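/- Let $n\ge 3$, $\alpha\in(1/2,1]$, and let $\tau,c_0,b,\nu>0$ with $b\nu<2c_0$. Consider the linear Cauchy problem on $\mathbb R^n$ $$(\tau\partial_t+1)\bigl(\varphi_{tt}-c_0^2\Delta\varphi+b\nu(-\Delta)^{\alpha}\varphi_t\bigr)=0\quad (t>0),\qquad (\varphi,\varphi_t,\varphi_{tt})(0,\cdot)=(\varphi_0,\varphi_1,\varphi_2),$$ whose solutions are understood as Sobolev solutions, $\varphi\in C^2([0,\infty),H^\sigma)$ for some $\sigma\in\mathbb R$. For $s\in\mathbb R$ and $j\in\{0,1,2\}$ let $\mathcal A^{(2)}_{s,j}$ be the space of the data with $$(\varphi_0,\varphi_1,\varphi_2)\in\begin{cases}(H^{s+2}\cap L^1)\times(H^{s+2\alpha}\cap L^1)\times(H^{s}\cap L^1), & j=0,\\ (H^{s+1}\cap L^1)\times(H^{s+1}\cap L^1)\times(H^{s+1-2\alpha}\cap L^1), & j=1,\\ (H^{s+2-2\alpha}\cap L^1)\times(H^{s+2-2\alpha}\cap L^1)\times(H^{s}\cap L^1), & j=2,\end{cases}$$ with its natural norm. Write $\|u\|_{\dot H^r}=\||D|^ru\|_{L^2}$,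 $P=\int_{\mathbb R^n}(\varphi_1+\tau\varphi_2)\,dx$, and $$\mathcal G_{2,j}(t,x)=\mathcal F^{-1}_{\xi\to x}\Bigl(\chi(\xi)\,\frac{\partial_t^j\sin(c_0|\xi|t)}{c_0|\xi|}\,e^{-\frac{b\nu}{2}|\xi|^{2\alpha}t}\Bigr),$$ where $\mathcal F f(\xi)=\int e^{-ix\cdot\xi}f(x)\,dx$ and $\chi\in C^\infty$ is any cut-off function with $\chi=1$ for $|\xi|\le\varepsilon_0/2$ and $\chi=0$ for $|\xi|\ge\varepsilon_0$, for some $\varepsilon_0>0$. (i) Let $j\in\{0,1,2\}$, and let $s=j-2$ or $s\ge0$. There are constants $C,c>0$, depending only on $n,\alpha,\tau,c_0,b,\nu,s,j$, such that for all data in $\mathcal A^{(2)}_{s,j}$ the solution satisfies $$\|\partial_t^j\varphi(t,\cdot)\|_{\dot H^{s+2-j}}\le C(1+t)^{-\frac{2s+n+2}{4\alpha}}\|(\varphi_0,\varphi_1,\varphi_2)\|_{\mathcal A^{(2)}_{s,j}}\quad\text{for all }t\ge0,$$ $$\|\partial_t^j\varphi(t,\cdot)-\mathcal G_{2,j}(t,\cdot)P\|_{\dot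 H^{s+2-j}}=o\bigl(t^{-\frac{2s+n+2}{4\alpha}}\bigr)\quad\text{as }t\to\infty,$$ and, if $P\ne0$, $$\|\partial_t^j\varphi(t,\cdot)\|_{\dot H^{s+2-j}}\ge c\,t^{-\frac{2s+n+2}{4\alpha}}|P|\quad\text{for all }t\ge T,$$ where $T$ may depend on the data. (ii) Let $s\ge0$. There are constants $C,c>0$, depending only on $n,\alpha,\tau,c_0,b,\nu,s$, such that for all data in $\mathcal A^{(2)}_{s+1-2\alpha,2}$ the solution satisfies $$\|\partial_t^2\varphi(t,\cdot)\|_{\dot H^{s+1-2\alpha}}\le C(1+t)^{-\frac{2s+n+4-4\alpha}{4\alpha}}\|(\varphi_0,\varphi_1,\varphi_2)\|_{\mathcal A^{(2)}_{s+1-2\alpha,2}}\quad\text{for all }t\ge0,$$ $$\|\partial_t^2\varphi(t,\cdot)-\mathcal G_{2,2}(t,\cdot)P\|_{\dot H^{s+1-2\alpha}}=o\bigl(t^{-\frac{2s+n+4-4\alpha}{4\alpha}}\bigr)\quad\text{as }t\to\infty,$$ and, if $P\ne0$, $$\|\partial_t^2\varphi(t,\cdot)\|_{\dot H^{s+1-2\alpha}}\ge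 c\,t^{-\frac{2s+n+4-4\alpha}{4\alpha}}|P|\quad\text{for all }t\ge T,$$ where $T$ may depend on the data. -/

import Mathlib

open MeasureTheory Filter Topology FourierTransform TemperedDistribution
open scoped SchwartzMap ENNReal ContDiff Laplacian

noncomputable section

/-- The whole space `ℝⁿ` with its Euclidean norm. -/
abbrev Space (n : ℕ) : Type := EuclideanSpace ℝ (Fin n)

/-- Tempered distributions on `ℝⁿ`, with complex values. -/
abbrev Distr (n : ℕ) : Type := 𝓢'(Space n, ℂ)

/-- The Fourier transform of the tempered distribution `u` is the function `g`. The transform is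
the one of Mathlib, `∫ exp (-2πi ⟨x, ξ⟩) u x dx`, so that the symbol of `|D|` is `2π‖ξ‖`. -/
def HasFourierFunction {n : ℕ} (u : Distr n) (g : Space n → ℂ) : Prop :=
  ∀ f : 𝓢(Space n, ℂ), Integrable (fun ξ => f ξ * g ξ) ∧ (𝓕 u) f = ∫ ξ, f ξ * g ξ

/-- `v = (-Δ)^α u`, where `(-Δ)^α` is the Fourier multiplier with symbol `|D|^(2α)`. -/
def IsFracLaplacian {n : ℕ} (α : ℝ) (u v : Distr n) : Prop :=
  ∃ g : Space n → ℂ, HasFourierFunction u g ∧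
    HasFourierFunction v (fun ξ => (((2 * Real.pi * ‖ξ‖) ^ (2 * α) : ℝ) : ℂ) * g ξ)

/-- The norm of the homogeneous space `Ḣ^r`, that is the `L²` norm of `|D|^r u`; it is `⊤` if the
Fourier transform of `u` is not a function or if `|D|^r u` is not in `L²`. The Fourier function is
unique up to null sets, so that the infimum runs over a single value at most. -/
def homSobolevNorm {n : ℕ} (r : ℝ) (u : Distr n) : ℝ≥0∞ :=
  ⨅ (g : Space n → ℂ) (_ : HasFourierFunction u g),
    eLpNorm (fun ξ => (((2 * Real.pi * ‖ξ‖) ^ r : ℝ) : ℂ) * g ξ) 2 volume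

/-- The norm of the inhomogeneous space `H^r`, the `L²` norm of the Bessel potential of order `r`
of `u`; it is `⊤` if `u` is not in `H^r`. -/
def sobolevNorm {n : ℕ} (r : ℝ) (u : Distr n) : ℝ≥0∞ :=
  ⨅ (f : Lp ℂ 2 (volume : Measure (Space n))) (_ : besselPotential (Space n) ℂ r u = f), ‖f‖ₑ

/-- The curve `u` belongs to `C([0,∞), H^r)`. -/
def IsSobolevContinuous {n : ℕ} (r : ℝ) (u : ℝ → Distr n) : Prop :=
  ∃ U : ℝ → Lp ℂ 2 (volume : Measure (Space n)), ContinuousOn U (Set.Ici 0) ∧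
    ∀ t, 0 ≤ t → besselPotential (Space n) ℂ r (u t) = U t

/-- `v = ∂ₜ u` on `[0,∞)` (one-sided at `t = 0`), in the topology of tempered distributions. -/
def IsTimeDeriv {n : ℕ} (u v : ℝ → Distr n) : Prop :=
  ∀ t, 0 ≤ t → ∀ f : 𝓢(Space n, ℂ),
    HasDerivWithinAt (fun r => u r f) (v t f) (Set.Ici 0) t

/-- `φ` is a Sobolev solution of the linear Cattaneo problem
`(τ ∂ₜ + 1) (φ_tt - c₀² Δ φ + b ν (-Δ)^α φ_t) = 0` for `t > 0`, with
`(φ, φ_t, φ_tt) = (φ₀, φ₁, φ₂)` at `t = 0`. Here `φ j` is the time derivative of order `j` of the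
solution `φ 0`, and `data j` is `φⱼ`. The solution is in `C²([0,∞), H^σ)` for some real `σ`. -/
structure IsCattaneoSolution {n : ℕ} (τ c₀ b ν α : ℝ)
    (data : Fin 3 → Lp ℂ 1 (volume : Measure (Space n))) (φ : Fin 3 → ℝ → Distr n) : Prop where
  regularity : ∃ σ : ℝ, ∀ j, IsSobolevContinuous σ (φ j)
  deriv_one : IsTimeDeriv (φ 0) (φ 1)
  deriv_two : IsTimeDeriv (φ 1) (φ 2)
  initial : ∀ j, φ j 0 = (data j : Distr n)
  equation : ∃ ψ w : ℝ → Distr n,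
    (∀ t, 0 < t → IsFracLaplacian α (φ 1 t) (ψ t)) ∧
    (∀ t, 0 < t → w t = φ 2 t - ((c₀ ^ 2 : ℝ) : ℂ) • Δ (φ 0 t) + ((b * ν : ℝ) : ℂ) • ψ t) ∧
    ∀ t, 0 < t → ∀ f : 𝓢(Space n, ℂ),
      ∃ d : ℂ, HasDerivAt (fun r => w r f) d t ∧ (τ : ℂ) * d + w t f = 0

/-- Row `j` holds the Sobolev orders of `φ₀`, `φ₁`, `φ₂` in the data space `𝒜⁽²⁾_{s,j}`. -/
def dataOrder (α s : ℝ) : Fin 3 → Fin 3 → ℝ :=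
  ![![s + 2, s + 2 * α, s],
    ![s + 1, s + 1, s + 1 - 2 * α],
    ![s + 2 - 2 * α, s + 2 - 2 * α, s]]

/-- Membership in `𝒜⁽²⁾_{s,j}`; each datum is in `L¹` by its type. -/
def MemDataSpace {n : ℕ} (α s : ℝ) (j : Fin 3)
    (data : Fin 3 → Lp ℂ 1 (volume : Measure (Space n))) : Prop :=
  ∀ k, MemSobolev (dataOrder α s j k) 2 (data k : Distr n)

/-- The norm of `𝒜⁽²⁾_{s,j}`: the sum of the `H^r` norms and of the `L¹` norms. -/
def dataNorm {n : ℕ} (α s : ℝ) (j : Fin 3)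
    (data : Fin 3 → Lp ℂ 1 (volume : Measure (Space n))) : ℝ≥0∞ :=
  ∑ k, (sobolevNorm (dataOrder α s j k) (data k : Distr n) + ‖data k‖ₑ)

/-- The mean `P_{φ₁ + τ φ₂}`. -/
def dataMean {n : ℕ} (τ : ℝ) (data : Fin 3 → Lp ℂ 1 (volume : Measure (Space n))) : ℂ :=
  ∫ x, (data 1 x + (τ : ℂ) * data 2 x)

/-- A smooth cut-off function to low frequencies: it is `1` for `‖ξ‖ ≤ ε₀ / 2` and vanishes
for `‖ξ‖ ≥ ε₀`. -/
structure LowFreqCutoff (n : ℕ) where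
  ε₀ : ℝ
  pos : 0 < ε₀
  toFun : Space n → ℝ
  smooth : ContDiff ℝ ∞ toFun
  eq_one : ∀ ξ, ‖ξ‖ ≤ ε₀ / 2 → toFun ξ = 1
  eq_zero : ∀ ξ, ε₀ ≤ ‖ξ‖ → toFun ξ = 0

/-- The function `χ(η) (∂ₜ^j sin (c₀|η|t)) / (c₀|η|) exp (-(bν/2) |η|^(2α) t)` at `η = 2πξ`. -/
def profileSymbol {n : ℕ} (c₀ b ν α : ℝ) (χ : LowFreqCutoff n) (j : ℕ) (t : ℝ)
    (ξ : Space n) : ℂ :=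
  ((χ.toFun ((2 * Real.pi) • ξ) *
    (iteratedDeriv j (fun r : ℝ => Real.sin (c₀ * (2 * Real.pi * ‖ξ‖) * r)) t /
      (c₀ * (2 * Real.pi * ‖ξ‖))) *
    Real.exp (-(b * ν / 2) * (2 * Real.pi * ‖ξ‖) ^ (2 * α) * t) : ℝ) : ℂ)

theorem profileSymbol_memLp {n : ℕ} (c₀ b ν : ℝ) {α : ℝ} (hα : α ∈ Set.Ioc (1 / 2 : ℝ) 1)
    (χ : LowFreqCutoff n) (j : ℕ) (t : ℝ) :
    MemLp (profileSymbol c₀ b ν α χ j t) 2 volume := by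
  have hα₀ : 0 ≤ 2 * α := by linarith [hα.1]
  have hπ : 0 < 2 * Real.pi := by positivity
  have hsin : ∀ x y : ℝ, iteratedDeriv j (fun r : ℝ => Real.sin (x * r)) y
      = x ^ j * iteratedDeriv j Real.sin (x * y) := by
    intro x y
    rw [iteratedDeriv_comp_const_mul (Real.contDiff_sin.of_le le_top)]
  have hone : ∀ (k : ℕ) (y : ℝ), |iteratedDeriv k Real.sin y| ≤ 1 := fun k y =>
    Real.abs_iteratedDeriv_sin_le_one k y
  obtain ⟨R, hR⟩ : ∃ R : ℝ, R = χ.ε₀ / (2 * Real.pi) := ⟨_, rfl⟩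
  have hzero : ∀ ξ : Space n, R < ‖ξ‖ → profileSymbol c₀ b ν α χ j t ξ = 0 := by
    intro ξ hξ
    have : χ.toFun ((2 * Real.pi) • ξ) = 0 := by
      apply χ.eq_zero
      rw [norm_smul, Real.norm_of_nonneg hπ.le]
      rw [hR, div_lt_iff₀ hπ] at hξ
      linarith
    simp [profileSymbol, this]
  have hmeas : Measurable (profileSymbol c₀ b ν α χ j t) := by
    unfold profileSymbol
    simp only [hsin]
    have h1 : Continuous (iteratedDeriv j Real.sin) :=
      (Real.differentiable_iteratedDeriv_sin j).continuous
    have h2 : Continuous χ.toFun := χ.smooth.continuous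
    have h3 := h1.measurable
    have h4 := h2.measurable
    fun_prop
  have hcont : Continuous (fun ξ : Space n => |χ.toFun ((2 * Real.pi) • ξ)| *
      (|t| + |c₀ * (2 * Real.pi * ‖ξ‖)| ^ (j - 1)) *
      Real.exp (-(b * ν / 2) * (2 * Real.pi * ‖ξ‖) ^ (2 * α) * t)) := by
    have h2 : Continuous χ.toFun := χ.smooth.continuous
    have h3 : Continuous (fun ξ : Space n => (2 * Real.pi * ‖ξ‖) ^ (2 * α)) :=
      (continuous_const.mul continuous_norm).rpow_const (fun _ => Or.inr hα₀)
    fun_prop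
  obtain ⟨M, hM⟩ := (isCompact_closedBall (0 : Space n) R).exists_bound_of_continuousOn
    hcont.continuousOn
  have hbound : ∀ x y : ℝ, |iteratedDeriv j (fun r : ℝ => Real.sin (x * r)) y / x|
      ≤ |y| + |x| ^ (j - 1) := by
    intro x y
    rcases eq_or_ne x 0 with rfl | hx
    · simp only [div_zero, abs_zero]; positivity
    have hx' : 0 < |x| := abs_pos.mpr hx
    rw [hsin, abs_div, abs_mul, abs_pow, div_le_iff₀ hx']
    rcases j with _ | k
    · have := Real.abs_sin_le_abs (x := x * y)
      rw [abs_mul] at this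
      simp only [pow_zero, iteratedDeriv_zero, one_mul]
      have h0 : 0 ≤ |x| ^ (0 - 1) * |x| := by positivity
      linarith
    · have h1 := mul_le_of_le_one_right (by positivity : 0 ≤ |x| ^ (k + 1)) (hone (k + 1) (x * y))
      have h0 : 0 ≤ |y| * |x| := by positivity
      have h2 : |x| ^ (k + 1 - 1) * |x| = |x| ^ (k + 1) := by
        rw [Nat.add_sub_cancel, pow_succ]
      linarith
  have hM' : ∀ ξ ∈ Metric.closedBall (0 : Space n) R, ‖profileSymbol c₀ b ν α χ j t ξ‖ ≤ M := by
    intro ξ hξ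
    refine le_trans ?_ (le_trans (le_abs_self _) (hM ξ hξ))
    unfold profileSymbol
    rw [Complex.norm_real, Real.norm_eq_abs, abs_mul, abs_mul, Real.abs_exp]
    gcongr
    exact hbound _ _
  have hind : profileSymbol c₀ b ν α χ j t =
      (Metric.closedBall (0 : Space n) R).indicator (profileSymbol c₀ b ν α χ j t) := by
    ext ξ
    by_cases h : ξ ∈ Metric.closedBall (0 : Space n) R
    · rw [Set.indicator_of_mem h]
    · rw [Set.indicator_of_notMem h]
      apply hzero
      simpa using h
  rw [hind, memLp_indicator_iff_restrict Metric.isClosed_closedBall.measurableSet]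
  have : IsFiniteMeasure (volume.restrict (Metric.closedBall (0 : Space n) R)) :=
    ⟨by simpa using measure_closedBall_lt_top⟩
  refine MemLp.of_bound hmeas.aestronglyMeasurable M ?_
  exact (ae_restrict_iff' Metric.isClosed_closedBall.measurableSet).2 (ae_of_all _ hM')

/-- The diffusion wave profile `𝒢_{2,j}(t, ·)`, the inverse Fourier transform of the symbol above. -/
def profile {n : ℕ} (c₀ b ν : ℝ) {α : ℝ} (hα : α ∈ Set.Ioc (1 / 2 : ℝ) 1)
    (χ : LowFreqCutoff n) (j : ℕ) (t : ℝ) : Distr n :=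
  𝓕⁻ (((profileSymbol_memLp c₀ b ν hα χ j t).toLp _ :
    Lp ℂ 2 (volume : Measure (Space n))) : Distr n)

end

/-! On the Fourier side the problem is an ordinary differential equation at each frequency. With x =
|ξ|, β = bν x^(2α), γ = c₀² x² and μ = 1/τ it reads (∂ₜ + μ)(y'' + β y' + γ y) = 0. Let E be the
solution of the damped wave factor with E(0) = 0, E'(0) = 1 (`waveKernel`), and let K be the
convolution of exp(-μt) with E (`cattaneoKernel`). The solution is a combination of the data with
coefficients built from E and K (`dataKernel`), and all estimates are estimates of these
coefficients.

Low frequencies decide the rate. Since 2α > 1, β is small against c₀x, so E oscillates under the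
damping exp(-βt/2). Inverting ∂ₜ + μ there costs only a factor: K = E/μ up to exp(-μt) and terms
smaller by a power of x. Hence the transform of φ is close to (φ̂₁ + τφ̂₂)(ξ) E. The first factor is
close to P near the origin, because transforms of L¹ functions are continuous, and E differs from
the profile by a relative error of order x^(2α-1). The majorant x^(s+1) exp(-k x^(2α) t) has an L²
norm governed by the scale x ~ t^(-1/(2α)), which gives the rate, the same for every j at fixed s.
Away from the origin both characteristic roots stay to the left of a vertical line Re λ = -δ, so
everything decays exponentially. The powers of β and γ that the coefficients can absorb there
(`kernelWeight`) are what fixes the Sobolev orders of the data.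

For the o(·) statement the ball around the origin is shrunk until the low frequency error has a
prescribed small constant; the rest decays exponentially (`exists_evolution_sub_profileSymbol_le`).
For the lower bound the profile is integrated over a shell x ~ t^(-1/(2α)). There c₀xt tends to
infinity, again because 2α > 1, so sin² and cos² average to 1/2
(`le_eLpNorm_indicator_rpow_mul_osc`), and the o(·) statement transfers the bound to φ.

It remains to see that every Sobolev solution is the one given by the kernels
(`IsCattaneoSolution.hasFourierFunction`). Continuity in H^σ upgrades the distributional time
derivatives to derivatives in a weighted L² space. After restriction to a ball of frequencies the
coefficients are bounded multiplication operators, and Grönwall's inequality gives uniqueness. -/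

noncomputable section

/-! ### The kernels of the ordinary differential equation in Fourier space -/

/-- The convolution of `exp (l ·)` and `f` on `[0, t]`. -/
def expConv (l : ℂ) (f : ℝ → ℂ) (t : ℝ) : ℂ := ∫ r in (0 : ℝ)..t, Complex.exp (l * (t - r)) * f r

theorem expConv_eq (l : ℂ) (f : ℝ → ℂ) (t : ℝ) :
    expConv l f t = Complex.exp (l * t) * ∫ r in (0 : ℝ)..t, Complex.exp (-l * r) * f r := by
  rw [expConv, ← intervalIntegral.integral_const_mul]
  congr 1
  ext r
  rw [← mul_assoc, ← Complex.exp_add]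
  ring_nf

theorem expConv_zero (l : ℂ) (f : ℝ → ℂ) : expConv l f 0 = 0 := by simp [expConv]

theorem hasDerivAt_exp_mul_ofReal (l : ℂ) (t : ℝ) :
    HasDerivAt (fun t : ℝ => Complex.exp (l * t)) (l * Complex.exp (l * t)) t := by
  have h1 : HasDerivAt (fun t : ℝ => l * (t : ℂ)) l t := by
    simpa using (Complex.ofRealCLM.hasDerivAt (x := t)).const_mul l
  simpa [mul_comm] using h1.cexp

theorem hasDerivAt_expConv (l : ℂ) {f : ℝ → ℂ} (hf : Continuous f) (t : ℝ) :
    HasDerivAt (expConv l f) (l * expConv l f t + f t) t := by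
  have hc : Continuous fun r : ℝ => Complex.exp (-l * r) * f r := by fun_prop
  have h2 := intervalIntegral.integral_hasDerivAt_right (hc.intervalIntegrable 0 t)
    (hc.stronglyMeasurableAtFilter _ _) hc.continuousAt
  have h := (hasDerivAt_exp_mul_ofReal l t).mul h2
  have he : expConv l f = (fun t : ℝ => Complex.exp (l * t)) *
      fun t => ∫ r in (0 : ℝ)..t, Complex.exp (-l * r) * f r := by
    ext t; exact expConv_eq l f t
  rw [he]
  refine h.congr_deriv ?_
  simp only [Pi.mul_apply, neg_mul]
  rw [← mul_assoc (Complex.exp (l * t)) (Complex.exp (-(l * t))), ← Complex.exp_add]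
  simp [mul_assoc]

/-- A uniqueness statement for `y' = l y`. -/
theorem eq_exp_mul_of_hasDerivAt {l : ℂ} {y : ℝ → ℂ} (hy : ∀ t, HasDerivAt y (l * y t) t) (t : ℝ) :
    y t = Complex.exp (l * t) * y 0 := by
  have h : ∀ t, HasDerivAt (fun t : ℝ => Complex.exp (-l * t) * y t) 0 t := by
    intro t
    refine ((hasDerivAt_exp_mul_ofReal (-l) t).mul (hy t)).congr_deriv ?_
    ring
  have := is_const_of_deriv_eq_zero (fun t => (h t).differentiableAt) (fun t => (h t).deriv) t 0
  simp only [Complex.ofReal_zero, mul_zero, Complex.exp_zero, one_mul] at this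
  rw [← this, ← mul_assoc, ← Complex.exp_add]
  simp

/-- A square root of `β² / 4 - γ`. -/
def rootDisc (β γ : ℝ) : ℂ := (√(β ^ 2 / 4 - γ) : ℝ) + (√(γ - β ^ 2 / 4) : ℝ) * Complex.I

/-- At most one of the two real square roots in `rootDisc` is nonzero, so no cross term appears.
Unlike the principal complex root, this choice is continuous in (β, γ) across the cut, as
`continuous_waveKernel` needs. -/
theorem rootDisc_sq (β γ : ℝ) : rootDisc β γ ^ 2 = ((β ^ 2 / 4 - γ : ℝ) : ℂ) := by
  unfold rootDisc
  rcases le_total (β ^ 2 / 4) γ with h | h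
  · rw [Real.sqrt_eq_zero_of_nonpos (by linarith : β ^ 2 / 4 - γ ≤ 0)]
    rw [Complex.ofReal_zero, zero_add, mul_pow, Complex.I_sq, ← Complex.ofReal_pow,
      Real.sq_sqrt (by linarith)]
    push_cast; ring
  · rw [Real.sqrt_eq_zero_of_nonpos (by linarith : γ - β ^ 2 / 4 ≤ 0)]
    rw [Complex.ofReal_zero, zero_mul, add_zero, ← Complex.ofReal_pow, Real.sq_sqrt (by linarith)]

/-- The first root of `λ² + β λ + γ`. -/
def charRootOne (β γ : ℝ) : ℂ := -(β / 2 : ℝ) + rootDisc β γ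

/-- The second root of `λ² + β λ + γ`. -/
def charRootTwo (β γ : ℝ) : ℂ := -(β / 2 : ℝ) - rootDisc β γ

theorem charRootOne_add_charRootTwo (β γ : ℝ) : charRootOne β γ + charRootTwo β γ = -β := by
  simp [charRootOne, charRootTwo]; ring

theorem charRootOne_mul_charRootTwo (β γ : ℝ) : charRootOne β γ * charRootTwo β γ = γ := by
  have := rootDisc_sq β γ
  simp only [charRootOne, charRootTwo]
  linear_combination (norm := (push_cast; ring)) -this

/-- The derivative of order `j` of the solution of `y'' + β y' + γ y = 0` with `y 0 = 0` and
`y' 0 = 1`. -/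
def waveKernel (β γ : ℝ) : ℕ → ℝ → ℂ
  -- The convolution replaces the quotient (exp(λ₁t) - exp(λ₂t))/(λ₁ - λ₂). It needs no case
  -- distinction at a double root and is continuous in the parameters.
  | 0, t => expConv (charRootOne β γ) (fun r : ℝ => Complex.exp (charRootTwo β γ * r)) t
  | 1, t => charRootOne β γ *
      expConv (charRootOne β γ) (fun r : ℝ => Complex.exp (charRootTwo β γ * r)) t +
      Complex.exp (charRootTwo β γ * t)
  | j + 2, t => -β * waveKernel β γ (j + 1) t - γ * waveKernel β γ j t

theorem waveKernel_add_two (β γ : ℝ) (j : ℕ) (t : ℝ) :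
    waveKernel β γ (j + 2) t = -β * waveKernel β γ (j + 1) t - γ * waveKernel β γ j t := by
  rw [waveKernel]

theorem waveKernel_one (β γ : ℝ) (t : ℝ) : waveKernel β γ 1 t =
    charRootOne β γ * waveKernel β γ 0 t + Complex.exp (charRootTwo β γ * t) := by
  simp [waveKernel]

theorem hasDerivAt_waveKernel (β γ : ℝ) (j : ℕ) (t : ℝ) :
    HasDerivAt (waveKernel β γ j) (waveKernel β γ (j + 1) t) t := by
  have h0 : ∀ t, HasDerivAt (waveKernel β γ 0) (waveKernel β γ 1 t) t := fun t => by
    have he : waveKernel β γ 0 = expConv (charRootOne β γ)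
        (fun r : ℝ => Complex.exp (charRootTwo β γ * r)) := by ext t; simp [waveKernel]
    rw [he, waveKernel]
    exact hasDerivAt_expConv _ (by fun_prop) t
  induction j using Nat.twoStepInduction generalizing t with
  | zero => exact h0 t
  | one =>
    have he : waveKernel β γ 1 = fun t => charRootOne β γ * waveKernel β γ 0 t +
        Complex.exp (charRootTwo β γ * t) := by ext t; exact waveKernel_one β γ t
    rw [he]
    refine (((h0 t).const_mul (charRootOne β γ)).add
      (hasDerivAt_exp_mul_ofReal (charRootTwo β γ) t)).congr_deriv ?_
    rw [waveKernel_add_two, waveKernel_one]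
    -- Vieta's formulas turn λ₁E' + λ₂ exp(λ₂t) into -βE' - γE.
    linear_combination (charRootOne β γ * waveKernel β γ 0 t + Complex.exp (charRootTwo β γ * t))
      * charRootOne_add_charRootTwo β γ
      - waveKernel β γ 0 t * charRootOne_mul_charRootTwo β γ
  | more j hj hj1 =>
    have he : waveKernel β γ (j + 2) = fun t =>
        -β * waveKernel β γ (j + 1) t - γ * waveKernel β γ j t := by
      ext t; exact waveKernel_add_two β γ j t
    rw [he, waveKernel_add_two]
    exact ((hj1 t).const_mul _).sub ((hj t).const_mul _)

theorem continuous_waveKernel_apply (β γ : ℝ) (j : ℕ) : Continuous (waveKernel β γ j) :=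
  continuous_iff_continuousAt.2 fun t => (hasDerivAt_waveKernel β γ j t).continuousAt

theorem waveKernel_zero_zero (β γ : ℝ) : waveKernel β γ 0 0 = 0 := by
  simp [waveKernel, expConv_zero]

theorem waveKernel_one_zero (β γ : ℝ) : waveKernel β γ 1 0 = 1 := by
  simp [waveKernel, expConv_zero]

/-- The derivative of order `j` of the solution of
`(∂ₜ + μ) (y'' + β y' + γ y) = 0` with `y 0 = y' 0 = 0` and `y'' 0 = 1`. -/
def cattaneoKernel (μ β γ : ℝ) : ℕ → ℝ → ℂ
  | 0, t => expConv (-μ) (waveKernel β γ 0) t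
  -- K' + μK = E, differentiated j times.
  | j + 1, t => waveKernel β γ j t - μ * cattaneoKernel μ β γ j t

theorem cattaneoKernel_succ (μ β γ : ℝ) (j : ℕ) (t : ℝ) : cattaneoKernel μ β γ (j + 1) t =
    waveKernel β γ j t - μ * cattaneoKernel μ β γ j t := by
  rw [cattaneoKernel]

theorem hasDerivAt_cattaneoKernel (μ β γ : ℝ) (j : ℕ) (t : ℝ) :
    HasDerivAt (cattaneoKernel μ β γ j) (cattaneoKernel μ β γ (j + 1) t) t := by
  induction j generalizing t with
  | zero =>
    have he : cattaneoKernel μ β γ 0 = expConv (-μ) (waveKernel β γ 0) := by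
      ext t; simp [cattaneoKernel]
    rw [cattaneoKernel_succ, he]
    refine (hasDerivAt_expConv (-μ : ℂ) (continuous_waveKernel_apply β γ 0) t).congr_deriv ?_
    ring
  | succ j hj =>
    have he : cattaneoKernel μ β γ (j + 1) =
        fun t => waveKernel β γ j t - μ * cattaneoKernel μ β γ j t := by
      ext t; exact cattaneoKernel_succ μ β γ j t
    rw [he, cattaneoKernel_succ]
    exact (hasDerivAt_waveKernel β γ j t).sub ((hj t).const_mul _)

theorem cattaneoKernel_zero_zero (μ β γ : ℝ) : cattaneoKernel μ β γ 0 0 = 0 := by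
  simp [cattaneoKernel, expConv_zero]

/-- The function w = K'' + βK' + γK satisfies w' = -μw and w(0) = 1, because (∂ₜ + μ)K = E and E is
annihilated by the wave factor. Larger j follow from the recursion. -/
theorem cattaneoKernel_relation (μ β γ : ℝ) (j : ℕ) (t : ℝ) :
    cattaneoKernel μ β γ (j + 2) t + β * cattaneoKernel μ β γ (j + 1) t +
      γ * cattaneoKernel μ β γ j t = (-μ) ^ j * Complex.exp (-μ * t) := by
  induction j with
  | zero =>
    have h : ∀ t, HasDerivAt (fun t => cattaneoKernel μ β γ 2 t + β * cattaneoKernel μ β γ 1 t +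
        γ * cattaneoKernel μ β γ 0 t) (-μ * (cattaneoKernel μ β γ 2 t +
        β * cattaneoKernel μ β γ 1 t + γ * cattaneoKernel μ β γ 0 t)) t := by
      intro t
      refine (((hasDerivAt_cattaneoKernel μ β γ 2 t).add
        ((hasDerivAt_cattaneoKernel μ β γ 1 t).const_mul (β : ℂ))).add
        ((hasDerivAt_cattaneoKernel μ β γ 0 t).const_mul (γ : ℂ))).congr_deriv ?_
      have h1 := waveKernel_add_two β γ 0 t
      rw [cattaneoKernel_succ μ β γ 2, cattaneoKernel_succ μ β γ 1, cattaneoKernel_succ μ β γ 0]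
      linear_combination h1
    have := eq_exp_mul_of_hasDerivAt h t
    simp only [cattaneoKernel_succ, cattaneoKernel_zero_zero, waveKernel_zero_zero,
      waveKernel_one_zero] at this ⊢
    simpa using this
  | succ j hj =>
    have h1 := waveKernel_add_two β γ j t
    rw [cattaneoKernel_succ μ β γ (j + 2), cattaneoKernel_succ μ β γ (j + 1),
      cattaneoKernel_succ μ β γ j] at *
    linear_combination h1 - μ * hj

/-- K' and K'' are eliminated with K' = E - μK. The prefactor is the characteristic polynomial at
-μ. It can vanish in general but is at least μ²/2 at low frequencies, where this formula compares K
with E/μ. -/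
theorem cattaneoKernel_eq_waveKernel (μ β γ : ℝ) (j : ℕ) (t : ℝ) :
    (μ ^ 2 - μ * β + γ) * cattaneoKernel μ β γ j t = (-μ) ^ j * Complex.exp (-μ * t) -
      waveKernel β γ (j + 1) t + (μ - β) * waveKernel β γ j t := by
  have h := cattaneoKernel_relation μ β γ j t
  rw [cattaneoKernel_succ μ β γ (j + 1), cattaneoKernel_succ μ β γ j] at h
  linear_combination h

/-- The coefficient of the datum number `k` in the derivative of order `j` of the solution of
`(∂ₜ + μ) (y'' + β y' + γ y) = 0`. -/
def dataKernel (μ β γ : ℝ) (k : Fin 3) (j : ℕ) (t : ℝ) : ℂ :=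
  match k with
  -- The source of the second order equation is exp(-μt) (φ₂ + βφ₁ + γφ₀), whose response is K times
  -- the bracket. The homogeneous part is φ₀(E' + βE) + φ₁E.
  | 0 => waveKernel β γ (j + 1) t + β * waveKernel β γ j t + γ * cattaneoKernel μ β γ j t
  | 1 => waveKernel β γ j t + β * cattaneoKernel μ β γ j t
  | 2 => cattaneoKernel μ β γ j t

theorem hasDerivAt_dataKernel (μ β γ : ℝ) (k : Fin 3) (j : ℕ) (t : ℝ) :
    HasDerivAt (dataKernel μ β γ k j) (dataKernel μ β γ k (j + 1) t) t := by
  fin_cases k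
  · exact ((hasDerivAt_waveKernel β γ (j + 1) t).add
      ((hasDerivAt_waveKernel β γ j t).const_mul _)).add
      ((hasDerivAt_cattaneoKernel μ β γ j t).const_mul _)
  · exact (hasDerivAt_waveKernel β γ j t).add ((hasDerivAt_cattaneoKernel μ β γ j t).const_mul _)
  · exact hasDerivAt_cattaneoKernel μ β γ j t

theorem dataKernel_zero (μ β γ : ℝ) (k : Fin 3) :
    dataKernel μ β γ k 0 0 = if k = 0 then 1 else 0 := by
  fin_cases k <;> simp [dataKernel, waveKernel_zero_zero, waveKernel_one_zero,
    cattaneoKernel_zero_zero]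

theorem dataKernel_one (μ β γ : ℝ) (k : Fin 3) :
    dataKernel μ β γ k 1 0 = if k = 1 then 1 else 0 := by
  fin_cases k <;> simp [dataKernel, waveKernel_zero_zero, waveKernel_one_zero,
    cattaneoKernel_zero_zero, cattaneoKernel_succ, waveKernel_add_two]

theorem dataKernel_relation (μ β γ : ℝ) (k : Fin 3) (t : ℝ) :
    dataKernel μ β γ k 2 t + β * dataKernel μ β γ k 1 t + γ * dataKernel μ β γ k 0 t =
      ![(γ : ℂ), β, 1] k * Complex.exp (-μ * t) := by
  have h := cattaneoKernel_relation μ β γ 0 t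
  have h0 := waveKernel_add_two β γ 0 t
  have h1 := waveKernel_add_two β γ 1 t
  fin_cases k
  · change _ = (γ : ℂ) * _
    simp only [dataKernel]
    linear_combination h1 + β * h0 + γ * h
  · change _ = (β : ℂ) * _
    simp only [dataKernel]
    linear_combination h0 + β * h
  · change _ = (1 : ℂ) * _
    simp only [dataKernel]
    linear_combination h

theorem continuous_expConv {X : Type*} [TopologicalSpace X] {l : X → ℂ} {f : X → ℝ → ℂ} {t : X → ℝ}
    (hl : Continuous l) (hf : Continuous (Function.uncurry f)) (ht : Continuous t) :
    Continuous fun x => expConv (l x) (f x) (t x) := by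
  unfold expConv
  apply intervalIntegral.continuous_parametric_intervalIntegral_of_continuous _ ht
  have : Continuous fun p : X × ℝ => f p.1 p.2 := hf
  simp only [Function.uncurry_def]
  fun_prop

theorem continuous_waveKernel (j : ℕ) :
    Continuous fun p : (ℝ × ℝ) × ℝ => waveKernel p.1.1 p.1.2 j p.2 := by
  have hr : Continuous fun p : (ℝ × ℝ) × ℝ => rootDisc p.1.1 p.1.2 := by
    unfold rootDisc; fun_prop
  have h1 : Continuous fun p : (ℝ × ℝ) × ℝ => charRootOne p.1.1 p.1.2 := by
    unfold charRootOne; fun_prop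
  have h2 : Continuous fun p : (ℝ × ℝ) × ℝ => charRootTwo p.1.1 p.1.2 := by
    unfold charRootTwo; fun_prop
  have h0 : Continuous fun p : (ℝ × ℝ) × ℝ => waveKernel p.1.1 p.1.2 0 p.2 := by
    simp only [waveKernel]
    apply continuous_expConv h1 _ continuous_snd
    have := h2.comp (continuous_fst (X := (ℝ × ℝ) × ℝ) (Y := ℝ))
    simp only [Function.comp_def] at this
    simp only [Function.uncurry_def]
    fun_prop
  induction j using Nat.twoStepInduction with
  | zero => exact h0
  | one => simp only [waveKernel_one]; fun_prop
  | more j hj hj1 => simp only [waveKernel_add_two]; fun_prop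

theorem continuous_cattaneoKernel (μ : ℝ) (j : ℕ) :
    Continuous fun p : (ℝ × ℝ) × ℝ => cattaneoKernel μ p.1.1 p.1.2 j p.2 := by
  induction j with
  | zero =>
    simp only [cattaneoKernel]
    apply continuous_expConv continuous_const _ continuous_snd
    exact (continuous_waveKernel 0).comp
      (by fun_prop : Continuous fun p : ((ℝ × ℝ) × ℝ) × ℝ => ((p.1.1.1, p.1.1.2), p.2))
  | succ j hj =>
    have := continuous_waveKernel j
    simp only [cattaneoKernel_succ]; fun_prop

theorem continuous_dataKernel (μ : ℝ) (k : Fin 3) (j : ℕ) :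
    Continuous fun p : (ℝ × ℝ) × ℝ => dataKernel μ p.1.1 p.1.2 k j p.2 := by
  have h0 := continuous_waveKernel j
  have h1 := continuous_waveKernel (j + 1)
  have h2 := continuous_cattaneoKernel μ j
  fin_cases k <;> simp only [dataKernel] <;> fun_prop

/-! ### Estimates of the kernels at low frequencies -/

theorem expConv_exp {l m : ℂ} (h : l ≠ m) (t : ℝ) :
    expConv l (fun r : ℝ => Complex.exp (m * r)) t =
      (Complex.exp (l * t) - Complex.exp (m * t)) / (l - m) := by
  have h' : m - l ≠ 0 := sub_ne_zero.2 h.symm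
  have h'' : l - m ≠ 0 := sub_ne_zero.2 h
  have hi : ∀ r : ℝ, Complex.exp (-l * r) * Complex.exp (m * r) = Complex.exp ((m - l) * r) := by
    intro r; rw [← Complex.exp_add]; ring_nf
  rw [expConv_eq]
  simp only [hi]
  rw [integral_exp_mul_complex h', mul_div_assoc', mul_sub, ← Complex.exp_add,
    div_eq_div_iff h' h'']
  simp only [Complex.ofReal_zero, mul_zero, Complex.exp_zero]
  ring_nf

section LowFrequency

variable {a β μ t : ℝ}

/-- With w the frequency of the damped oscillation, (a - w)(a + w) = β²/4. Hence the damping shifts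
the frequency only to second order in β. -/
theorem lowFreq_root (ha : 0 < a) (hβ : 0 ≤ β) (hβa : β ≤ a) :
    a / 2 ≤ √(a ^ 2 - β ^ 2 / 4) ∧ √(a ^ 2 - β ^ 2 / 4) ≤ a ∧
      a - √(a ^ 2 - β ^ 2 / 4) ≤ β ^ 2 / (4 * a) ∧ β / 2 ≤ √(a ^ 2 - β ^ 2 / 4) := by
  have hb : β ^ 2 ≤ a ^ 2 := by gcongr
  have h1 : a / 2 ≤ √(a ^ 2 - β ^ 2 / 4) := Real.le_sqrt_of_sq_le (by nlinarith)
  have h2 : √(a ^ 2 - β ^ 2 / 4) ≤ a := by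
    rw [Real.sqrt_le_left ha.le]; nlinarith
  refine ⟨h1, h2, ?_, by linarith⟩
  have h3 : √(a ^ 2 - β ^ 2 / 4) ^ 2 = a ^ 2 - β ^ 2 / 4 := Real.sq_sqrt (by nlinarith)
  rw [le_div_iff₀ (by positivity)]
  nlinarith

theorem rootDisc_lowFreq (ha : 0 < a) (hβ : 0 ≤ β) (hβa : β ≤ a) :
    rootDisc β (a ^ 2) = (√(a ^ 2 - β ^ 2 / 4) : ℝ) * Complex.I := by
  have hb : β ^ 2 ≤ a ^ 2 := pow_le_pow_left₀ hβ hβa 2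
  have := sq_pos_of_pos ha
  rw [rootDisc, Real.sqrt_eq_zero_of_nonpos (by nlinarith : β ^ 2 / 4 - a ^ 2 ≤ 0)]
  simp

theorem waveKernel_zero_lowFreq (ha : 0 < a) (hβ : 0 ≤ β) (hβa : β ≤ a) (t : ℝ) :
    waveKernel β (a ^ 2) 0 t = ((Real.exp (-(β / 2) * t) *
      (Real.sin (√(a ^ 2 - β ^ 2 / 4) * t) / √(a ^ 2 - β ^ 2 / 4)) : ℝ) : ℂ) := by
  have hw := (lowFreq_root ha hβ hβa).1
  have hr := rootDisc_lowFreq ha hβ hβa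
  generalize √(a ^ 2 - β ^ 2 / 4) = w at *
  have hw0 : 0 < w := by linarith
  have hwc : (w : ℂ) ≠ 0 := by exact_mod_cast hw0.ne'
  have hd : charRootOne β (a ^ 2) - charRootTwo β (a ^ 2) = 2 * (w * Complex.I) := by
    simp only [charRootOne, charRootTwo, hr]; ring
  have hne : charRootOne β (a ^ 2) ≠ charRootTwo β (a ^ 2) := by
    rw [← sub_ne_zero, hd]; simp [hwc]
  rw [waveKernel, expConv_exp hne, hd, charRootOne, charRootTwo, hr, add_mul, sub_mul,
    sub_eq_add_neg ((-((β / 2 : ℝ) : ℂ)) * t), Complex.exp_add, Complex.exp_add]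
  have e1 : (w : ℂ) * Complex.I * t = ((w * t : ℝ) : ℂ) * Complex.I := by push_cast; ring
  rw [e1, ← neg_mul, Complex.exp_mul_I, Complex.exp_mul_I, Complex.cos_neg, Complex.sin_neg]
  push_cast
  field_simp
  ring

theorem waveKernel_one_lowFreq (ha : 0 < a) (hβ : 0 ≤ β) (hβa : β ≤ a) (t : ℝ) :
    waveKernel β (a ^ 2) 1 t = ((Real.exp (-(β / 2) * t) *
      (Real.cos (√(a ^ 2 - β ^ 2 / 4) * t) - β / 2 *
      (Real.sin (√(a ^ 2 - β ^ 2 / 4) * t) / √(a ^ 2 - β ^ 2 / 4))) : ℝ) : ℂ) := by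
  rw [waveKernel_one, waveKernel_zero_lowFreq ha hβ hβa]
  have hw := (lowFreq_root ha hβ hβa).1
  have hr := rootDisc_lowFreq ha hβ hβa
  generalize √(a ^ 2 - β ^ 2 / 4) = w at *
  have hw0 : 0 < w := by linarith
  have hwc : (w : ℂ) ≠ 0 := by exact_mod_cast hw0.ne'
  rw [charRootOne, charRootTwo, hr, sub_mul,
    sub_eq_add_neg ((-((β / 2 : ℝ) : ℂ)) * t), Complex.exp_add]
  have e1 : (w : ℂ) * Complex.I * t = ((w * t : ℝ) : ℂ) * Complex.I := by push_cast; ring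
  rw [e1, ← neg_mul, Complex.exp_mul_I, Complex.cos_neg, Complex.sin_neg]
  push_cast
  field_simp
  ring

theorem abs_sin_div_lowFreq_le (ha : 0 < a) (hβ : 0 ≤ β) (hβa : β ≤ a) (t : ℝ) :
    |Real.sin (√(a ^ 2 - β ^ 2 / 4) * t) / √(a ^ 2 - β ^ 2 / 4)| ≤ 2 / a := by
  have hw := (lowFreq_root ha hβ hβa).1
  generalize √(a ^ 2 - β ^ 2 / 4) = w at *
  have hw0 : 0 < w := by linarith
  rw [abs_div, abs_of_pos hw0, div_le_div_iff₀ hw0 ha]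
  have := Real.abs_sin_le_one (w * t)
  nlinarith

/-- Since β ≤ a, the recursion E'' = -βE' - a²E shows that each time derivative costs at most a
factor 2a. The factor a on the left accounts for the size 1/a of E. -/
theorem norm_waveKernel_lowFreq_le (ha : 0 < a) (hβ : 0 ≤ β) (hβa : β ≤ a) (t : ℝ) (j : ℕ) :
    a * ‖waveKernel β (a ^ 2) j t‖ ≤ 2 ^ (j + 1) * a ^ j * Real.exp (-(β / 2) * t) := by
  have hs := abs_sin_div_lowFreq_le ha hβ hβa t
  have he := (Real.exp_pos (-(β / 2) * t)).le
  induction j using Nat.twoStepInduction with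
  | zero =>
    rw [waveKernel_zero_lowFreq ha hβ hβa, Complex.norm_real, Real.norm_eq_abs, abs_mul,
      Real.abs_exp]
    calc _ ≤ a * (Real.exp (-(β / 2) * t) * (2 / a)) := by gcongr
      _ = _ := by field_simp; simp
  | one =>
    rw [waveKernel_one_lowFreq ha hβ hβa, Complex.norm_real, Real.norm_eq_abs, abs_mul,
      Real.abs_exp]
    have hc := Real.abs_cos_le_one (√(a ^ 2 - β ^ 2 / 4) * t)
    generalize √(a ^ 2 - β ^ 2 / 4) = w at *
    have h2 : |β / 2 * (Real.sin (w * t) / w)| ≤ 1 := by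
      rw [abs_mul, abs_of_nonneg (by linarith)]
      calc _ ≤ a / 2 * (2 / a) := by gcongr
        _ = 1 := by field_simp
    have h3 : |Real.cos (w * t) - β / 2 * (Real.sin (w * t) / w)| ≤ 2 := by
      refine (abs_sub _ _).trans ?_; linarith
    calc _ ≤ a * (Real.exp (-(β / 2) * t) * 2) := by gcongr
      _ ≤ _ := by
        have : 0 ≤ a * Real.exp (-(β / 2) * t) := by positivity
        linarith
  | more j hj hj1 =>
    rw [waveKernel_add_two]
    have h1 : ‖-(β : ℂ) * waveKernel β (a ^ 2) (j + 1) t‖ ≤ a * ‖waveKernel β (a ^ 2) (j + 1) t‖ := by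
      rw [norm_mul, norm_neg, Complex.norm_real, Real.norm_of_nonneg hβ]; gcongr
    have h2 : ‖((a ^ 2 : ℝ) : ℂ) * waveKernel β (a ^ 2) j t‖ =
        a * (a * ‖waveKernel β (a ^ 2) j t‖) := by
      rw [norm_mul, Complex.norm_real, Real.norm_of_nonneg (by positivity)]; ring
    have h3 : a * ‖-(β : ℂ) * waveKernel β (a ^ 2) (j + 1) t -
        ((a ^ 2 : ℝ) : ℂ) * waveKernel β (a ^ 2) j t‖ ≤
        a * (2 ^ (j + 1 + 1) * a ^ (j + 1) * Real.exp (-(β / 2) * t)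
          + a * (2 ^ (j + 1) * a ^ j * Real.exp (-(β / 2) * t))) := by
      gcongr
      refine (norm_sub_le _ _).trans ?_
      rw [h2]
      gcongr
      exact h1.trans hj1
    refine h3.trans ?_
    have : 0 ≤ 2 ^ j * a ^ (j + 2) * Real.exp (-(β / 2) * t) := by positivity
    ring_nf at this ⊢
    linarith

theorem iteratedDeriv_sin_mul_div (ha : a ≠ 0) (t : ℝ) :
    iteratedDeriv 0 (fun r : ℝ => Real.sin (a * r)) t / a = Real.sin (a * t) / a ∧
    iteratedDeriv 1 (fun r : ℝ => Real.sin (a * r)) t / a = Real.cos (a * t) ∧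
    iteratedDeriv 2 (fun r : ℝ => Real.sin (a * r)) t / a = -(a * Real.sin (a * t)) := by
  have h : ∀ j, iteratedDeriv j (fun r : ℝ => Real.sin (a * r)) t =
      a ^ j * iteratedDeriv j Real.sin (a * t) := by
    intro j
    rw [iteratedDeriv_comp_const_mul (Real.contDiff_sin.of_le le_top)]
  refine ⟨by simp, ?_, ?_⟩
  · rw [h]; simp [iteratedDeriv_one, ha]
  · rw [h]; simp [iteratedDeriv_succ]; field_simp

/-- Replacing the frequency w by a costs (a - w)t ≤ (β/a)(βt)/4. The factor βt is absorbed by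
weakening exp(-βt/2) to exp(-βt/4), and what remains is the relative error β/a. The case j = 2
reduces to the others by E'' = -βE' - a²E. -/
theorem norm_waveKernel_sub_profile_le (ha : 0 < a) (hβ : 0 ≤ β) (hβa : β ≤ a) (ht : 0 ≤ t)
    {j : ℕ} (hj : j ≤ 2) :
    a * ‖waveKernel β (a ^ 2) j t - ((iteratedDeriv j (fun r : ℝ => Real.sin (a * r)) t / a *
      Real.exp (-(β / 2) * t) : ℝ) : ℂ)‖ ≤
      12 * (a ^ j * (β / a) * Real.exp (-(β / 4) * t)) := by
  obtain ⟨hw, hwa, hwd, -⟩ := lowFreq_root ha hβ hβa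
  obtain ⟨i0, i1, i2⟩ := iteratedDeriv_sin_mul_div ha.ne' t
  have hs := abs_sin_div_lowFreq_le ha hβ hβa t
  have he := (Real.exp_pos (-(β / 2) * t)).le
  have hw0 := waveKernel_zero_lowFreq ha hβ hβa t
  have hw1 := waveKernel_one_lowFreq ha hβ hβa t
  have hexp : (1 + β * t) * Real.exp (-(β / 2) * t) ≤ 4 * Real.exp (-(β / 4) * t) := by
    have h1 : 1 + β * t ≤ 4 * Real.exp (β / 4 * t) := by
      have := Real.add_one_le_exp (β / 4 * t); nlinarith
    calc _ ≤ 4 * Real.exp (β / 4 * t) * Real.exp (-(β / 2) * t) := by gcongr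
      _ = _ := by rw [mul_assoc, ← Real.exp_add]; ring_nf
  have hr : β / a ≤ 1 := (div_le_one ha).2 hβa
  have hr0 : 0 ≤ β / a := by positivity
  have key0 : a * |Real.sin (√(a ^ 2 - β ^ 2 / 4) * t) / √(a ^ 2 - β ^ 2 / 4) -
      Real.sin (a * t) / a| ≤ β / a * (1 + β * t) := by
    generalize √(a ^ 2 - β ^ 2 / 4) = w at *
    have hw0 : 0 < w := by linarith
    have h1 : |Real.sin (w * t) - Real.sin (a * t)| ≤ (a - w) * t := by
      refine (Real.abs_sin_sub_sin_le _ _).trans ?_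
      rw [← sub_mul, abs_mul, abs_of_nonneg ht, abs_sub_comm, abs_of_nonneg (by linarith)]
    have e : a * (Real.sin (w * t) / w - Real.sin (a * t) / a) =
        ((a * (Real.sin (w * t) - Real.sin (a * t))) + (a - w) * Real.sin (a * t)) / w := by
      field_simp; ring
    rw [← abs_of_pos ha, ← abs_mul, abs_of_pos ha, e, abs_div, abs_of_pos hw0, div_le_iff₀ hw0]
    have h2 : |a * (Real.sin (w * t) - Real.sin (a * t)) + (a - w) * Real.sin (a * t)| ≤
        a * ((a - w) * t) + (a - w) := by
      refine (abs_add_le _ _).trans ?_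
      rw [abs_mul, abs_mul, abs_of_pos ha, abs_of_nonneg (by linarith : 0 ≤ a - w)]
      have := Real.abs_sin_le_one (a * t)
      have h3 : (a - w) * |Real.sin (a * t)| ≤ (a - w) * 1 :=
        mul_le_mul_of_nonneg_left this (by linarith)
      have h4 := mul_le_mul_of_nonneg_left h1 ha.le
      linarith
    have h5 : a * ((a - w) * t) + (a - w) ≤ β ^ 2 / (4 * a) * (1 + a * t) := by
      have : 0 ≤ 1 + a * t := by positivity
      nlinarith [mul_le_mul_of_nonneg_right hwd this]
    have h6 : β ^ 2 / (4 * a) * (1 + a * t) ≤ β / a * (1 + β * t) * (a / 2) := by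
      have : β ^ 2 / (4 * a) * (1 + a * t) = β / 4 * (β / a + β * t) := by field_simp
      rw [this]
      have : β / a * (1 + β * t) * (a / 2) = β / 2 * (1 + β * t) := by field_simp
      rw [this]
      have : 0 ≤ β * t := by positivity
      nlinarith
    have h7 : β / a * (1 + β * t) * (a / 2) ≤ β / a * (1 + β * t) * w := by
      have : 0 ≤ β * t := by positivity
      gcongr
    linarith
  have main0 : a * ‖waveKernel β (a ^ 2) 0 t - ((Real.sin (a * t) / a *
      Real.exp (-(β / 2) * t) : ℝ) : ℂ)‖ ≤ β / a * (4 * Real.exp (-(β / 4) * t)) := by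
    rw [hw0, ← Complex.ofReal_sub, Complex.norm_real, Real.norm_eq_abs, mul_comm (Real.exp _),
      ← sub_mul, abs_mul, Real.abs_exp, ← mul_assoc]
    calc _ ≤ β / a * (1 + β * t) * Real.exp (-(β / 2) * t) := by gcongr
      _ = β / a * ((1 + β * t) * Real.exp (-(β / 2) * t)) := by ring
      _ ≤ _ := by gcongr
  have hE4 := (Real.exp_pos (-(β / 4) * t)).le
  have hE24 : Real.exp (-(β / 2) * t) ≤ Real.exp (-(β / 4) * t) := by
    apply Real.exp_le_exp.2; nlinarith [mul_nonneg hβ ht]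
  interval_cases j
  · rw [i0]
    refine main0.trans ?_
    have : 0 ≤ β / a * Real.exp (-(β / 4) * t) := by positivity
    rw [pow_zero]; nlinarith
  · rw [i1, hw1, ← Complex.ofReal_sub, Complex.norm_real, Real.norm_eq_abs, mul_comm (Real.exp _),
      ← sub_mul, abs_mul, Real.abs_exp]
    have h1 : |Real.cos (√(a ^ 2 - β ^ 2 / 4) * t) - β / 2 *
        (Real.sin (√(a ^ 2 - β ^ 2 / 4) * t) / √(a ^ 2 - β ^ 2 / 4)) - Real.cos (a * t)| ≤
        2 * (β / a) * (1 + β * t) := by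
      generalize √(a ^ 2 - β ^ 2 / 4) = w at *
      have h1 : |Real.cos (w * t) - Real.cos (a * t)| ≤ (a - w) * t := by
        refine (Real.abs_cos_sub_cos_le _ _).trans ?_
        rw [← sub_mul, abs_mul, abs_of_nonneg ht, abs_sub_comm, abs_of_nonneg (by linarith)]
      have h2 : |β / 2 * (Real.sin (w * t) / w)| ≤ β / a := by
        rw [abs_mul, abs_of_nonneg (by linarith)]
        calc _ ≤ β / 2 * (2 / a) := by gcongr
          _ = _ := by field_simp
      have h3 : (a - w) * t ≤ β / a * (β * t) := by
        have : β / a * (β * t) = 4 * (β ^ 2 / (4 * a)) * t := by field_simp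
        rw [this]
        gcongr
        have : 0 ≤ β ^ 2 / (4 * a) := by positivity
        linarith
      rw [sub_right_comm]
      refine (abs_sub _ _).trans ?_
      have : 0 ≤ β / a * (β * t) := by positivity
      nlinarith
    calc _ ≤ a * (2 * (β / a) * (1 + β * t) * Real.exp (-(β / 2) * t)) := by gcongr
      _ = a * (2 * (β / a)) * ((1 + β * t) * Real.exp (-(β / 2) * t)) := by ring
      _ ≤ a * (2 * (β / a)) * (4 * Real.exp (-(β / 4) * t)) := by gcongr
      _ ≤ _ := by
        have : 0 ≤ a * (β / a) * Real.exp (-(β / 4) * t) := by positivity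
        rw [pow_one]; nlinarith
  · rw [i2, waveKernel_add_two]
    have e : -(β : ℂ) * waveKernel β (a ^ 2) (0 + 1) t -
        ((a ^ 2 : ℝ) : ℂ) * waveKernel β (a ^ 2) 0 t -
        ((-(a * Real.sin (a * t)) * Real.exp (-(β / 2) * t) : ℝ) : ℂ) =
        -(β * waveKernel β (a ^ 2) 1 t) - ((a ^ 2 : ℝ) : ℂ) * (waveKernel β (a ^ 2) 0 t -
        ((Real.sin (a * t) / a * Real.exp (-(β / 2) * t) : ℝ) : ℂ)) := by
      have : (a : ℂ) ≠ 0 := by exact_mod_cast ha.ne'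
      push_cast
      field_simp
      ring
    rw [e]
    have h1 := norm_waveKernel_lowFreq_le ha hβ hβa t 1
    have h2 : ‖-(β * waveKernel β (a ^ 2) 1 t)‖ ≤ β / a *
        (4 * a * Real.exp (-(β / 4) * t)) := by
      rw [norm_neg, norm_mul, Complex.norm_real, Real.norm_of_nonneg hβ]
      calc _ = β / a * (a * ‖waveKernel β (a ^ 2) 1 t‖) := by field_simp
        _ ≤ β / a * (2 ^ (1 + 1) * a ^ 1 * Real.exp (-(β / 2) * t)) := by gcongr
        _ ≤ β / a * (2 ^ (1 + 1) * a ^ 1 * Real.exp (-(β / 4) * t)) := by gcongr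
        _ = _ := by norm_num
    have h3 : ∀ z : ℂ, ‖((a ^ 2 : ℝ) : ℂ) * z‖ = a * (a * ‖z‖) := by
      intro z
      rw [norm_mul, Complex.norm_real, Real.norm_of_nonneg (by positivity)]; ring
    calc _ ≤ a * (β / a * (4 * a * Real.exp (-(β / 4) * t)) +
          a * (β / a * (4 * Real.exp (-(β / 4) * t)))) := by
          gcongr
          refine (norm_sub_le _ _).trans ?_
          rw [h3]
          gcongr
      _ ≤ _ := by
        have : 0 ≤ a ^ 2 * (β / a) * Real.exp (-(β / 4) * t) := by positivity
        nlinarith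

/-- By `cattaneoKernel_eq_waveKernel`, K - E/μ consists of exp(-μt), E' and a²E/μ, divided by a
quantity at least μ²/2. Here E' gains a factor a over E. In the coefficients of the first two data
the other terms carry β, a² or a time derivative, which compensates the 1/a in E. -/
theorem norm_dataKernel_sub_waveKernel_le (hμ : 0 < μ) (ha : 0 < a) (ha1 : a ≤ 1) (hβ : 0 ≤ β)
    (hβa : β ≤ a) (hβμ : β ≤ μ / 2) (t : ℝ) {j : ℕ} (hj : j ≤ 2) (k : Fin 3) :
    ‖dataKernel μ β (a ^ 2) k j t - ![(0 : ℂ), 1, (μ : ℂ)⁻¹] k * waveKernel β (a ^ 2) j t‖ ≤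
      (100 * (1 + μ⁻¹) ^ 3 * (1 + μ) ^ 2) *
        (Real.exp (-μ * t) + a ^ j * Real.exp (-(β / 2) * t)) := by
  have hμc : (μ : ℂ) ≠ 0 := by exact_mod_cast hμ.ne'
  have he := (Real.exp_pos (-(β / 2) * t)).le
  have heμ := (Real.exp_pos (-μ * t)).le
  set S := Real.exp (-μ * t) + a ^ j * Real.exp (-(β / 2) * t) with hS
  have hS0 : 0 ≤ S := by positivity
  have hi0 : 0 ≤ μ⁻¹ := by positivity
  have hW0 : a * ‖waveKernel β (a ^ 2) j t‖ ≤ 8 * S := by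
    refine (norm_waveKernel_lowFreq_le ha hβ hβa t j).trans ?_
    have : (2 : ℝ) ^ (j + 1) ≤ 2 ^ 3 := by gcongr <;> norm_num; omega
    calc _ ≤ 2 ^ 3 * a ^ j * Real.exp (-(β / 2) * t) := by gcongr
      _ ≤ 8 * S := by rw [hS]; linarith
  have hW1 : ‖waveKernel β (a ^ 2) (j + 1) t‖ ≤ 16 * S := by
    have h := norm_waveKernel_lowFreq_le ha hβ hβa t (j + 1)
    have h2 : (2 : ℝ) ^ (j + 1 + 1) ≤ 2 ^ 4 := by gcongr <;> norm_num; omega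
    have : a * ‖waveKernel β (a ^ 2) (j + 1) t‖ ≤ a * (16 * S) := by
      refine h.trans ?_
      calc _ ≤ 2 ^ 4 * a ^ (j + 1) * Real.exp (-(β / 2) * t) := by gcongr
        _ = a * (16 * (a ^ j * Real.exp (-(β / 2) * t))) := by ring
        _ ≤ _ := by rw [hS]; gcongr; linarith
    exact le_of_mul_le_mul_left this ha
  have hq : μ ^ 2 / 2 ≤ μ ^ 2 - μ * β + a ^ 2 := by nlinarith [sq_nonneg a]
  have hK : ‖cattaneoKernel μ β (a ^ 2) j t - (μ : ℂ)⁻¹ * waveKernel β (a ^ 2) j t‖ ≤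
      50 * (1 + μ⁻¹) ^ 3 * (1 + μ) ^ 2 * S := by
    have e : ((μ ^ 2 - μ * β + a ^ 2 : ℝ) : ℂ) *
        (cattaneoKernel μ β (a ^ 2) j t - (μ : ℂ)⁻¹ * waveKernel β (a ^ 2) j t) =
        (-μ) ^ j * Complex.exp (-μ * t) - waveKernel β (a ^ 2) (j + 1) t -
        ((a ^ 2 : ℝ) : ℂ) * (μ : ℂ)⁻¹ * waveKernel β (a ^ 2) j t := by
      have := cattaneoKernel_eq_waveKernel μ β (a ^ 2) j t
      rw [mul_sub, mul_comm (μ : ℂ)⁻¹, ← mul_assoc]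
      push_cast at this ⊢
      rw [this]
      field_simp
      ring
    have h1 : ‖(-(μ : ℂ)) ^ j * Complex.exp (-μ * t)‖ ≤ (1 + μ) ^ 2 * S := by
      rw [norm_mul, norm_pow, norm_neg, Complex.norm_real, Real.norm_of_nonneg hμ.le,
        ← Complex.ofReal_neg, ← Complex.ofReal_mul, Complex.norm_exp_ofReal]
      have : μ ^ j ≤ (1 + μ) ^ 2 := by
        calc μ ^ j ≤ (1 + μ) ^ j := by gcongr; linarith
          _ ≤ _ := by gcongr; linarith
      have : Real.exp (-μ * t) ≤ S := by
        have : 0 ≤ a ^ j * Real.exp (-(β / 2) * t) := by positivity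
        linarith
      gcongr
    have h2 : ‖((a ^ 2 : ℝ) : ℂ) * (μ : ℂ)⁻¹ * waveKernel β (a ^ 2) j t‖ ≤ μ⁻¹ * (8 * S) := by
      rw [norm_mul, norm_mul, Complex.norm_real, norm_inv, Complex.norm_real,
        Real.norm_of_nonneg (by positivity), Real.norm_of_nonneg hμ.le]
      calc _ = a * μ⁻¹ * (a * ‖waveKernel β (a ^ 2) j t‖) := by ring
        _ ≤ 1 * μ⁻¹ * (8 * S) := by gcongr
        _ = _ := by ring
    have h3 : μ ^ 2 / 2 * ‖cattaneoKernel μ β (a ^ 2) j t -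
        (μ : ℂ)⁻¹ * waveKernel β (a ^ 2) j t‖ ≤ (1 + μ) ^ 2 * S + 16 * S + μ⁻¹ * (8 * S) := by
      calc _ ≤ (μ ^ 2 - μ * β + a ^ 2) * ‖cattaneoKernel μ β (a ^ 2) j t -
            (μ : ℂ)⁻¹ * waveKernel β (a ^ 2) j t‖ := by gcongr
        _ = ‖((μ ^ 2 - μ * β + a ^ 2 : ℝ) : ℂ) *
            (cattaneoKernel μ β (a ^ 2) j t - (μ : ℂ)⁻¹ * waveKernel β (a ^ 2) j t)‖ := by
            rw [norm_mul, Complex.norm_real, Real.norm_of_nonneg]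
            exact le_trans (by positivity) hq
        _ ≤ _ := by
            rw [e]
            refine (norm_sub_le _ _).trans (add_le_add ((norm_sub_le _ _).trans ?_) h2)
            exact add_le_add h1 hW1
    have h4 : ‖cattaneoKernel μ β (a ^ 2) j t - (μ : ℂ)⁻¹ * waveKernel β (a ^ 2) j t‖ ≤
        μ⁻¹ ^ 2 * (2 * ((1 + μ) ^ 2 * S + 16 * S + μ⁻¹ * (8 * S))) := by
      rw [inv_pow, inv_mul_eq_div _ (2 * _), le_div_iff₀ (by positivity)]
      linarith
    refine h4.trans ?_
    have h5 : (1 + μ) ^ 2 * S + 16 * S + μ⁻¹ * (8 * S) ≤ 25 * ((1 + μ⁻¹) * (1 + μ) ^ 2 * S) := by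
      have h6 : (1 : ℝ) ≤ (1 + μ) ^ 2 := one_le_pow₀ (by linarith)
      have h7 : (1 + μ) ^ 2 * S ≤ (1 + μ⁻¹) * (1 + μ) ^ 2 * S := by
        gcongr; exact le_mul_of_one_le_left (by positivity) (by linarith)
      have h8 : (1 + μ⁻¹) * S ≤ (1 + μ⁻¹) * (1 + μ) ^ 2 * S := by
        gcongr; exact le_mul_of_one_le_right (by positivity) h6
      nlinarith [mul_nonneg hi0 hS0]
    calc _ ≤ (1 + μ⁻¹) ^ 2 * (2 * (25 * ((1 + μ⁻¹) * (1 + μ) ^ 2 * S))) := by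
          gcongr; linarith
      _ = _ := by ring
  have hbig : S ≤ (1 + μ⁻¹) ^ 3 * (1 + μ) ^ 2 * S := by
    refine le_mul_of_one_le_left hS0 ?_
    have h1 : (1 : ℝ) ≤ (1 + μ⁻¹) ^ 3 := one_le_pow₀ (by linarith)
    have h2 : (1 : ℝ) ≤ (1 + μ) ^ 2 := one_le_pow₀ (by linarith)
    nlinarith
  have hbig' : μ⁻¹ * S ≤ (1 + μ⁻¹) ^ 3 * (1 + μ) ^ 2 * S := by
    refine mul_le_mul_of_nonneg_right ?_ hS0
    have h1 : μ⁻¹ ≤ (1 + μ⁻¹) ^ 3 := by nlinarith [sq_nonneg μ⁻¹, mul_nonneg hi0 (sq_nonneg μ⁻¹)]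
    have h2 : (1 : ℝ) ≤ (1 + μ) ^ 2 := one_le_pow₀ (by linarith)
    nlinarith
  have haK : a * ‖cattaneoKernel μ β (a ^ 2) j t‖ ≤
      58 * ((1 + μ⁻¹) ^ 3 * (1 + μ) ^ 2 * S) := by
    have h1 : ‖cattaneoKernel μ β (a ^ 2) j t‖ ≤
        ‖cattaneoKernel μ β (a ^ 2) j t - (μ : ℂ)⁻¹ * waveKernel β (a ^ 2) j t‖ +
        μ⁻¹ * ‖waveKernel β (a ^ 2) j t‖ := by
      have := norm_add_le (cattaneoKernel μ β (a ^ 2) j t - (μ : ℂ)⁻¹ * waveKernel β (a ^ 2) j t)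
        ((μ : ℂ)⁻¹ * waveKernel β (a ^ 2) j t)
      rwa [sub_add_cancel, norm_mul, norm_inv, Complex.norm_real,
        Real.norm_of_nonneg hμ.le] at this
    calc _ ≤ a * (‖cattaneoKernel μ β (a ^ 2) j t - (μ : ℂ)⁻¹ * waveKernel β (a ^ 2) j t‖ +
        μ⁻¹ * ‖waveKernel β (a ^ 2) j t‖) := by gcongr
      _ = a * ‖cattaneoKernel μ β (a ^ 2) j t - (μ : ℂ)⁻¹ * waveKernel β (a ^ 2) j t‖ +
        μ⁻¹ * (a * ‖waveKernel β (a ^ 2) j t‖) := by ring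
      _ ≤ 1 * (50 * (1 + μ⁻¹) ^ 3 * (1 + μ) ^ 2 * S) + μ⁻¹ * (8 * S) := by gcongr
      _ ≤ _ := by linarith
  have hβK : ‖(β : ℂ) * cattaneoKernel μ β (a ^ 2) j t‖ ≤
      58 * ((1 + μ⁻¹) ^ 3 * (1 + μ) ^ 2 * S) := by
    rw [norm_mul, Complex.norm_real, Real.norm_of_nonneg hβ]
    refine le_trans ?_ haK
    gcongr
  have hbig0 : 0 ≤ (1 + μ⁻¹) ^ 3 * (1 + μ) ^ 2 * S := hS0.trans hbig
  fin_cases k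
  · change ‖_ - (0 : ℂ) * _‖ ≤ _
    simp only [dataKernel, zero_mul, sub_zero]
    refine (norm_add₃_le).trans ?_
    have h1 : ‖(β : ℂ) * waveKernel β (a ^ 2) j t‖ ≤ 8 * S := by
      rw [norm_mul, Complex.norm_real, Real.norm_of_nonneg hβ]
      refine le_trans ?_ hW0
      gcongr
    have h2 : ‖((a ^ 2 : ℝ) : ℂ) * cattaneoKernel μ β (a ^ 2) j t‖ ≤
        58 * ((1 + μ⁻¹) ^ 3 * (1 + μ) ^ 2 * S) := by
      rw [norm_mul, Complex.norm_real, Real.norm_of_nonneg (by positivity)]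
      refine le_trans ?_ haK
      gcongr
      nlinarith
    linarith
  · change ‖_ - (1 : ℂ) * _‖ ≤ _
    simp only [dataKernel, one_mul, add_sub_cancel_left]
    linarith
  · change ‖_ - (μ : ℂ)⁻¹ * _‖ ≤ _
    simp only [dataKernel]
    linarith

end LowFrequency

/-! ### Estimates of the kernels away from low frequencies -/

theorem norm_expConv_le_mul {l : ℂ} {f : ℝ → ℂ} {t M : ℝ} (ht : 0 ≤ t)
    (h : ∀ r ∈ Set.Icc 0 t, Real.exp (l.re * (t - r)) * ‖f r‖ ≤ M) : ‖expConv l f t‖ ≤ M * t := by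
  have := intervalIntegral.norm_integral_le_of_norm_le_const (a := 0) (b := t) (C := M)
    (f := fun r : ℝ => Complex.exp (l * (t - r)) * f r) ?_
  · simpa [expConv, abs_of_nonneg ht] using this
  · intro r hr
    rw [Set.uIoc_of_le ht] at hr
    have he : (l * (t - r)).re = l.re * (t - r) := by
      rw [← Complex.ofReal_sub, Complex.re_mul_ofReal]
    rw [norm_mul, Complex.norm_exp, he]
    exact h r ⟨hr.1.le, hr.2⟩

/-- Integrating exp(-pr) gains 1/p and no growth in t. The constant M may itself contain decay in t,
and it does when this is applied. -/
theorem norm_expConv_le_div {l : ℂ} {f : ℝ → ℂ} {t M p : ℝ} (ht : 0 ≤ t) (hp : 0 < p) (hM : 0 ≤ M)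
    (h : ∀ r ∈ Set.Icc 0 t, Real.exp (l.re * (t - r)) * ‖f r‖ ≤ M * Real.exp (-p * r)) :
    ‖expConv l f t‖ ≤ M / p := by
  have hi : IntervalIntegrable (fun r => M * Real.exp (-p * r)) volume 0 t :=
    Continuous.intervalIntegrable (by fun_prop) _ _
  have h1 : ‖expConv l f t‖ ≤ ∫ r in (0 : ℝ)..t, M * Real.exp (-p * r) := by
    refine intervalIntegral.norm_integral_le_of_norm_le ht ?_ hi
    refine ae_of_all _ fun r hr => ?_
    have he : (l * (t - r)).re = l.re * (t - r) := by
      rw [← Complex.ofReal_sub, Complex.re_mul_ofReal]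
    rw [norm_mul, Complex.norm_exp, he]
    exact h r ⟨hr.1.le, hr.2⟩
  refine h1.trans ?_
  have h2 : ∀ r ∈ Set.uIcc 0 t, HasDerivAt (fun r => M * (-Real.exp (-p * r) / p))
      (M * Real.exp (-p * r)) r := by
    intro r _
    have h3 : HasDerivAt (fun r : ℝ => Real.exp (-p * r)) (Real.exp (-p * r) * -p) r := by
      simpa using ((hasDerivAt_id r).const_mul (-p)).exp
    refine ((h3.neg.div_const p).const_mul M).congr_deriv ?_
    field_simp
  rw [intervalIntegral.integral_eq_sub_of_hasDerivAt h2 hi]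
  simp only [mul_zero, Real.exp_zero]
  have : 0 ≤ M * (Real.exp (-p * t) / p) := by positivity
  have e : M * (-Real.exp (-p * t) / p) - M * (-1 / p) = M / p - M * (Real.exp (-p * t) / p) := by
    ring
  linarith

theorem mul_exp_neg_le {k t : ℝ} (hk : 0 < k) :
    t * Real.exp (-(2 * k) * t) ≤ k⁻¹ * Real.exp (-k * t) := by
  have h1 : k * t ≤ Real.exp (k * t) := by linarith [Real.add_one_le_exp (k * t)]
  have e : Real.exp (-k * t) = Real.exp (k * t) * Real.exp (-(2 * k) * t) := by
    rw [← Real.exp_add]; ring_nf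
  have h2 : t ≤ k⁻¹ * Real.exp (k * t) := by
    rw [inv_mul_eq_div, le_div_iff₀ hk]; linarith
  rw [e, ← mul_assoc]
  gcongr

/-- This places both characteristic roots in Re λ ≤ -δ: β/2 is the decay rate of complex roots, and
γ/β is a lower bound for the slow rate of real ones. -/
theorem sqrt_disc_le {β γ δ : ℝ} (hβ : 0 < β) (h1 : δ ≤ β / 2) (h2 : δ ≤ γ / β) :
    √(β ^ 2 / 4 - γ) ≤ β / 2 - δ := by
  rw [Real.sqrt_le_left (by linarith)]
  rw [le_div_iff₀ hβ] at h2
  nlinarith [sq_nonneg δ]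

theorem re_charRootOne (β γ : ℝ) : (charRootOne β γ).re = -(β / 2) + √(β ^ 2 / 4 - γ) := by
  simp [charRootOne, rootDisc]

theorem re_charRootTwo (β γ : ℝ) : (charRootTwo β γ).re = -(β / 2) - √(β ^ 2 / 4 - γ) := by
  simp [charRootTwo, rootDisc]

theorem norm_exp_charRootTwo_le {β γ δ t : ℝ} (hβ : 0 < β) (h1 : δ ≤ β / 2)
    (h2 : δ ≤ γ / β) (ht : 0 ≤ t) :
    ‖Complex.exp (charRootTwo β γ * t)‖ ≤ Real.exp (-δ * t) := by
  rw [Complex.norm_exp, Complex.re_mul_ofReal, re_charRootTwo]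
  apply Real.exp_le_exp.2
  have := sqrt_disc_le hβ h1 h2
  have := Real.sqrt_nonneg (β ^ 2 / 4 - γ)
  gcongr
  linarith

theorem norm_exp_charRootOne_le {β γ δ t : ℝ} (hβ : 0 < β) (h1 : δ ≤ β / 2)
    (h2 : δ ≤ γ / β) (ht : 0 ≤ t) :
    ‖Complex.exp (charRootOne β γ * t)‖ ≤ Real.exp (-δ * t) := by
  rw [Complex.norm_exp, Complex.re_mul_ofReal, re_charRootOne]
  apply Real.exp_le_exp.2
  have := sqrt_disc_le hβ h1 h2
  gcongr
  linarith

/-- The factor t is the price for allowing a double root; the bound uses no separation of the roots.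
-/
theorem norm_waveKernel_zero_le {β γ δ t : ℝ} (hβ : 0 < β) (h1 : δ ≤ β / 2)
    (h2 : δ ≤ γ / β) (ht : 0 ≤ t) : ‖waveKernel β γ 0 t‖ ≤ Real.exp (-δ * t) * t := by
  rw [waveKernel]
  refine norm_expConv_le_mul ht fun r hr => ?_
  refine (mul_le_mul_of_nonneg_left (norm_exp_charRootTwo_le hβ h1 h2 hr.1)
    (Real.exp_pos _).le).trans ?_
  have := sqrt_disc_le hβ h1 h2
  rw [← Real.exp_add, re_charRootOne]
  apply Real.exp_le_exp.2
  have h3 : 0 ≤ t - r := by linarith [hr.2]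
  nlinarith

theorem norm_charRootOne_le {β γ : ℝ} (hβ : 0 < β) (hγ : 0 < γ) :
    ‖charRootOne β γ‖ ≤ β + γ + 1 := by
  have h1 : √(β ^ 2 / 4 - γ) ≤ β / 2 := by
    rw [Real.sqrt_le_left (by linarith)]; nlinarith
  have h2 : √(γ - β ^ 2 / 4) ≤ γ + 1 := by
    rw [Real.sqrt_le_left (by linarith)]; nlinarith [sq_nonneg β]
  rw [charRootOne, rootDisc]
  refine (norm_add_le _ _).trans ?_
  have h3 : ‖((√(β ^ 2 / 4 - γ) : ℝ) : ℂ) + ((√(γ - β ^ 2 / 4) : ℝ) : ℂ) * Complex.I‖ ≤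
      β / 2 + (γ + 1) := by
    refine (norm_add_le _ _).trans ?_
    rw [norm_mul, Complex.norm_I, mul_one, Complex.norm_real, Complex.norm_real,
      Real.norm_of_nonneg (Real.sqrt_nonneg _), Real.norm_of_nonneg (Real.sqrt_nonneg _)]
    exact add_le_add h1 h2
  rw [norm_neg, Complex.norm_real, Real.norm_of_nonneg (by linarith)]
  linarith

/-- The condition on γ makes the discriminant root at least β/4, so the real roots are β/2 apart.
The quotient formula then gains 1/β over the bound with the factor t. -/
theorem norm_waveKernel_overdamped_le {β γ t : ℝ} (hβ : 0 < β) (hγ : 0 < γ)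
    (h : 16 * γ ≤ 3 * β ^ 2) (ht : 0 ≤ t) :
    β * ‖waveKernel β γ 0 t‖ ≤ 4 * Real.exp (-(γ / β) * t) ∧
      ‖waveKernel β γ 1 t‖ ≤ 2 * Real.exp (-(γ / β) * t) := by
  have hs : β / 4 ≤ √(β ^ 2 / 4 - γ) := Real.le_sqrt_of_sq_le (by nlinarith)
  have hs2 : √(β ^ 2 / 4 - γ) ≤ β / 2 := by
    rw [Real.sqrt_le_left (by linarith)]; nlinarith
  have hp : γ / β ≤ β / 2 := by rw [div_le_iff₀ hβ]; nlinarith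
  have e1 := norm_exp_charRootOne_le hβ hp le_rfl ht
  have e2 := norm_exp_charRootTwo_le hβ hp le_rfl ht
  have hr : rootDisc β γ = (√(β ^ 2 / 4 - γ) : ℝ) := by
    rw [rootDisc, Real.sqrt_eq_zero_of_nonpos (by nlinarith : γ - β ^ 2 / 4 ≤ 0)]
    simp
  have hl1 : charRootOne β γ = ((-(β / 2) + √(β ^ 2 / 4 - γ) : ℝ) : ℂ) := by
    rw [charRootOne, hr]; push_cast; ring
  have hl2 : charRootTwo β γ = ((-(β / 2) - √(β ^ 2 / 4 - γ) : ℝ) : ℂ) := by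
    rw [charRootTwo, hr]; push_cast; ring
  generalize √(β ^ 2 / 4 - γ) = s at *
  have hs0 : 0 < s := by linarith
  have hsc : (s : ℂ) ≠ 0 := by exact_mod_cast hs0.ne'
  have hd : charRootOne β γ - charRootTwo β γ = 2 * s := by rw [hl1, hl2]; push_cast; ring
  have hne : charRootOne β γ ≠ charRootTwo β γ := by
    rw [← sub_ne_zero, hd]; simp [hsc]
  have hE0 : waveKernel β γ 0 t = (Complex.exp (charRootOne β γ * t) -
      Complex.exp (charRootTwo β γ * t)) / (2 * s) := by
    rw [waveKernel, expConv_exp hne, hd]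
  have hE1 : waveKernel β γ 1 t = (charRootOne β γ * Complex.exp (charRootOne β γ * t) -
      charRootTwo β γ * Complex.exp (charRootTwo β γ * t)) / (2 * s) := by
    have h2s : (2 * s : ℂ) ≠ 0 := by simp [hsc]
    rw [waveKernel_one, hE0, eq_div_iff h2s, add_mul, mul_assoc, div_mul_cancel₀ _ h2s]
    linear_combination (-Complex.exp (charRootTwo β γ * t)) * hd
  have hn : ‖(2 * s : ℂ)‖ = 2 * s := by
    rw [norm_mul, Complex.norm_real, Real.norm_of_nonneg hs0.le]; simp
  constructor
  · rw [hE0, norm_div, hn, mul_div_assoc', div_le_iff₀ (by positivity)]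
    have := (norm_sub_le (Complex.exp (charRootOne β γ * t)) (Complex.exp (charRootTwo β γ * t)))
    have h3 := (Real.exp_pos (-(γ / β) * t)).le
    calc _ ≤ (4 * s) * (Real.exp (-(γ / β) * t) + Real.exp (-(γ / β) * t)) := by
          gcongr
          · linarith
          · linarith
      _ = _ := by ring
  · rw [hE1, norm_div, hn, div_le_iff₀ (by positivity)]
    have n1 : ‖charRootOne β γ‖ = β / 2 - s := by
      rw [hl1, Complex.norm_real, Real.norm_of_nonpos (by linarith)]; ring
    have n2 : ‖charRootTwo β γ‖ = β / 2 + s := by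
      rw [hl2, Complex.norm_real, Real.norm_of_nonpos (by linarith)]; ring
    refine (norm_sub_le _ _).trans ?_
    rw [norm_mul, norm_mul, n1, n2]
    have h3 := (Real.exp_pos (-(γ / β) * t)).le
    calc _ ≤ (β / 2 - s) * Real.exp (-(γ / β) * t) + (β / 2 + s) * Real.exp (-(γ / β) * t) := by
          gcongr
      _ = β * Real.exp (-(γ / β) * t) := by ring
      _ ≤ _ := by nlinarith

/-- In the overdamped regime, where β and γ may be unbounded, separation of the roots supplies the
factors β and γ. In the bounded regime these factors cost a constant, and the roots may coalesce, so
powers of t are absorbed by the exponential. -/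
theorem exists_norm_kernel_highFreq_le {μ δ : ℝ} (hμ : 0 < μ) (hδ : 0 < δ) (M : ℝ) :
    ∃ C c : ℝ, 0 < C ∧ 0 < c ∧ ∀ β γ : ℝ, 0 < β → 0 < γ → δ ≤ β / 2 → δ ≤ γ / β →
      (16 * γ ≤ 3 * β ^ 2 ∨ (β ≤ M ∧ γ ≤ M)) → ∀ t, 0 ≤ t →
      β * ‖waveKernel β γ 0 t‖ ≤ C * Real.exp (-c * t) ∧
      ‖waveKernel β γ 1 t‖ ≤ C * Real.exp (-c * t) ∧
      γ * ‖cattaneoKernel μ β γ 0 t‖ ≤ C * Real.exp (-c * t) := by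
  -- In the bounded regime a factor t is absorbed twice, once in E and once in K. Each absorption
  -- halves the rate, from 4k ≤ δ to 2k to k.
  obtain ⟨k, hk, hkμ, hkδ⟩ : ∃ k, 0 < k ∧ 4 * k ≤ μ ∧ 4 * k ≤ δ :=
    ⟨min μ δ / 4, by positivity, by linarith [min_le_left μ δ], by linarith [min_le_right μ δ]⟩
  refine ⟨8 + |M| * (2 * k)⁻¹ + (2 * |M| + 1) * (2 * k)⁻¹ + |M| * ((2 * k)⁻¹ * k⁻¹), k,
    by positivity, hk, ?_⟩
  intro β γ hβ hγ h1 h2 hcase t ht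
  have hA : 0 ≤ |M| * (2 * k)⁻¹ := by positivity
  have hB : 0 ≤ (2 * |M| + 1) * (2 * k)⁻¹ := by positivity
  have hD : 0 ≤ |M| * ((2 * k)⁻¹ * k⁻¹) := by positivity
  have hek := (Real.exp_pos (-k * t)).le
  rcases hcase with h | ⟨hβM, hγM⟩
  · have hpk : 4 * k ≤ γ / β := hkδ.trans h2
    have hexp : Real.exp (-(γ / β) * t) ≤ Real.exp (-k * t) := by
      apply Real.exp_le_exp.2; gcongr; linarith
    obtain ⟨b0, b1⟩ := norm_waveKernel_overdamped_le hβ hγ h ht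
    -- Half of the rate γ/β is kept for the integration, where it produces the weight γ; the other
    -- half and μ provide exp(-kt).
    have hK : ‖cattaneoKernel μ β γ 0 t‖ ≤ (4 / β * Real.exp (-k * t)) / (γ / β / 2) := by
      rw [cattaneoKernel]
      refine norm_expConv_le_div ht (by positivity) (by positivity) fun r hr => ?_
      have b0 := (norm_waveKernel_overdamped_le hβ hγ h hr.1).1
      have b0' : ‖waveKernel β γ 0 r‖ ≤ 4 / β * Real.exp (-(γ / β) * r) := by
        rw [div_mul_eq_mul_div, le_div_iff₀ hβ]; linarith
      calc _ ≤ Real.exp ((-μ : ℂ).re * (t - r)) * (4 / β * Real.exp (-(γ / β) * r)) := by gcongr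
        _ = 4 / β * Real.exp (-μ * (t - r) + -(γ / β) * r) := by
          rw [Real.exp_add, Complex.neg_re, Complex.ofReal_re]; ring
        _ ≤ 4 / β * Real.exp (-k * t + -(γ / β / 2) * r) := by
          refine mul_le_mul_of_nonneg_left (Real.exp_le_exp.2 ?_) (by positivity)
          have h3 : 0 ≤ t - r := by linarith [hr.2]
          have := hr.1
          nlinarith
        _ = _ := by rw [Real.exp_add]; ring
    refine ⟨b0.trans ?_, b1.trans ?_, ?_⟩
    · gcongr; linarith
    · gcongr; linarith
    · calc _ ≤ γ * ((4 / β * Real.exp (-k * t)) / (γ / β / 2)) := by gcongr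
        _ = 8 * Real.exp (-k * t) := by field_simp; norm_num
        _ ≤ _ := by gcongr; linarith
  · have hM : 0 ≤ M := hβ.le.trans hβM
    rw [abs_of_nonneg hM] at *
    have h4 : ∀ r, 0 ≤ r → ‖waveKernel β γ 0 r‖ ≤ (2 * k)⁻¹ * Real.exp (-(2 * k) * r) := by
      intro r hr
      refine (norm_waveKernel_zero_le hβ h1 h2 hr).trans ?_
      rw [mul_comm]
      refine le_trans ?_ (mul_exp_neg_le (by positivity : 0 < 2 * k))
      gcongr
      linarith
    have he2 : Real.exp (-(2 * k) * t) ≤ Real.exp (-k * t) := by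
      apply Real.exp_le_exp.2; gcongr; linarith
    have heδ : Real.exp (-δ * t) ≤ Real.exp (-k * t) := by
      apply Real.exp_le_exp.2; gcongr; linarith
    have h5 : ‖waveKernel β γ 0 t‖ ≤ (2 * k)⁻¹ * Real.exp (-k * t) :=
      (h4 t ht).trans (by gcongr)
    refine ⟨?_, ?_, ?_⟩
    · calc _ ≤ M * ((2 * k)⁻¹ * Real.exp (-k * t)) := by gcongr
        _ = M * (2 * k)⁻¹ * Real.exp (-k * t) := by ring
        _ ≤ _ := by gcongr; linarith
    · rw [waveKernel_one]
      refine (norm_add_le _ _).trans ?_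
      rw [norm_mul]
      have h6 := norm_charRootOne_le hβ hγ
      calc _ ≤ (2 * M + 1) * ((2 * k)⁻¹ * Real.exp (-k * t)) + Real.exp (-k * t) := by
            gcongr
            · linarith
            · exact (norm_exp_charRootTwo_le hβ h1 h2 ht).trans heδ
        _ = ((2 * M + 1) * (2 * k)⁻¹ + 1) * Real.exp (-k * t) := by ring
        _ ≤ _ := mul_le_mul_of_nonneg_right (by linarith) hek
    · have hK : ‖cattaneoKernel μ β γ 0 t‖ ≤ ((2 * k)⁻¹ * Real.exp (-(2 * k) * t)) * t := by
        rw [cattaneoKernel]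
        refine norm_expConv_le_mul ht fun r hr => ?_
        calc _ ≤ Real.exp ((-μ : ℂ).re * (t - r)) * ((2 * k)⁻¹ * Real.exp (-(2 * k) * r)) := by
              gcongr; exact h4 r hr.1
          _ = (2 * k)⁻¹ * Real.exp (-μ * (t - r) + -(2 * k) * r) := by
            rw [Real.exp_add, Complex.neg_re, Complex.ofReal_re]; ring
          _ ≤ _ := by
            refine mul_le_mul_of_nonneg_left (Real.exp_le_exp.2 ?_) (by positivity)
            have h3 : 0 ≤ t - r := by linarith [hr.2]
            nlinarith
      have h7 := mul_exp_neg_le (t := t) hk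
      calc _ ≤ M * ((2 * k)⁻¹ * (t * Real.exp (-(2 * k) * t))) := by
            gcongr; refine hK.trans (le_of_eq ?_); ring
        _ ≤ M * ((2 * k)⁻¹ * (k⁻¹ * Real.exp (-k * t))) := by gcongr
        _ = M * ((2 * k)⁻¹ * k⁻¹) * Real.exp (-k * t) := by ring
        _ ≤ _ := by gcongr; linarith

/-- The growth of the coefficient of the datum number `k` in the derivative of order `j` at
high frequencies. -/
def kernelWeight (β γ : ℝ) : Fin 3 → Fin 3 → ℝ :=
  ![![1, γ / β, γ], ![1, 1, β], ![β / γ, β / γ, 1]]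

set_option maxHeartbeats 1000000 in
-- The recursions express every coefficient through E, E' and K, so the bounds on βE, E' and γK
-- suffice. The relations γ ≤ Mβ² and β ≤ Mγ exchange one weight for another.
theorem exists_norm_dataKernel_highFreq_le {μ δ : ℝ} (hμ : 0 < μ) (hδ : 0 < δ) (M : ℝ) :
    ∃ C c : ℝ, 0 < C ∧ 0 < c ∧ ∀ β γ : ℝ, 0 < β → 0 < γ → δ ≤ β / 2 → δ ≤ γ / β →
      γ ≤ M * β ^ 2 → β ≤ M * γ →
      (16 * γ ≤ 3 * β ^ 2 ∨ (β ≤ M ∧ γ ≤ M)) → ∀ t, 0 ≤ t → ∀ j k : Fin 3,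
      kernelWeight β γ j k * ‖dataKernel μ β γ k j t‖ ≤ C * Real.exp (-c * t) := by
  obtain ⟨C, c, hC, hc, h⟩ := exists_norm_kernel_highFreq_le hμ hδ M
  refine ⟨C * (1 + |M|) ^ 2 * (1 + μ) ^ 2 * (1 + δ⁻¹) * 3, c, by positivity, hc, ?_⟩
  intro β γ hβ hγ h1 h2 h3 h4 hcase t ht j k
  obtain ⟨b0, b1, bK⟩ := h β γ hβ hγ h1 h2 hcase t ht
  have hM : 0 ≤ M := by
    by_contra hM
    have := sq_pos_of_pos hβ
    nlinarith
  rw [abs_of_nonneg hM]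
  set e := C * Real.exp (-c * t) with he
  have he0 : 0 ≤ e := by positivity
  have hgoal : C * (1 + M) ^ 2 * (1 + μ) ^ 2 * (1 + δ⁻¹) * 3 * Real.exp (-c * t) =
    (1 + M) ^ 2 * (1 + μ) ^ 2 * (1 + δ⁻¹) * 3 * e := by rw [he]; ring
  rw [hgoal]
  have hδi : 0 < δ⁻¹ := by positivity
  have hMsq : (1 : ℝ) ≤ (1 + M) ^ 2 := one_le_pow₀ (by linarith)
  have hMM : M ≤ (1 + M) ^ 2 := by nlinarith [sq_nonneg M]
  have hM1 : 1 + M ≤ (1 + M) ^ 2 := by nlinarith [sq_nonneg M]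
  have hμsq : 1 + μ ≤ (1 + μ) ^ 2 := by nlinarith [sq_nonneg μ]
  have n0 : ‖(β : ℂ)‖ = β := by rw [Complex.norm_real, Real.norm_of_nonneg hβ.le]
  have n1 : ‖(γ : ℂ)‖ = γ := by rw [Complex.norm_real, Real.norm_of_nonneg hγ.le]
  have n2 : ‖(μ : ℂ)‖ = μ := by rw [Complex.norm_real, Real.norm_of_nonneg hμ.le]
  set E0 := waveKernel β γ 0 t with hE0
  set E1 := waveKernel β γ 1 t with hE1
  set K0 := cattaneoKernel μ β γ 0 t with hK0
  have hK1 : cattaneoKernel μ β γ 1 t = E0 - μ * K0 := cattaneoKernel_succ μ β γ 0 t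
  have hK2 : cattaneoKernel μ β γ 2 t = E1 - μ * (E0 - μ * K0) := by
    rw [cattaneoKernel_succ μ β γ 1 t, hK1]
  have hE2 : waveKernel β γ 2 t = -β * E1 - γ * E0 := waveKernel_add_two β γ 0 t
  have hE3 : waveKernel β γ 3 t = -β * (-β * E1 - γ * E0) - γ * E1 := by
    rw [waveKernel_add_two β γ 1 t, hE2]
  have bβK : β * ‖K0‖ ≤ M * e := by
    calc _ ≤ M * γ * ‖K0‖ := by gcongr
      _ = M * (γ * ‖K0‖) := by ring
      _ ≤ _ := by gcongr
  have bK1 : β * ‖E0 - μ * K0‖ ≤ (1 + M) * (1 + μ) * e := by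
    calc _ ≤ β * (‖E0‖ + μ * ‖K0‖) := by
          gcongr; refine (norm_sub_le _ _).trans ?_; rw [norm_mul, n2]
      _ = β * ‖E0‖ + μ * (β * ‖K0‖) := by ring
      _ ≤ e + μ * (M * e) := by gcongr
      _ ≤ _ := by nlinarith [mul_nonneg hμ.le he0, mul_nonneg hM he0]
  have fin : ∀ {X : ℝ} (m : ℝ), 0 ≤ m → m ≤ 3 → X ≤ m * ((1 + M) * (1 + μ) ^ 2 * e) →
      X ≤ (1 + M) ^ 2 * (1 + μ) ^ 2 * (1 + δ⁻¹) * 3 * e := by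
    intro X m hm hm3 hX
    refine hX.trans ?_
    calc _ ≤ 3 * ((1 + M) ^ 2 * (1 + μ) ^ 2 * e) := by gcongr
      _ ≤ 3 * ((1 + M) ^ 2 * (1 + μ) ^ 2 * e) * (1 + δ⁻¹) :=
        le_mul_of_one_le_right (by positivity) (by linarith)
      _ = _ := by ring
  have hW : 1 + M + μ + μ * M ≤ (1 + M) * (1 + μ) ^ 2 := by
    calc _ = (1 + M) * (1 + μ) := by ring
      _ ≤ _ := by gcongr
  have hμM : 0 ≤ μ * M := by positivity
  have u1 : e ≤ (1 + M) * (1 + μ) ^ 2 * e := le_mul_of_one_le_left he0 (by linarith)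
  have u2 : M * e ≤ (1 + M) * (1 + μ) ^ 2 * e := mul_le_mul_of_nonneg_right (by linarith) he0
  have u3 : μ * e ≤ (1 + M) * (1 + μ) ^ 2 * e := mul_le_mul_of_nonneg_right (by linarith) he0
  have u4 : μ * (M * e) ≤ (1 + M) * (1 + μ) ^ 2 * e := by
    rw [← mul_assoc]; exact mul_le_mul_of_nonneg_right (by linarith) he0
  have hγβ0 : 0 ≤ γ / β := by positivity
  have hβγ0 : 0 ≤ β / γ := by positivity
  have cancel1 : ∀ x : ℝ, β / γ * (γ * x) = β * x := fun x => by field_simp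
  have cancel2 : ∀ x : ℝ, γ / β * (β * x) = γ * x := fun x => by field_simp
  have bγ0 : γ / β * ‖E0‖ ≤ M * e := by
    rw [div_mul_eq_mul_div, div_le_iff₀ hβ]
    calc _ ≤ M * β ^ 2 * ‖E0‖ := by gcongr
      _ = M * (β * ‖E0‖) * β := by ring
      _ ≤ _ := by gcongr
  have hβγM : β / γ ≤ M := by rw [div_le_iff₀ hγ]; exact h4
  fin_cases j <;> fin_cases k
  · change 1 * ‖dataKernel μ β γ 0 0 t‖ ≤ _
    simp only [dataKernel, one_mul]
    refine fin 3 (by norm_num) le_rfl ?_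
    refine (norm_add₃_le).trans ?_
    rw [norm_mul, norm_mul, n0, n1]
    linarith
  · change γ / β * ‖dataKernel μ β γ 1 0 t‖ ≤ _
    simp only [dataKernel]
    refine fin 2 (by norm_num) (by norm_num) ?_
    calc _ ≤ γ / β * (‖E0‖ + β * ‖K0‖) := by
          gcongr; refine (norm_add_le _ _).trans ?_; rw [norm_mul, n0]
      _ = γ / β * ‖E0‖ + γ * ‖K0‖ := by rw [mul_add, cancel2]
      _ ≤ M * e + e := by gcongr
      _ ≤ _ := by linarith
  · change γ * ‖dataKernel μ β γ 2 0 t‖ ≤ _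
    simp only [dataKernel]
    exact fin 1 (by norm_num) (by norm_num) (by linarith)
  · change 1 * ‖dataKernel μ β γ 0 1 t‖ ≤ _
    -- The large terms βE' and γE cancel; estimating them separately would lose the weight. The same
    -- cancellation serves j = 2 below.
    have e1 : dataKernel μ β γ 0 1 t = -(μ * (γ * K0)) := by
      simp only [dataKernel]
      rw [hE2, hK1]; ring
    rw [e1, one_mul, norm_neg, norm_mul, norm_mul, n1, n2]
    refine fin 1 (by norm_num) (by norm_num) ?_
    calc _ ≤ μ * e := by gcongr
      _ ≤ _ := by linarith
  · change 1 * ‖dataKernel μ β γ 1 1 t‖ ≤ _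
    simp only [dataKernel]
    rw [one_mul, hK1]
    refine fin 2 (by norm_num) (by norm_num) ?_
    refine (norm_add_le _ _).trans ?_
    rw [norm_mul, n0]
    have : (1 + M) * (1 + μ) * e ≤ (1 + M) * (1 + μ) ^ 2 * e := by gcongr
    linarith
  · change β * ‖dataKernel μ β γ 2 1 t‖ ≤ _
    simp only [dataKernel]
    rw [hK1]
    refine fin 1 (by norm_num) (by norm_num) ?_
    have : (1 + M) * (1 + μ) * e ≤ (1 + M) * (1 + μ) ^ 2 * e := by gcongr
    linarith
  · change β / γ * ‖dataKernel μ β γ 0 2 t‖ ≤ _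
    have e1 : dataKernel μ β γ 0 2 t = -(μ * (γ * (E0 - μ * K0))) := by
      simp only [dataKernel]
      rw [hE2, hE3, hK2]; ring
    rw [e1, norm_neg, norm_mul, norm_mul, n1, n2, mul_left_comm, cancel1]
    refine fin 1 (by norm_num) (by norm_num) ?_
    calc _ ≤ μ * ((1 + M) * (1 + μ) * e) := by gcongr
      _ ≤ (1 + μ) * ((1 + M) * (1 + μ) * e) := by gcongr; linarith
      _ = _ := by ring
  · change β / γ * ‖dataKernel μ β γ 1 2 t‖ ≤ _
    have e1 : dataKernel μ β γ 1 2 t = -(γ * E0) - μ * (β * (E0 - μ * K0)) := by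
      simp only [dataKernel]
      rw [hE2, hK2]; ring
    rw [e1]
    calc _ ≤ β / γ * (γ * ‖E0‖ + μ * (β * ‖E0 - μ * K0‖)) := by
          gcongr; refine (norm_sub_le _ _).trans ?_
          rw [norm_neg, norm_mul, norm_mul, norm_mul, n0, n1, n2]
      _ = β * ‖E0‖ + β / γ * (μ * (β * ‖E0 - μ * K0‖)) := by rw [mul_add, cancel1]
      _ ≤ e + M * (μ * ((1 + M) * (1 + μ) * e)) := by gcongr
      _ ≤ 1 * 1 * e + (1 + M) * ((1 + μ) * ((1 + M) * (1 + μ) * e)) := by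
          rw [one_mul, one_mul]
          gcongr
          · linarith
          · linarith
      _ ≤ (1 + M) ^ 2 * (1 + μ) ^ 2 * e + (1 + M) * ((1 + μ) * ((1 + M) * (1 + μ) * e)) := by
          gcongr; linarith
      _ = (1 + M) ^ 2 * (1 + μ) ^ 2 * 1 * 2 * e := by ring
      _ ≤ _ := by
          gcongr <;> linarith
  · change 1 * ‖dataKernel μ β γ 2 2 t‖ ≤ _
    simp only [dataKernel]
    rw [hK2, one_mul]
    have b2 : ‖E0 - μ * K0‖ ≤ δ⁻¹ * ((1 + M) * (1 + μ) * e) := by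
      rw [inv_mul_eq_div, le_div_iff₀ hδ]
      calc _ ≤ ‖E0 - μ * K0‖ * β := by gcongr; linarith
        _ ≤ _ := by linarith
    calc _ ≤ e + (1 + μ) * (δ⁻¹ * ((1 + M) * (1 + μ) * e)) := by
          refine (norm_sub_le _ _).trans ?_
          rw [norm_mul, n2]
          gcongr
          linarith
      _ ≤ (1 + M) ^ 2 * (1 + μ) ^ 2 * e + (1 + μ) * (δ⁻¹ * ((1 + M) ^ 2 * (1 + μ) * e)) := by
          gcongr
          exact le_mul_of_one_le_left he0 (one_le_mul_of_one_le_of_one_le hMsq (by linarith))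
      _ = (1 + M) ^ 2 * (1 + μ) ^ 2 * (1 + δ⁻¹) * 1 * e := by ring
      _ ≤ _ := by gcongr; norm_num

/-! ### `L²` norms of radial functions -/

theorem eLpNorm_radial {n : ℕ} (hn : n ≠ 0) {h : ℝ → ℝ} (hm : Measurable h)
    (hi : IntegrableOn (fun y => y ^ (n - 1) * h y ^ 2) (Set.Ioi 0)) :
    eLpNorm (fun ξ : Space n => h ‖ξ‖) 2 volume = ENNReal.ofReal
      √(n * (volume.real (Metric.ball (0 : Space n) 1) *
        ∫ y in Set.Ioi 0, y ^ (n - 1) * h y ^ 2)) := by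
  have : Nonempty (Fin n) := ⟨⟨0, Nat.pos_of_ne_zero hn⟩⟩
  have hmeas : AEStronglyMeasurable (fun ξ : Space n => h ‖ξ‖) volume :=
    (hm.comp measurable_norm).aestronglyMeasurable
  have hint : Integrable (fun ξ : Space n => h ‖ξ‖ ^ 2) := by
    refine (integrable_fun_norm_addHaar volume (f := fun y => h y ^ 2)).2 ?_
    simpa [finrank_euclideanSpace] using hi
  have hmem : MemLp (fun ξ : Space n => h ‖ξ‖) 2 volume := (memLp_two_iff_integrable_sq hmeas).2 hint
  rw [hmem.eLpNorm_eq_integral_rpow_norm (by norm_num) (by norm_num)]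
  have h2 := integral_fun_norm_addHaar (volume : Measure (Space n)) (fun y => h y ^ 2)
  simp only [finrank_euclideanSpace, Fintype.card_fin, smul_eq_mul, nsmul_eq_mul] at h2
  have e : ∀ ξ : Space n, ‖h ‖ξ‖‖ ^ (2 : ℝ≥0∞).toReal = h ‖ξ‖ ^ 2 := by
    intro ξ
    simp [Real.norm_eq_abs, sq_abs]
  simp only [e]
  rw [h2, Real.sqrt_eq_rpow]
  norm_num

/-- Polar coordinates reduce the square of the norm to a Gamma integral, and scaling gives the power
of t. The condition 2p + n > 0 is integrability at the origin. -/
theorem eLpNorm_rpow_mul_exp_le {n : ℕ} (hn : n ≠ 0) {p q k : ℝ} (hq : 0 < q) (hk : 0 < k)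
    (hp : 0 < 2 * p + n) : ∃ N : ℝ, 0 < N ∧ ∀ t : ℝ, 0 < t →
      eLpNorm (fun ξ : Space n => (2 * Real.pi * ‖ξ‖) ^ p *
        Real.exp (-k * (2 * Real.pi * ‖ξ‖) ^ q * t)) 2 volume ≤
      ENNReal.ofReal (N * t ^ (-((2 * p + n) / (2 * q)))) := by
  have hπ : 0 < 2 * Real.pi := by positivity
  set A := (n : ℝ) * (volume.real (Metric.ball (0 : Space n) 1)) with hA
  have hA0 : 0 ≤ A := by positivity
  set G := A * ((2 * Real.pi) ^ (2 * p) * ((2 * k * (2 * Real.pi) ^ q) ^ (-((2 * p + n) / q)) *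
    (1 / q) * Real.Gamma ((2 * p + n) / q))) with hG
  refine ⟨√G + 1, by positivity, fun t ht => ?_⟩
  set h : ℝ → ℝ := fun y => (2 * Real.pi * y) ^ p * Real.exp (-k * (2 * Real.pi * y) ^ q * t)
    with hh
  have hn1 : ((n - 1 : ℕ) : ℝ) = n - 1 := by
    rw [Nat.cast_sub (Nat.one_le_iff_ne_zero.2 hn)]; simp
  have key : ∀ y ∈ Set.Ioi (0 : ℝ), y ^ (n - 1) * h y ^ 2 = (2 * Real.pi) ^ (2 * p) *
      (y ^ (2 * p + n - 1) * Real.exp (-(2 * k * (2 * Real.pi) ^ q * t) * y ^ q)) := by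
    intro y hy
    have hy : 0 < y := hy
    simp only [hh]
    rw [mul_pow, ← Real.exp_nat_mul, ← Real.rpow_natCast, ← Real.rpow_natCast,
      ← Real.rpow_mul (by positivity), Real.mul_rpow hπ.le hy.le, Real.mul_rpow hπ.le hy.le, hn1,
      show 2 * p + n - 1 = (n - 1) + p * (2 : ℕ) by push_cast; ring, Real.rpow_add hy]
    have : (2 * Real.pi) ^ (2 * p) = (2 * Real.pi) ^ (p * (2 : ℕ)) := by push_cast; ring_nf
    rw [this]
    push_cast
    ring_nf
  have hb : 0 < 2 * k * (2 * Real.pi) ^ q * t := by positivity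
  have hs : -1 < 2 * p + n - 1 := by linarith
  have hi : IntegrableOn (fun y => y ^ (n - 1) * h y ^ 2) (Set.Ioi 0) := by
    refine IntegrableOn.congr_fun ?_ (fun y hy => (key y hy).symm) measurableSet_Ioi
    exact (integrableOn_rpow_mul_exp_neg_mul_rpow hs hq hb).const_mul _
  have hI : ∫ y in Set.Ioi 0, y ^ (n - 1) * h y ^ 2 = (2 * Real.pi) ^ (2 * p) *
      ((2 * k * (2 * Real.pi) ^ q) ^ (-((2 * p + n) / q)) * (1 / q) *
      Real.Gamma ((2 * p + n) / q)) * t ^ (-((2 * p + n) / q)) := by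
    rw [setIntegral_congr_fun measurableSet_Ioi key, integral_const_mul,
      integral_rpow_mul_exp_neg_mul_rpow hq hs hb, sub_add_cancel, neg_div,
      Real.mul_rpow (by positivity) ht.le]
    ring
  have := eLpNorm_radial hn (h := h) (by fun_prop) hi
  simp only [hh] at this
  rw [this]
  apply ENNReal.ofReal_le_ofReal
  rw [← mul_assoc, ← hA]
  simp only [hh] at hI
  rw [hI, ← mul_assoc, ← hG, Real.sqrt_mul' _ (by positivity)]
  have e : √(t ^ (-((2 * p + n) / q))) = t ^ (-((2 * p + n) / (2 * q))) := by
    rw [Real.sqrt_eq_rpow, ← Real.rpow_mul ht.le]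
    congr 1
    field_simp
  rw [e]
  gcongr
  linarith

/-- The ball on which `2π‖ξ‖ ≤ R`. -/
def lowFreq (n : ℕ) (R : ℝ) : Set (Space n) := {ξ | 2 * Real.pi * ‖ξ‖ ≤ R}

theorem measurableSet_lowFreq (n : ℕ) (R : ℝ) : MeasurableSet (lowFreq n R) :=
  measurableSet_le (by fun_prop) measurable_const

/-- On the ball, t can be replaced by 1 + t at the cost of exp(kR^q), so the bound reaches t = 0
without a singularity. -/
theorem eLpNorm_indicator_rpow_mul_exp_le {n : ℕ} (hn : n ≠ 0) {p q k : ℝ} (hq : 0 < q)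
    (hk : 0 < k) (hp : 0 < 2 * p + n) (R : ℝ) :
    ∃ N : ℝ, 0 < N ∧ ∀ t : ℝ, 0 ≤ t →
      eLpNorm ((lowFreq n R).indicator fun ξ : Space n => (2 * Real.pi * ‖ξ‖) ^ p *
        Real.exp (-k * (2 * Real.pi * ‖ξ‖) ^ q * t)) 2 volume ≤
      ENNReal.ofReal (N * (1 + t) ^ (-((2 * p + n) / (2 * q)))) := by
  obtain ⟨N, hN, h⟩ := eLpNorm_rpow_mul_exp_le hn hq hk hp
  refine ⟨Real.exp (k * R ^ q) * N, by positivity, fun t ht => ?_⟩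
  have h1 : eLpNorm ((lowFreq n R).indicator fun ξ : Space n => (2 * Real.pi * ‖ξ‖) ^ p *
        Real.exp (-k * (2 * Real.pi * ‖ξ‖) ^ q * t)) 2 volume ≤
      eLpNorm (Real.exp (k * R ^ q) • fun ξ : Space n => (2 * Real.pi * ‖ξ‖) ^ p *
        Real.exp (-k * (2 * Real.pi * ‖ξ‖) ^ q * (1 + t))) 2 volume := by
    refine eLpNorm_mono fun ξ => ?_
    by_cases hξ : ξ ∈ lowFreq n R
    · rw [Set.indicator_of_mem hξ]
      have hx : 0 ≤ 2 * Real.pi * ‖ξ‖ := by positivity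
      have hR' : 2 * Real.pi * ‖ξ‖ ≤ R := hξ
      rw [Pi.smul_apply, smul_eq_mul, Real.norm_of_nonneg (by positivity),
        Real.norm_of_nonneg (by positivity), mul_left_comm, ← Real.exp_add]
      gcongr
      have : (2 * Real.pi * ‖ξ‖) ^ q ≤ R ^ q := Real.rpow_le_rpow hx hR' hq.le
      nlinarith
    · rw [Set.indicator_of_notMem hξ, norm_zero]; exact norm_nonneg _
  refine h1.trans ?_
  rw [eLpNorm_const_smul, Real.enorm_eq_ofReal (Real.exp_pos _).le, mul_assoc,
    ENNReal.ofReal_mul (Real.exp_pos _).le]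
  gcongr
  exact h (1 + t) (by linarith)

/-- The mean of sin² and cos² is 1/2, and the oscillating part of the primitive contributes at most
1/w. -/
theorem integral_sq_sin_or_cos_ge {f : ℝ → ℝ} (hf : f = Real.sin ∨ f = Real.cos) {w a b : ℝ}
    (hw : 0 < w) : (b - a) / 2 - 1 / w ≤ ∫ y in a..b, f (w * y) ^ 2 := by
  have hsc : ∀ u, |Real.sin u * Real.cos u| ≤ 1 := by
    intro u
    rw [abs_mul]
    exact mul_le_one₀ (Real.abs_sin_le_one u) (abs_nonneg _) (Real.abs_cos_le_one u)
  have h1 := abs_le.1 (hsc (w * a))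
  have h2 := abs_le.1 (hsc (w * b))
  have hmain : (w * b - w * a) / 2 - 1 ≤ ∫ u in (w * a)..(w * b), f u ^ 2 := by
    rcases hf with rfl | rfl
    · rw [integral_sin_sq]; linarith
    · rw [integral_cos_sq]; linarith
  rw [intervalIntegral.integral_comp_mul_left (fun u => f u ^ 2) hw.ne', smul_eq_mul,
    inv_mul_eq_div, le_div_iff₀ hw]
  have : ((b - a) / 2 - 1 / w) * w = (w * b - w * a) / 2 - 1 := by field_simp
  linarith

/-- Only the shell L ≤ 2π‖ξ‖ ≤ 2L with L = t^(-1/q) is kept. On it the exponential is bounded below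
and the power is comparable to L^p. The phase varies by wLt = w t^(1-1/q), which tends to infinity
because q > 1, so the oscillation averages out. -/
theorem le_eLpNorm_indicator_rpow_mul_osc {n : ℕ} (hn : n ≠ 0) {f : ℝ → ℝ}
    (hf : f = Real.sin ∨ f = Real.cos) {p q k w R : ℝ} (hq : 1 < q) (hk : 0 < k) (hw : 0 < w)
    (hR : 0 < R) : ∃ c T : ℝ, 0 < c ∧ 0 < T ∧ ∀ t : ℝ, T ≤ t →
      ENNReal.ofReal (c * t ^ (-((2 * p + n) / (2 * q)))) ≤
      eLpNorm ((lowFreq n R).indicator fun ξ : Space n => (2 * Real.pi * ‖ξ‖) ^ p *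
        f (w * (2 * Real.pi * ‖ξ‖) * t) *
        Real.exp (-k * (2 * Real.pi * ‖ξ‖) ^ q * t)) 2 volume := by
  have : Nonempty (Fin n) := ⟨⟨0, Nat.pos_of_ne_zero hn⟩⟩
  have hπ : 0 < 2 * Real.pi := by positivity
  have hq0 : 0 < q := by linarith
  have hfm : Continuous f := by
    rcases hf with rfl | rfl
    · exact Real.continuous_sin
    · exact Real.continuous_cos
  -- On the shell x^p ≥ min(1, 2^p) L^p for either sign of p, and x^q t ≤ 2^q because L^q t = 1.
  set m := min 1 ((2 : ℝ) ^ p) * Real.exp (-k * 2 ^ q) with hm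
  have hm0 : 0 < m := by positivity
  set B := volume.real (Metric.ball (0 : Space n) 1) with hB
  have hB0 : 0 < B := by
    rw [hB, measureReal_def]
    exact ENNReal.toReal_pos (Metric.measure_ball_pos _ _ one_pos).ne' measure_ball_lt_top.ne
  set c := √(n * (B * ((1 / (2 * Real.pi)) ^ (n - 1) * m ^ 2 * (1 / (8 * Real.pi))))) with hc
  have hc0 : 0 < c := by
    have : (0 : ℝ) < n := by exact_mod_cast Nat.pos_of_ne_zero hn
    positivity
  have lim1 : Tendsto (fun t : ℝ => w * t ^ (1 - 1 / q)) atTop atTop := by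
    refine Tendsto.const_mul_atTop hw (tendsto_rpow_atTop ?_)
    rw [sub_pos, div_lt_one hq0]; exact hq
  have lim2 : Tendsto (fun t : ℝ => 2 * t ^ (-(1 / q))) atTop (𝓝 0) := by
    simpa using (tendsto_rpow_neg_atTop (by positivity : 0 < 1 / q)).const_mul 2
  -- Any threshold at least 4 would do: it makes the boundary term 1/(2πwt) at most L/(8π), half of
  -- the main term (b - a)/2 = L/(4π). The second limit puts the shell inside the ball of radius R.
  obtain ⟨T, hT⟩ := ((lim1.eventually_ge_atTop 8).and
    ((lim2.eventually (gt_mem_nhds hR)).and (eventually_gt_atTop 0))).exists_forall_of_atTop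
  refine ⟨c, max T 1, hc0, by positivity, fun t ht => ?_⟩
  obtain ⟨h1, h2, ht0⟩ := hT t ((le_max_left _ _).trans ht)
  obtain ⟨L, hL⟩ : ∃ L, L = t ^ (-(1 / q)) := ⟨_, rfl⟩
  have hL0 : 0 < L := hL ▸ Real.rpow_pos_of_pos ht0 _
  rw [← hL] at h2
  have hLt : w * (L * t) = w * t ^ (1 - 1 / q) := by
    rw [hL, ← Real.rpow_add_one ht0.ne']; ring_nf
  rw [← hLt] at h1
  have hLq : L ^ q * t = 1 := by
    rw [hL, ← Real.rpow_mul ht0.le, neg_mul, one_div, inv_mul_cancel₀ hq0.ne', Real.rpow_neg_one,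
      inv_mul_cancel₀ ht0.ne']
  set a := L / (2 * Real.pi) with ha
  set b := 2 * L / (2 * Real.pi) with hb
  have ha0 : 0 < a := by positivity
  have hab : a ≤ b := by rw [ha, hb]; gcongr; linarith
  set h : ℝ → ℝ := (Set.Icc a b).indicator fun y => m * L ^ p * f (w * (2 * Real.pi) * t * y)
    with hh
  have hhm : Measurable h := by
    refine Measurable.indicator ?_ measurableSet_Icc
    have := hfm.measurable
    fun_prop
  have e1 : (fun y => y ^ (n - 1) * h y ^ 2) = (Set.Icc a b).indicator
      fun y => y ^ (n - 1) * (m * L ^ p * f (w * (2 * Real.pi) * t * y)) ^ 2 := by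
    ext y
    by_cases hy : y ∈ Set.Icc a b
    · simp only [hh, Set.indicator_of_mem hy]
    · simp only [hh, Set.indicator_of_notMem hy]; ring
  have hcont : Continuous fun y : ℝ =>
      y ^ (n - 1) * (m * L ^ p * f (w * (2 * Real.pi) * t * y)) ^ 2 := by fun_prop
  have hint : Integrable (fun y => y ^ (n - 1) * h y ^ 2) := by
    rw [e1, integrable_indicator_iff measurableSet_Icc]
    exact hcont.continuousOn.integrableOn_compact isCompact_Icc
  have hnorm := eLpNorm_radial hn hhm hint.integrableOn
  have hle : eLpNorm (fun ξ : Space n => h ‖ξ‖) 2 volume ≤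
      eLpNorm ((lowFreq n R).indicator fun ξ : Space n => (2 * Real.pi * ‖ξ‖) ^ p *
        f (w * (2 * Real.pi * ‖ξ‖) * t) *
        Real.exp (-k * (2 * Real.pi * ‖ξ‖) ^ q * t)) 2 volume := by
    refine eLpNorm_mono fun ξ => ?_
    by_cases hξ : ‖ξ‖ ∈ Set.Icc a b
    · have hx1 : L ≤ 2 * Real.pi * ‖ξ‖ := by
        have := hξ.1; rw [ha, div_le_iff₀ hπ] at this; linarith
      have hx2 : 2 * Real.pi * ‖ξ‖ ≤ 2 * L := by
        have := hξ.2; rw [hb, le_div_iff₀ hπ] at this; linarith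
      have hmem : ξ ∈ lowFreq n R := hx2.trans h2.le
      rw [Set.indicator_of_mem hmem]
      simp only [hh, Set.indicator_of_mem hξ]
      have e2 : w * (2 * Real.pi) * t * ‖ξ‖ = w * (2 * Real.pi * ‖ξ‖) * t := by ring
      rw [e2]
      generalize 2 * Real.pi * ‖ξ‖ = x at *
      have hx0 : 0 < x := by linarith
      have hp : min 1 ((2 : ℝ) ^ p) * L ^ p ≤ x ^ p := by
        rcases le_total 0 p with hp | hp
        · calc _ ≤ 1 * L ^ p := by gcongr; exact min_le_left _ _
            _ ≤ _ := by rw [one_mul]; exact Real.rpow_le_rpow hL0.le hx1 hp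
        · calc _ ≤ (2 : ℝ) ^ p * L ^ p := by gcongr; exact min_le_right _ _
            _ = (2 * L) ^ p := by rw [Real.mul_rpow (by norm_num) hL0.le]
            _ ≤ _ := Real.rpow_le_rpow_of_nonpos hx0 hx2 hp
      have he : Real.exp (-k * 2 ^ q) ≤ Real.exp (-k * x ^ q * t) := by
        apply Real.exp_le_exp.2
        have h3 : x ^ q ≤ (2 * L) ^ q := Real.rpow_le_rpow hx0.le hx2 hq0.le
        rw [Real.mul_rpow (by norm_num) hL0.le] at h3
        have h4 : x ^ q * t ≤ 2 ^ q := by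
          calc _ ≤ 2 ^ q * L ^ q * t := by gcongr
            _ = 2 ^ q * (L ^ q * t) := by ring
            _ = _ := by rw [hLq, mul_one]
        nlinarith
      simp only [norm_mul]
      rw [Real.norm_of_nonneg hm0.le, Real.norm_of_nonneg (by positivity : 0 ≤ L ^ p),
        Real.norm_of_nonneg (by positivity : 0 ≤ x ^ p), Real.norm_of_nonneg (Real.exp_pos _).le]
      calc _ = (min 1 ((2 : ℝ) ^ p) * L ^ p) * ‖f (w * x * t)‖ * Real.exp (-k * 2 ^ q) := by
            rw [hm]; ring
        _ ≤ _ := by gcongr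
    · simp only [hh, Set.indicator_of_notMem hξ, norm_zero]
      exact norm_nonneg _
  refine le_trans ?_ hle
  rw [hnorm]
  apply ENNReal.ofReal_le_ofReal
  have hI : (1 / (2 * Real.pi)) ^ (n - 1) * m ^ 2 * (1 / (8 * Real.pi)) * L ^ (2 * p + n) ≤
      ∫ y in Set.Ioi 0, y ^ (n - 1) * h y ^ 2 := by
    have e3 : ∫ y in Set.Ioi 0, y ^ (n - 1) * h y ^ 2 =
        ∫ y in Set.Icc a b, y ^ (n - 1) * (m * L ^ p * f (w * (2 * Real.pi) * t * y)) ^ 2 := by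
      rw [e1, setIntegral_indicator measurableSet_Icc]
      congr 2
      exact Set.inter_eq_right.2 fun y hy => ha0.trans_le hy.1
    rw [e3]
    have h3 : ∫ y in Set.Icc a b, a ^ (n - 1) * (m * L ^ p) ^ 2 *
        f (w * (2 * Real.pi) * t * y) ^ 2 ≤
        ∫ y in Set.Icc a b, y ^ (n - 1) * (m * L ^ p * f (w * (2 * Real.pi) * t * y)) ^ 2 := by
      refine setIntegral_mono_on ?_ (hcont.continuousOn.integrableOn_compact isCompact_Icc)
        measurableSet_Icc fun y hy => ?_
      · exact Continuous.integrableOn_Icc (by fun_prop)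
      · rw [mul_pow (m * L ^ p), ← mul_assoc (y ^ (n - 1))]
        have := ha0.trans_le hy.1
        gcongr
        exact hy.1
    refine le_trans ?_ h3
    rw [integral_const_mul, integral_Icc_eq_integral_Ioc,
      ← intervalIntegral.integral_of_le hab]
    have h4 := integral_sq_sin_or_cos_ge hf (w := w * (2 * Real.pi) * t) (a := a) (b := b)
      (by positivity)
    have h5 : L / (8 * Real.pi) ≤ (b - a) / 2 - 1 / (w * (2 * Real.pi) * t) := by
      have : (b - a) / 2 - 1 / (w * (2 * Real.pi) * t) - L / (8 * Real.pi) =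
          (w * (L * t) - 4) / (8 * Real.pi * w * t) := by
        rw [ha, hb]; field_simp; ring
      have h6 : 0 ≤ (w * (L * t) - 4) / (8 * Real.pi * w * t) := by
        apply div_nonneg <;> [linarith; positivity]
      linarith
    calc _ = a ^ (n - 1) * (m * L ^ p) ^ 2 * (L / (8 * Real.pi)) := by
          have : L ^ (2 * p + n) = (L ^ p) ^ 2 * L ^ (n - 1) * L := by
            rw [mul_assoc, ← pow_succ, Nat.sub_add_cancel (Nat.one_le_iff_ne_zero.2 hn),
              Real.rpow_add hL0, Real.rpow_natCast, mul_comm 2 p, Real.rpow_mul hL0.le]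
            norm_num
          rw [this, ha, div_pow, div_pow, one_pow]
          ring
      _ ≤ _ := by gcongr; exact h5.trans h4
  have e4 : t ^ (-((2 * p + n) / (2 * q))) = √(L ^ (2 * p + n)) := by
    rw [hL, Real.sqrt_eq_rpow, ← Real.rpow_mul ht0.le, ← Real.rpow_mul ht0.le]
    congr 1
    field_simp
  rw [e4, hc, ← Real.sqrt_mul (by positivity)]
  apply Real.sqrt_le_sqrt
  calc _ = n * (B * ((1 / (2 * Real.pi)) ^ (n - 1) * m ^ 2 * (1 / (8 * Real.pi)) *
        L ^ (2 * p + n))) := by ring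
    _ ≤ _ := by gcongr

/-! ### Tempered distributions whose Fourier transform is a function -/

section FourierFunction

variable {n : ℕ}

/-- A smooth bump equal to 1 on a given compact set is an admissible test function. -/
theorem locallyIntegrable_of_schwartz_mul {g : Space n → ℂ}
    (h : ∀ f : 𝓢(Space n, ℂ), Integrable fun ξ => f ξ * g ξ) : LocallyIntegrable g := by
  rw [locallyIntegrable_iff]
  intro K hK
  obtain ⟨R, hR⟩ := hK.isBounded.subset_closedBall (0 : Space n)
  let φ : ContDiffBump (0 : Space n) := ⟨|R| + 1, |R| + 2, by positivity, by linarith⟩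
  have h1 : HasCompactSupport (Complex.ofRealCLM ∘ φ) := φ.hasCompactSupport.comp_left rfl
  have h2 : ContDiff ℝ ∞ (Complex.ofRealCLM ∘ φ) := Complex.ofRealCLM.contDiff.comp φ.contDiff
  have hi := (h (h1.toSchwartzMap h2)).integrableOn (s := K)
  refine hi.congr_fun_ae ?_
  filter_upwards [ae_restrict_mem hK.measurableSet] with ξ hξ
  have : φ ξ = 1 := φ.one_of_mem_closedBall (by
    have := hR hξ
    simp only [Metric.mem_closedBall, dist_zero_right] at this ⊢
    exact this.trans ((le_abs_self R).trans (by linarith [show φ.rIn = |R| + 1 from rfl])))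
  simp [this]

/-- The fundamental lemma of the calculus of variations. It makes the Fourier function unique up to
null sets, so that norms and identities can be read off any representative. -/
theorem ae_eq_of_integral_schwartz_mul_eq {g g' : Space n → ℂ}
    (h : ∀ f : 𝓢(Space n, ℂ), Integrable fun ξ => f ξ * g ξ)
    (h' : ∀ f : 𝓢(Space n, ℂ), Integrable fun ξ => f ξ * g' ξ)
    (heq : ∀ f : 𝓢(Space n, ℂ), ∫ ξ, f ξ * g ξ = ∫ ξ, f ξ * g' ξ) : g =ᵐ[volume] g' := by
  refine ae_eq_of_integral_contDiff_smul_eq (locallyIntegrable_of_schwartz_mul h)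
    (locallyIntegrable_of_schwartz_mul h') fun φ hφ hφc => ?_
  have h1 : HasCompactSupport (Complex.ofRealCLM ∘ φ) := hφc.comp_left rfl
  have h2 : ContDiff ℝ ∞ (Complex.ofRealCLM ∘ φ) := Complex.ofRealCLM.contDiff.comp hφ
  simpa using heq (h1.toSchwartzMap h2)

theorem HasFourierFunction.ae_eq {u : Distr n} {g g' : Space n → ℂ} (h : HasFourierFunction u g)
    (h' : HasFourierFunction u g') : g =ᵐ[volume] g' :=
  ae_eq_of_integral_schwartz_mul_eq (fun f => (h f).1) (fun f => (h' f).1) fun f =>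
    (h f).2.symm.trans (h' f).2

theorem HasFourierFunction.congr {u : Distr n} {g g' : Space n → ℂ} (h : HasFourierFunction u g)
    (hg : g =ᵐ[volume] g') : HasFourierFunction u g' := by
  intro f
  have : (fun ξ => f ξ * g ξ) =ᵐ[volume] fun ξ => f ξ * g' ξ := by
    filter_upwards [hg] with ξ hξ; rw [hξ]
  exact ⟨(h f).1.congr this, (h f).2.trans (integral_congr_ae this)⟩

theorem HasFourierFunction.add {u v : Distr n} {g g' : Space n → ℂ} (h : HasFourierFunction u g)
    (h' : HasFourierFunction v g') : HasFourierFunction (u + v) fun ξ => g ξ + g' ξ := by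
  intro f
  simp only [mul_add]
  refine ⟨(h f).1.add (h' f).1, ?_⟩
  rw [integral_add (h f).1 (h' f).1, ← (h f).2, ← (h' f).2]
  rfl

theorem HasFourierFunction.smul {u : Distr n} {g : Space n → ℂ} (h : HasFourierFunction u g)
    (c : ℂ) : HasFourierFunction (c • u) fun ξ => c * g ξ := by
  intro f
  simp only [mul_left_comm _ c]
  refine ⟨(h f).1.const_mul c, ?_⟩
  rw [integral_const_mul, ← (h f).2]
  rfl

theorem HasFourierFunction.sub {u v : Distr n} {g g' : Space n → ℂ} (h : HasFourierFunction u g)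
    (h' : HasFourierFunction v g') : HasFourierFunction (u - v) fun ξ => g ξ - g' ξ := by
  have e : u - v = u + (-1 : ℂ) • v := by
    ext f
    change u f - v f = u f + (-1 : ℂ) • v f
    simp [sub_eq_add_neg]
  rw [e]
  convert h.add (h'.smul (-1)) using 2 with ξ
  ring

theorem homSobolevNorm_eq {u : Distr n} {g : Space n → ℂ} (h : HasFourierFunction u g) (r : ℝ) :
    homSobolevNorm r u = eLpNorm (fun ξ => (((2 * Real.pi * ‖ξ‖) ^ r : ℝ) : ℂ) * g ξ) 2 volume := by
  apply le_antisymm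
  · exact iInf₂_le g h
  · refine le_iInf₂ fun g' h' => le_of_eq (eLpNorm_congr_ae ?_)
    filter_upwards [h.ae_eq h'] with ξ hξ
    rw [hξ]

theorem hasFourierFunction_smulLeft {u v : Distr n} {g m : Space n → ℂ}
    (hm : m.HasTemperateGrowth) (h : HasFourierFunction u g) (hv : 𝓕 v = smulLeftCLM ℂ m (𝓕 u)) :
    HasFourierFunction v fun ξ => m ξ * g ξ := by
  intro f
  have h1 := h (SchwartzMap.smulLeftCLM ℂ m f)
  have e : (fun ξ => SchwartzMap.smulLeftCLM ℂ m f ξ * g ξ) = fun ξ => f ξ * (m ξ * g ξ) := by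
    ext ξ
    rw [SchwartzMap.smulLeftCLM_apply_apply hm, smul_eq_mul]; ring
  rw [e] at h1
  refine ⟨h1.1, ?_⟩
  rw [hv, smulLeftCLM_apply_apply]
  exact h1.2

theorem HasFourierFunction.laplacian {u : Distr n} {g : Space n → ℂ} (h : HasFourierFunction u g) :
    HasFourierFunction (Δ u) fun ξ => -((((2 * Real.pi * ‖ξ‖) ^ 2 : ℝ) : ℂ) * g ξ) := by
  have hm : (fun ξ : Space n => Complex.ofReal (‖ξ‖ ^ 2)).HasTemperateGrowth := by fun_prop
  have h1 : HasFourierFunction (fourierMultiplierCLM ℂ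
      (fun ξ : Space n => Complex.ofReal (‖ξ‖ ^ 2)) u) fun ξ => Complex.ofReal (‖ξ‖ ^ 2) * g ξ := by
    refine hasFourierFunction_smulLeft hm h ?_
    rw [fourierMultiplierCLM_apply, fourier_fourierInv_eq]
  have h2 := h1.smul (-((2 * Real.pi) ^ 2 : ℝ) : ℂ)
  have e : Δ u = (-((2 * Real.pi) ^ 2 : ℝ) : ℂ) •
      fourierMultiplierCLM ℂ (fun ξ : Space n => Complex.ofReal (‖ξ‖ ^ 2)) u := by
    rw [laplacian_eq_fourierMultiplierCLM, ← Complex.coe_smul]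
    simp
  rw [e]
  convert h2 using 2 with ξ
  push_cast; ring

theorem integrable_schwartz_mul_Lp (φ : 𝓢(Space n, ℂ))
    (f : Lp ℂ 2 (volume : Measure (Space n))) : Integrable fun ξ => φ ξ * f ξ := by
  have h1 : MemLp (fun ξ => φ ξ) 2 volume := φ.memLp 2 volume
  have h2 : MemLp (fun ξ => f ξ) 2 volume := Lp.memLp f
  exact h1.integrable_mul h2

theorem hasFourierFunction_toTemperedDistribution (f : Lp ℂ 2 (volume : Measure (Space n))) :
    HasFourierFunction (f : Distr n) (𝓕 f : Lp ℂ 2 (volume : Measure (Space n))) := by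
  intro φ
  refine ⟨integrable_schwartz_mul_Lp φ _, ?_⟩
  rw [Lp.fourier_toTemperedDistribution_eq, Lp.toTemperedDistribution_apply]
  simp

theorem hasFourierFunction_fourierInv (f : Lp ℂ 2 (volume : Measure (Space n))) :
    HasFourierFunction (𝓕⁻ (f : Distr n)) f := by
  intro φ
  refine ⟨integrable_schwartz_mul_Lp φ _, ?_⟩
  rw [fourier_fourierInv_eq, Lp.toTemperedDistribution_apply]
  simp

theorem besselWeight_mul_besselWeight (r s : ℝ) (ξ : Space n) :
    (((1 + ‖ξ‖ ^ 2) ^ (r / 2) : ℝ) : ℂ) * (((1 + ‖ξ‖ ^ 2) ^ (s / 2) : ℝ) : ℂ) =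
      (((1 + ‖ξ‖ ^ 2) ^ ((r + s) / 2) : ℝ) : ℂ) := by
  rw [← Complex.ofReal_mul, ← Real.rpow_add (by positivity)]
  ring_nf

/-- The Fourier function of a distribution in `H^r`. -/
theorem hasFourierFunction_of_besselPotential {r : ℝ} {u : Distr n}
    {U : Lp ℂ 2 (volume : Measure (Space n))} (h : besselPotential (Space n) ℂ r u = U) :
    HasFourierFunction u fun ξ => (((1 + ‖ξ‖ ^ 2) ^ (-r / 2) : ℝ) : ℂ) *
      (𝓕 U : Lp ℂ 2 (volume : Measure (Space n))) ξ := by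
  refine hasFourierFunction_smulLeft (u := (U : Distr n)) (by fun_prop)
    (hasFourierFunction_toTemperedDistribution U) ?_
  rw [← h, fourier_besselPotential_eq_smulLeftCLM_fourier_apply,
    smulLeftCLM_smulLeftCLM_apply (by fun_prop) (by fun_prop)]
  have : ((fun x : Space n => (((1 + ‖x‖ ^ 2) ^ (r / 2) : ℝ) : ℂ)) * fun x : Space n =>
      (((1 + ‖x‖ ^ 2) ^ (-r / 2) : ℝ) : ℂ)) = fun _ => 1 := by
    ext x
    rw [Pi.mul_apply, besselWeight_mul_besselWeight]
    simp
  rw [this]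
  simp

/-- The Fourier transform moves from one factor to the other under the integral, by Fubini;
boundedness of the transform gives integrability against Schwartz functions. -/
theorem hasFourierFunction_L1 (d : Lp ℂ 1 (volume : Measure (Space n))) :
    HasFourierFunction (d : Distr n) (𝓕 (d : Space n → ℂ)) := by
  intro φ
  have hd := L1.integrable_coeFn d
  constructor
  · have : (𝓕 (d : Space n → ℂ)) = Real.Lp.fourierTransform d := rfl
    rw [this]
    exact (φ.integrable (μ := volume)).mul_bdd (c := ‖Real.Lp.fourierTransform d‖)
      (Real.Lp.fourierTransform d).continuous.aestronglyMeasurable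
      (ae_of_all _ fun ξ => BoundedContinuousFunction.norm_coe_le_norm _ _)
  · have h := VectorFourier.integral_fourierIntegral_smul_eq_flip (L := innerₗ (Space n))
      Real.continuous_fourierChar continuous_inner (φ.integrable (μ := volume)) hd
    rw [TemperedDistribution.fourier_apply, Lp.toTemperedDistribution_apply]
    simp only [smul_eq_mul, flip_innerₗ] at h ⊢
    exact h

theorem norm_fourier_L1_le (d : Lp ℂ 1 (volume : Measure (Space n))) (ξ : Space n) :
    ‖𝓕 (d : Space n → ℂ) ξ‖ ≤ ‖d‖ := by
  rw [Real.fourier_eq]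
  refine (norm_integral_le_integral_norm _).trans ?_
  simp_rw [Circle.norm_smul]
  exact (L1.norm_eq_integral_norm d).symm.le

theorem continuous_fourier_L1 (d : Lp ℂ 1 (volume : Measure (Space n))) :
    Continuous (𝓕 (d : Space n → ℂ)) :=
  (Real.Lp.fourierTransform d).continuous

theorem dataMean_eq (τ : ℝ) (data : Fin 3 → Lp ℂ 1 (volume : Measure (Space n))) :
    dataMean τ data =
      𝓕 (data 1 : Space n → ℂ) 0 + τ * 𝓕 (data 2 : Space n → ℂ) 0 := by
  rw [dataMean, integral_add (L1.integrable_coeFn _) ((L1.integrable_coeFn _).const_mul _),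
    integral_const_mul, Real.fourier_eq, Real.fourier_eq]
  simp

/-- The `H^r` norm bounds the weighted `L²` norm of the Fourier function. -/
theorem eLpNorm_le_sobolevNorm (r : ℝ) {u : Distr n} {g : Space n → ℂ}
    (h : HasFourierFunction u g) :
    eLpNorm (fun ξ => (((1 + ‖ξ‖ ^ 2) ^ (r / 2) : ℝ) : ℂ) * g ξ) 2 volume ≤ sobolevNorm r u := by
  refine le_iInf₂ fun U hU => ?_
  have h1 := h.ae_eq (hasFourierFunction_of_besselPotential hU)
  have h2 : ‖U‖ₑ = eLpNorm (𝓕 U : Lp ℂ 2 (volume : Measure (Space n))) 2 volume := by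
    rw [← Lp.enorm_def, ← ofReal_norm, ← ofReal_norm, Lp.norm_fourier_eq]
  rw [h2]
  refine le_of_eq (eLpNorm_congr_ae ?_)
  filter_upwards [h1] with ξ hξ
  rw [hξ, ← mul_assoc, besselWeight_mul_besselWeight]
  simp

end FourierFunction

/-! ### Linear ordinary differential equations with multiplication operators in `L²` -/

section Multiplication

variable {X : Type*} [MeasurableSpace X] {ρ : Measure X}

theorem norm_taylor_le {F F' F'' : ℝ → ℂ} {t s M : ℝ} (hd : ∀ r, HasDerivAt F (F' r) r)
    (hd' : ∀ r, HasDerivAt F' (F'' r) r) (hM : ∀ r ∈ Set.uIcc t s, ‖F'' r‖ ≤ M) :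
    ‖F s - F t - (s - t) • F' t‖ ≤ M * ‖s - t‖ ^ 2 := by
  have hsub : ∀ r ∈ Set.uIcc t s, ‖r - t‖ ≤ ‖s - t‖ := fun r hr => by
    simpa [Real.norm_eq_abs] using Set.abs_sub_left_of_mem_uIcc hr
  have hM0 : 0 ≤ M := (norm_nonneg _).trans (hM t Set.left_mem_uIcc)
  have h1 : ∀ r ∈ Set.uIcc t s, ‖F' r - F' t‖ ≤ M * ‖s - t‖ := by
    intro r hr
    have := (convex_uIcc t s).norm_image_sub_le_of_norm_hasDerivWithin_le
      (fun x _ => (hd' x).hasDerivWithinAt) hM Set.left_mem_uIcc hr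
    exact this.trans (by gcongr; exact hsub r hr)
  have h2 : ∀ r ∈ Set.uIcc t s, HasDerivWithinAt (fun r => F r - r • F' t) (F' r - F' t)
      (Set.uIcc t s) r := by
    intro r _
    have h : HasDerivAt (fun r => F r - r • F' t) (F' r - F' t) r :=
      ((hd r).sub ((hasDerivAt_id r).smul_const (F' t))).congr_deriv (by simp)
    exact h.hasDerivWithinAt
  have h3 := (convex_uIcc t s).norm_image_sub_le_of_norm_hasDerivWithin_le h2 h1
    Set.left_mem_uIcc Set.right_mem_uIcc
  have e : F s - F t - (s - t) • F' t = F s - s • F' t - (F t - t • F' t) := by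
    rw [sub_smul]; abel
  rw [e]
  refine h3.trans (le_of_eq ?_)
  ring

/-- A pointwise derivative is a derivative in L^∞ once the second derivative is bounded uniformly in
x, because Taylor's remainder is then O((s - t)²) uniformly. -/
theorem hasDerivAt_toLp_top {F F' F'' : ℝ → X → ℂ} (hF : ∀ t, MemLp (F t) ⊤ ρ)
    (hF' : ∀ t, MemLp (F' t) ⊤ ρ) (hd : ∀ t x, HasDerivAt (fun r => F r x) (F' t x) t)
    (hd' : ∀ t x, HasDerivAt (fun r => F' r x) (F'' t x) t)
    (hb : ∀ T, ∃ M, ∀ t, |t| ≤ T → ∀ x, ‖F'' t x‖ ≤ M) (t : ℝ) :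
    HasDerivAt (fun t => (hF t).toLp (F t)) ((hF' t).toLp (F' t)) t := by
  obtain ⟨M, hM⟩ := hb (|t| + 1)
  rw [hasDerivAt_iff_isLittleO]
  refine Asymptotics.IsBigO.trans_isLittleO ?_ (Asymptotics.isLittleO_pow_sub_sub t one_lt_two)
  refine Asymptotics.IsBigO.of_bound |M| ?_
  filter_upwards [Metric.ball_mem_nhds t one_pos] with s hs
  have hs1 : |s - t| < 1 := by simpa [Real.dist_eq] using hs
  have hbd : ∀ x, ‖F s x - F t x - (s - t) • F' t x‖ ≤ |M| * ‖s - t‖ ^ 2 := by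
    intro x
    refine norm_taylor_le (fun r => hd r x) (fun r => hd' r x) fun r hr => ?_
    refine (hM r ?_ x).trans (le_abs_self M)
    have h1 : |r - t| ≤ |s - t| := Set.abs_sub_left_of_mem_uIcc hr
    have h2 : |r| ≤ |r - t| + |t| := by simpa using abs_add_le (r - t) t
    linarith
  rw [norm_pow, norm_norm, ← MemLp.toLp_sub, ← MemLp.toLp_const_smul, ← MemLp.toLp_sub,
    Lp.norm_toLp, eLpNorm_exponent_top]
  refine ENNReal.toReal_le_of_le_ofReal (by positivity) ?_
  exact eLpNormEssSup_le_of_ae_bound (ae_of_all _ hbd)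

variable (ρ) in
/-- Multiplication of `L²` functions by bounded functions. -/
def mulL : Lp ℂ ⊤ ρ →L[ℝ] Lp ℂ 2 ρ →L[ℝ] Lp ℂ 2 ρ :=
  (ContinuousLinearMap.mul ℝ ℂ).holderL ρ ⊤ 2 2

theorem coeFn_mulL {m : X → ℂ} (hm : MemLp m ⊤ ρ) (f : Lp ℂ 2 ρ) :
    mulL ρ (hm.toLp m) f =ᵐ[ρ] fun x => m x * f x := by
  have h1 : mulL ρ (hm.toLp m) f = (ContinuousLinearMap.mul ℝ ℂ).holder 2 (hm.toLp m) f := rfl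
  rw [h1]
  filter_upwards [(ContinuousLinearMap.mul ℝ ℂ).coeFn_holder (r := 2) (hm.toLp m) f,
    hm.coeFn_toLp] with x hx hx'
  rw [hx, hx']
  rfl

end Multiplication

/-! ### Multiplication operators on balls of frequencies and uniqueness for the second order
equation -/

section CutOff

variable {n : ℕ}

theorem isCompact_lowFreq (n : ℕ) (R : ℝ) : IsCompact (lowFreq n R) := by
  refine Metric.isCompact_of_isClosed_isBounded
    (isClosed_le (by fun_prop) continuous_const) ?_
  refine (Metric.isBounded_closedBall (x := (0 : Space n)) (r := R / (2 * Real.pi))).subset ?_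
  intro ξ hξ
  have : 2 * Real.pi * ‖ξ‖ ≤ R := hξ
  rw [Metric.mem_closedBall, dist_zero_right, le_div_iff₀ (by positivity)]
  linarith

theorem memLp_top_indicator_lowFreq {m : Space n → ℂ} (hm : Continuous m) (R : ℝ) :
    MemLp ((lowFreq n R).indicator m) ⊤ volume := by
  obtain ⟨M, hM⟩ := (isCompact_lowFreq n R).exists_bound_of_continuousOn hm.continuousOn
  refine memLp_top_of_bound (hm.aestronglyMeasurable.indicator (measurableSet_lowFreq n R)) |M|
    (ae_of_all _ fun ξ => ?_)
  by_cases hξ : ξ ∈ lowFreq n R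
  · rw [Set.indicator_of_mem hξ]; exact (hM ξ hξ).trans (le_abs_self M)
  · rw [Set.indicator_of_notMem hξ, norm_zero]; exact abs_nonneg _

/-- Multiplication by a continuous function on a ball, as an operator of `L²`. -/
def cutMul (R : ℝ) {m : Space n → ℂ} (hm : Continuous m) :
    Lp ℂ 2 (volume : Measure (Space n)) →L[ℝ] Lp ℂ 2 (volume : Measure (Space n)) :=
  mulL volume ((memLp_top_indicator_lowFreq hm R).toLp _)

theorem coeFn_cutMul (R : ℝ) {m : Space n → ℂ} (hm : Continuous m)
    (f : Lp ℂ 2 (volume : Measure (Space n))) :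
    ∀ᵐ ξ, cutMul R hm f ξ = (lowFreq n R).indicator m ξ * f ξ :=
  coeFn_mulL _ f

theorem hasDerivWithinAt_cutMul {R : ℝ} {m : Space n → ℂ} (hm : Continuous m) {S : Set ℝ}
    {f : ℝ → Lp ℂ 2 (volume : Measure (Space n))} {f' : Lp ℂ 2 (volume : Measure (Space n))} {t : ℝ}
    (h : HasDerivWithinAt f f' S t) :
    HasDerivWithinAt (fun t => cutMul R hm (f t)) (cutMul R hm f') S t :=
  (cutMul R hm).hasFDerivAt.comp_hasDerivWithinAt t h

/-- On a compact ball times a bounded time interval the continuous second derivative is bounded, so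
`hasDerivAt_toLp_top` applies. This is why the multipliers are cut off. -/
theorem hasDerivAt_cutMul {R : ℝ} {m m' m'' : ℝ → Space n → ℂ} (hm : ∀ t, Continuous (m t))
    (hm' : ∀ t, Continuous (m' t)) (hm'' : Continuous fun p : Space n × ℝ => m'' p.2 p.1)
    (hd : ∀ t ξ, HasDerivAt (fun r => m r ξ) (m' t ξ) t)
    (hd' : ∀ t ξ, HasDerivAt (fun r => m' r ξ) (m'' t ξ) t) (t : ℝ)
    (f : Lp ℂ 2 (volume : Measure (Space n))) :
    HasDerivAt (fun t => cutMul R (hm t) f) (cutMul R (hm' t) f) t := by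
  have h := hasDerivAt_toLp_top (ρ := (volume : Measure (Space n)))
    (F := fun t => (lowFreq n R).indicator (m t))
    (F' := fun t => (lowFreq n R).indicator (m' t))
    (F'' := fun t => (lowFreq n R).indicator (m'' t))
    (fun t => memLp_top_indicator_lowFreq (hm t) R)
    (fun t => memLp_top_indicator_lowFreq (hm' t) R) ?_ ?_ ?_ t
  · exact (((mulL volume).flip f).hasFDerivAt.comp_hasDerivAt t h)
  · intro t ξ
    by_cases hξ : ξ ∈ lowFreq n R
    · simpa only [Set.indicator_of_mem hξ] using hd t ξ
    · simpa only [Set.indicator_of_notMem hξ] using hasDerivAt_const t (0 : ℂ)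
  · intro t ξ
    by_cases hξ : ξ ∈ lowFreq n R
    · simpa only [Set.indicator_of_mem hξ] using hd' t ξ
    · simpa only [Set.indicator_of_notMem hξ] using hasDerivAt_const t (0 : ℂ)
  · intro T
    obtain ⟨M, hM⟩ := ((isCompact_lowFreq n R).prod (isCompact_Icc (a := -T) (b := T)))
      |>.exists_bound_of_continuousOn hm''.continuousOn
    refine ⟨|M|, fun t ht ξ => ?_⟩
    by_cases hξ : ξ ∈ lowFreq n R
    · simp only [Set.indicator_of_mem hξ]
      exact (hM (ξ, t) ⟨hξ, abs_le.1 ht⟩).trans (le_abs_self M)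
    · simp only [Set.indicator_of_notMem hξ, norm_zero]; exact abs_nonneg _

/-- Grönwall's inequality for the first order system (Z₀, Z₁), with one-sided derivatives as at the
initial time. -/
theorem eq_zero_of_second_order {E : Type*} [NormedAddCommGroup E] [NormedSpace ℝ E]
    {Z₀ Z₁ Z₂ : ℝ → E} (A B : E →L[ℝ] E)
    (h0 : ∀ t, 0 ≤ t → HasDerivWithinAt Z₀ (Z₁ t) (Set.Ici 0) t)
    (h1 : ∀ t, 0 ≤ t → HasDerivWithinAt Z₁ (Z₂ t) (Set.Ici 0) t)
    (h2 : ∀ t, 0 ≤ t → Z₂ t = -A (Z₁ t) - B (Z₀ t)) (i0 : Z₀ 0 = 0) (i1 : Z₁ 0 = 0) :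
    ∀ t, 0 ≤ t → Z₀ t = 0 ∧ Z₁ t = 0 := by
  intro t ht
  have hmono : ∀ x : ℝ, 0 ≤ x → Set.Ici x ⊆ Set.Ici 0 := fun x hx => Set.Ici_subset_Ici.2 hx
  have key := eq_zero_of_abs_deriv_le_mul_abs_self_of_eq_zero_right (a := 0) (b := t)
    (f := fun t => (Z₀ t, Z₁ t)) (f' := fun t => (Z₁ t, Z₂ t)) (K := 1 + ‖A‖ + ‖B‖) ?_ ?_ ?_ ?_
    t ⟨ht, le_rfl⟩
  · exact Prod.mk_eq_zero.1 key
  · intro x hx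
    exact (((h0 x hx.1).continuousWithinAt).prodMk ((h1 x hx.1).continuousWithinAt)).mono
      fun y hy => hy.1
  · intro x hx
    exact (((h0 x hx.1).mono (hmono x hx.1)).prodMk ((h1 x hx.1).mono (hmono x hx.1)))
  · simp [i0, i1]
  · intro x hx
    set N := ‖(Z₀ x, Z₁ x)‖ with hN
    have n0 : ‖Z₀ x‖ ≤ N := norm_fst_le (Z₀ x, Z₁ x)
    have n1 : ‖Z₁ x‖ ≤ N := norm_snd_le (Z₀ x, Z₁ x)
    have hN0 : 0 ≤ N := norm_nonneg _
    have b1 : ‖Z₂ x‖ ≤ ‖A‖ * N + ‖B‖ * N := by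
      rw [h2 x hx.1]
      refine (norm_sub_le _ _).trans ?_
      rw [norm_neg]
      exact add_le_add ((A.le_opNorm _).trans (by gcongr)) ((B.le_opNorm _).trans (by gcongr))
    have hA : 0 ≤ ‖A‖ * N := by positivity
    have hB : 0 ≤ ‖B‖ * N := by positivity
    rw [Prod.norm_def]
    refine max_le ?_ ?_
    · simp only; linarith
    · simp only; linarith

/-- Solutions of the second order equation with an exponentially decaying source, whose
coefficients act by multiplication, are given by the kernels on every ball. -/
theorem ae_eq_dataKernel {μ : ℝ} {β γ : Space n → ℝ} (hβ : Continuous β) (hγ : Continuous γ)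
    {V : Fin 3 → ℝ → Lp ℂ 2 (volume : Measure (Space n))}
    (h0 : ∀ t, 0 ≤ t → HasDerivWithinAt (V 0) (V 1 t) (Set.Ici 0) t)
    (h1 : ∀ t, 0 ≤ t → HasDerivWithinAt (V 1) (V 2 t) (Set.Ici 0) t)
    (hc : ContinuousOn (V 2) (Set.Ici 0))
    (heq : ∀ s t : ℝ, 0 < s → s ≤ t → ∀ᵐ ξ, V 2 t ξ + β ξ * V 1 t ξ + γ ξ * V 0 t ξ =
      Real.exp (-μ * (t - s)) * (V 2 s ξ + β ξ * V 1 s ξ + γ ξ * V 0 s ξ))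
    (R : ℝ) {t : ℝ} (ht : 0 ≤ t) (j : Fin 3) :
    ∀ᵐ ξ, ξ ∈ lowFreq n R → V j t ξ = ∑ k, dataKernel μ (β ξ) (γ ξ) k j t * V k 0 ξ := by
  have hβc : Continuous fun ξ => (β ξ : ℂ) := by fun_prop
  have hγc : Continuous fun ξ => (γ ξ : ℂ) := by fun_prop
  have h1c : Continuous fun _ : Space n => (1 : ℂ) := continuous_const
  have hK : ∀ (k : Fin 3) (j : ℕ), Continuous fun p : Space n × ℝ =>
      dataKernel μ (β p.1) (γ p.1) k j p.2 := fun k j =>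
    (continuous_dataKernel μ k j).comp (g := fun p : (ℝ × ℝ) × ℝ => dataKernel μ p.1.1 p.1.2 k j p.2)
      (f := fun p : Space n × ℝ => ((β p.1, γ p.1), p.2)) (by fun_prop)
  have hKt : ∀ (k : Fin 3) (j : ℕ) (t : ℝ), Continuous fun ξ : Space n =>
      dataKernel μ (β ξ) (γ ξ) k j t := fun k j t =>
    (hK k j).comp (f := fun ξ : Space n => (ξ, t)) (by fun_prop)
  -- the equation up to the initial time
  set Q : ℝ → Lp ℂ 2 (volume : Measure (Space n)) := fun t =>
    cutMul R h1c (V 2 t) + cutMul R hβc (V 1 t) + cutMul R hγc (V 0 t) with hQ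
  have hQae : ∀ t, ∀ᵐ ξ, Q t ξ = (lowFreq n R).indicator
      (fun ξ => V 2 t ξ + β ξ * V 1 t ξ + γ ξ * V 0 t ξ) ξ := by
    intro t
    filter_upwards [coeFn_cutMul R h1c (V 2 t), coeFn_cutMul R hβc (V 1 t),
      coeFn_cutMul R hγc (V 0 t), Lp.coeFn_add (cutMul R h1c (V 2 t) + cutMul R hβc (V 1 t))
      (cutMul R hγc (V 0 t)), Lp.coeFn_add (cutMul R h1c (V 2 t)) (cutMul R hβc (V 1 t))]
      with ξ e1 e2 e3 e4 e5
    rw [hQ, e4, Pi.add_apply, e5, Pi.add_apply, e1, e2, e3]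
    by_cases hξ : ξ ∈ lowFreq n R
    · simp only [Set.indicator_of_mem hξ, one_mul]
    · simp only [Set.indicator_of_notMem hξ]; ring
  have hQs : ∀ s t : ℝ, 0 < s → s ≤ t → Q t = Real.exp (-μ * (t - s)) • Q s := by
    intro s t hs hst
    refine Lp.ext ?_
    filter_upwards [hQae s, hQae t, heq s t hs hst,
      Lp.coeFn_smul (Real.exp (-μ * (t - s))) (Q s)] with ξ e1 e2 e3 e4
    rw [e2, e4, Pi.smul_apply, e1]
    by_cases hξ : ξ ∈ lowFreq n R
    · simp only [Set.indicator_of_mem hξ]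
      rw [e3, Complex.real_smul]
    · simp only [Set.indicator_of_notMem hξ, smul_zero]
  have hQc : ContinuousWithinAt Q (Set.Ici 0) 0 := by
    have c2 := hc 0 Set.self_mem_Ici
    have c1 := (h1 0 le_rfl).continuousWithinAt
    have c0 := (h0 0 le_rfl).continuousWithinAt
    exact (((cutMul R h1c).continuous.continuousAt.comp_continuousWithinAt c2).add
      ((cutMul R hβc).continuous.continuousAt.comp_continuousWithinAt c1)).add
      ((cutMul R hγc).continuous.continuousAt.comp_continuousWithinAt c0)
  have hQ0 : ∀ t, 0 ≤ t → Q t = Real.exp (-μ * t) • Q 0 := by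
    intro t ht
    rcases ht.eq_or_lt with rfl | ht
    · simp
    -- The equation is known only for s > 0. Letting s decrease to 0, the constant is identified
    -- with the value determined by the initial data.
    have l1 : Tendsto (fun s => Real.exp (-μ * (t - s)) • Q s) (𝓝[>] 0)
        (𝓝 (Real.exp (-μ * (t - 0)) • Q 0)) := by
      refine Tendsto.smul ?_ (hQc.mono_left (nhdsWithin_mono _ Set.Ioi_subset_Ici_self))
      have : Continuous fun s => Real.exp (-μ * (t - s)) := by fun_prop
      exact this.continuousWithinAt
    have l2 : Tendsto (fun s => Real.exp (-μ * (t - s)) • Q s) (𝓝[>] 0) (𝓝 (Q t)) := by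
      refine tendsto_const_nhds.congr' ?_
      filter_upwards [Ioc_mem_nhdsGT ht] with s hs
      exact hQs s t hs.1 hs.2
    rw [tendsto_nhds_unique l2 l1, sub_zero]
  -- the difference with the candidate
  set Z : ℕ → (ℝ → Lp ℂ 2 (volume : Measure (Space n))) → ℝ →
      Lp ℂ 2 (volume : Measure (Space n)) := fun j W t =>
    cutMul R h1c (W t) - (cutMul R (hKt 0 j t) (V 0 0) + cutMul R (hKt 1 j t) (V 1 0) +
      cutMul R (hKt 2 j t) (V 2 0)) with hZ
  have hZae : ∀ j W t, ∀ᵐ ξ, Z j W t ξ = (lowFreq n R).indicator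
      (fun ξ => W t ξ - ∑ k, dataKernel μ (β ξ) (γ ξ) k j t * V k 0 ξ) ξ := by
    intro j W t
    filter_upwards [coeFn_cutMul R h1c (W t), coeFn_cutMul R (hKt 0 j t) (V 0 0),
      coeFn_cutMul R (hKt 1 j t) (V 1 0), coeFn_cutMul R (hKt 2 j t) (V 2 0),
      Lp.coeFn_sub (cutMul R h1c (W t)) (cutMul R (hKt 0 j t) (V 0 0) +
        cutMul R (hKt 1 j t) (V 1 0) + cutMul R (hKt 2 j t) (V 2 0)),
      Lp.coeFn_add (cutMul R (hKt 0 j t) (V 0 0) + cutMul R (hKt 1 j t) (V 1 0))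
        (cutMul R (hKt 2 j t) (V 2 0)),
      Lp.coeFn_add (cutMul R (hKt 0 j t) (V 0 0)) (cutMul R (hKt 1 j t) (V 1 0))]
      with ξ e1 e2 e3 e4 e5 e6 e7
    rw [hZ, e5, Pi.sub_apply, e6, Pi.add_apply, e7, Pi.add_apply, e1, e2, e3, e4]
    by_cases hξ : ξ ∈ lowFreq n R
    · simp only [Set.indicator_of_mem hξ, one_mul, Fin.sum_univ_three]
    · simp only [Set.indicator_of_notMem hξ]; ring
  have hZd : ∀ (j : ℕ) (W W' : ℝ → Lp ℂ 2 (volume : Measure (Space n))) (t : ℝ),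
      HasDerivWithinAt W (W' t) (Set.Ici 0) t →
      HasDerivWithinAt (Z j W) (Z (j + 1) W' t) (Set.Ici 0) t := by
    intro j W W' t hW
    have hk : ∀ k : Fin 3, HasDerivWithinAt (fun t => cutMul R (hKt k j t) (V k 0))
        (cutMul R (hKt k (j + 1) t) (V k 0)) (Set.Ici 0) t := fun k =>
      (hasDerivAt_cutMul (m'' := fun t ξ => dataKernel μ (β ξ) (γ ξ) k (j + 2) t)
        (hKt k j) (hKt k (j + 1)) (hK k (j + 2))
        (fun t ξ => hasDerivAt_dataKernel μ (β ξ) (γ ξ) k j t)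
        (fun t ξ => hasDerivAt_dataKernel μ (β ξ) (γ ξ) k (j + 1) t) t (V k 0)).hasDerivWithinAt
    exact (hasDerivWithinAt_cutMul h1c hW).sub (((hk 0).add (hk 1)).add (hk 2))
  -- The solution and the candidate have the same source exp(-μt) Q(0), so their difference solves
  -- the homogeneous equation.
  have hrel : ∀ t, 0 ≤ t → Z 2 (V 2) t =
      -cutMul R hβc (Z 1 (V 1) t) - cutMul R hγc (Z 0 (V 0) t) := by
    intro t ht
    refine Lp.ext ?_
    have hQt := hQae t
    rw [hQ0 t ht] at hQt
    filter_upwards [hZae 2 (V 2) t, hZae 1 (V 1) t, hZae 0 (V 0) t, hQt, hQae 0,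
      coeFn_cutMul R hβc (Z 1 (V 1) t), coeFn_cutMul R hγc (Z 0 (V 0) t),
      Lp.coeFn_sub (-cutMul R hβc (Z 1 (V 1) t)) (cutMul R hγc (Z 0 (V 0) t)),
      Lp.coeFn_neg (cutMul R hβc (Z 1 (V 1) t)),
      Lp.coeFn_smul (Real.exp (-μ * t)) (Q 0)] with ξ e2 e1 e0 q qz b1 b0 s1 s2 s3
    rw [s1, Pi.sub_apply, s2, Pi.neg_apply, b1, b0, e2, e1, e0]
    rw [s3, Pi.smul_apply, qz] at q
    by_cases hξ : ξ ∈ lowFreq n R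
    · simp only [Set.indicator_of_mem hξ, Complex.real_smul] at q ⊢
      have r0 := dataKernel_relation μ (β ξ) (γ ξ) 0 t
      have r1 := dataKernel_relation μ (β ξ) (γ ξ) 1 t
      have r2 := dataKernel_relation μ (β ξ) (γ ξ) 2 t
      simp only [Matrix.cons_val] at r0 r1 r2
      simp only [Fin.sum_univ_three]
      push_cast at q
      linear_combination -q - V 0 0 ξ * r0 - V 1 0 ξ * r1 - V 2 0 ξ * r2
    · simp only [Set.indicator_of_notMem hξ]; ring
  have hinit : ∀ (j : Fin 3), (j : ℕ) ≤ 1 → Z j (V j) 0 = 0 := by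
    intro j hj
    refine Lp.ext ?_
    filter_upwards [hZae j (V j) 0, Lp.coeFn_zero ℂ 2 (volume : Measure (Space n))] with ξ e1 e2
    rw [e1, e2]
    by_cases hξ : ξ ∈ lowFreq n R
    · simp only [Set.indicator_of_mem hξ, Fin.sum_univ_three, Pi.zero_apply]
      fin_cases j
      · simp [dataKernel_zero]
      · simp [dataKernel_one]
      · simp at hj
    · simp only [Set.indicator_of_notMem hξ, Pi.zero_apply]
  have hzero := eq_zero_of_second_order (cutMul R hβc) (cutMul R hγc)
    (fun t ht => hZd 0 (V 0) (V 1) t (h0 t ht)) (fun t ht => hZd 1 (V 1) (V 2) t (h1 t ht)) hrel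
    (hinit 0 (by simp)) (hinit 1 (by simp)) t ht
  have hall : Z j (V j) t = 0 := by
    fin_cases j
    · exact hzero.1
    · exact hzero.2
    · change Z 2 (V 2) t = 0
      rw [hrel t ht, hzero.1, hzero.2]; simp
  have hz := hZae j (V j) t
  rw [hall] at hz
  filter_upwards [hz, Lp.coeFn_zero ℂ 2 (volume : Measure (Space n))] with ξ e1 e2 hξ
  rw [e2, Set.indicator_of_mem hξ, Pi.zero_apply] at e1
  exact sub_eq_zero.1 e1.symm

end CutOff

/-! ### Representation of Sobolev solutions -/

section Representation

variable {n : ℕ}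

theorem toTemperedDistribution_injective {f g : Lp ℂ 2 (volume : Measure (Space n))}
    (h : ∀ φ : 𝓢(Space n, ℂ), (f : Distr n) φ = (g : Distr n) φ) : f = g := by
  have h1 : (f : Distr n) = g := by ext φ; exact h φ
  exact LinearMap.ker_eq_bot.1 (Lp.ker_toTemperedDistributionCLM_eq_bot (F := ℂ)
    (μ := (volume : Measure (Space n))) (p := 2)) h1

/-- The pairing of `L²` with a Schwartz function. -/
def pairL (φ : 𝓢(Space n, ℂ)) : Lp ℂ 2 (volume : Measure (Space n)) →L[ℝ] ℂ :=
  ((PointwiseConvergenceCLM.evalCLM (RingHom.id ℂ) ℂ φ).comp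
    (Lp.toTemperedDistributionCLM ℂ volume 2)).restrictScalars ℝ

theorem pairL_apply (φ : 𝓢(Space n, ℂ)) (f : Lp ℂ 2 (volume : Measure (Space n))) :
    pairL φ f = (f : Distr n) φ := rfl

/-- A distributional time derivative which is continuous in `H^σ` is a derivative in `H^σ`. -/
theorem IsTimeDeriv.hasDerivWithinAt_Lp {σ : ℝ} {u v : ℝ → Distr n} (h : IsTimeDeriv u v)
    {U V : ℝ → Lp ℂ 2 (volume : Measure (Space n))}
    (hU : ∀ t, 0 ≤ t → besselPotential (Space n) ℂ σ (u t) = U t)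
    (hV : ∀ t, 0 ≤ t → besselPotential (Space n) ℂ σ (v t) = V t)
    (hVc : ContinuousOn V (Set.Ici 0)) {t : ℝ} (ht : 0 ≤ t) :
    HasDerivWithinAt U (V t) (Set.Ici 0) t := by
  -- V is continued by its initial value to negative times, so that the primitive I is
  -- differentiable on the whole line.
  set W : ℝ → Lp ℂ 2 (volume : Measure (Space n)) := fun t => V (max t 0) with hW
  have hWc : Continuous W :=
    hVc.comp_continuous (by fun_prop) fun t => le_max_right t 0
  have hWV : ∀ t, 0 ≤ t → W t = V t := fun t ht => by rw [hW]; simp only [max_eq_left ht]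
  set I : ℝ → Lp ℂ 2 (volume : Measure (Space n)) := fun t => ∫ x in (0 : ℝ)..t, W x with hI
  have hId : ∀ t, HasDerivAt I (W t) t := fun t => hWc.integral_hasStrictDerivAt 0 t |>.hasDerivAt
  have hd : ∀ (φ : 𝓢(Space n, ℂ)) (t : ℝ), 0 ≤ t →
      HasDerivWithinAt (fun t => pairL φ (U t) - pairL φ (I t)) 0 (Set.Ici 0) t := by
    intro φ t ht
    -- The Bessel potential acts by duality, so pairing φ with U is pairing the Bessel potential of
    -- φ with u, where the weak derivative is known.
    have h1 := h t ht (𝓕 (SchwartzMap.smulLeftCLM ℂ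
      (fun x : Space n => (((1 + ‖x‖ ^ 2) ^ (σ / 2) : ℝ) : ℂ)) (𝓕⁻ φ)))
    have h2 : HasDerivWithinAt (fun t => pairL φ (U t)) (pairL φ (V t)) (Set.Ici 0) t := by
      rw [pairL_apply, ← hV t ht]
      refine h1.congr_of_mem (fun s hs => ?_) ht
      rw [pairL_apply, ← hU s hs]
      rfl
    have h3 : HasDerivWithinAt (fun t => pairL φ (I t)) (pairL φ (V t)) (Set.Ici 0) t := by
      rw [← hWV t ht]
      exact ((pairL φ).hasFDerivAt.comp_hasDerivAt t (hId t)).hasDerivWithinAt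
    exact (h2.sub h3).congr_deriv (sub_self _)
  have hUI : ∀ t, 0 ≤ t → U t = I t + U 0 := by
    intro t ht
    refine toTemperedDistribution_injective fun φ => ?_
    have hconst := constant_of_has_deriv_right_zero (a := 0) (b := t)
      (fun x hx => ((hd φ x hx.1).continuousWithinAt).mono fun y hy => hy.1)
      (fun x hx => (hd φ x hx.1).mono (Set.Ici_subset_Ici.2 hx.1)) t ⟨ht, le_rfl⟩
    have hI0 : I 0 = 0 := intervalIntegral.integral_same
    rw [hI0, map_zero, sub_zero] at hconst
    rw [← pairL_apply, ← pairL_apply, map_add, ← hconst]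
    ring
  rw [← hWV t ht]
  exact ((hId t).add_const (U 0)).hasDerivWithinAt.congr_of_mem (fun s hs => hUI s hs) ht

/-- The symbol of `B (-Δ)^α`. -/
def dampSymbol (B α : ℝ) (ξ : Space n) : ℝ := B * (2 * Real.pi * ‖ξ‖) ^ (2 * α)

/-- The symbol of `-c₀² Δ`. -/
def stiffSymbol (c₀ : ℝ) (ξ : Space n) : ℝ := (c₀ * (2 * Real.pi * ‖ξ‖)) ^ 2

theorem continuous_dampSymbol (B : ℝ) {α : ℝ} (hα : 0 ≤ α) :
    Continuous (dampSymbol (n := n) B α) :=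
  continuous_const.mul ((continuous_const.mul continuous_norm).rpow_const
    fun _ => Or.inr (by positivity))

theorem continuous_stiffSymbol (c₀ : ℝ) : Continuous (stiffSymbol (n := n) c₀) := by
  unfold stiffSymbol; fun_prop

theorem eq_exp_decay_of_hasDerivAt {τ : ℝ} (hτ : 0 < τ) {y : ℝ → ℂ}
    (h : ∀ t, 0 < t → ∃ d, HasDerivAt y d t ∧ (τ : ℂ) * d + y t = 0) {s t : ℝ} (hs : 0 < s)
    (hst : s ≤ t) : y t = Real.exp (-τ⁻¹ * (t - s)) * y s := by
  have hτ' : (τ : ℂ) ≠ 0 := by exact_mod_cast hτ.ne'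
  have hd : ∀ x, 0 < x → HasDerivAt (fun r => Real.exp (τ⁻¹ * r) * y r) 0 x := by
    intro x hx
    obtain ⟨d, hd, hd0⟩ := h x hx
    have h1 : HasDerivAt (fun r : ℝ => ((Real.exp (τ⁻¹ * r) : ℝ) : ℂ))
        ((Real.exp (τ⁻¹ * x) * τ⁻¹ : ℝ) : ℂ) x := by
      have : HasDerivAt (fun r : ℝ => Real.exp (τ⁻¹ * r)) (Real.exp (τ⁻¹ * x) * τ⁻¹) x := by
        simpa using ((hasDerivAt_id x).const_mul τ⁻¹).exp
      exact this.ofReal_comp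
    refine (h1.mul hd).congr_deriv ?_
    have : y x = -(τ * d) := by linear_combination hd0
    rw [this]
    push_cast
    field_simp
    ring
  have hconst := constant_of_has_deriv_right_zero (a := s) (b := t)
    (fun x hx => ((hd x (hs.trans_le hx.1)).continuousAt.continuousWithinAt))
    (fun x hx => (hd x (hs.trans_le hx.1)).hasDerivWithinAt) t ⟨hst, le_rfl⟩
  have e : Real.exp (-τ⁻¹ * (t - s)) = Real.exp (-(τ⁻¹ * t)) * Real.exp (τ⁻¹ * s) := by
    rw [← Real.exp_add]; ring_nf
  have e2 : ((Real.exp (-(τ⁻¹ * t)) : ℝ) : ℂ) * (Real.exp (τ⁻¹ * t) : ℝ) = 1 := by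
    rw [← Complex.ofReal_mul, ← Real.exp_add]; simp
  rw [e, Complex.ofReal_mul, mul_assoc, ← hconst, ← mul_assoc, e2, one_mul]

/-- Dividing by the nonvanishing Bessel weight B turns the solution into curves V in L² with true
time derivatives. The weak equation integrates to exponential decay of w against every test
function, hence to an identity between Fourier functions, and `ae_eq_dataKernel` applies. -/
theorem IsCattaneoSolution.hasFourierFunction {τ c₀ b ν α : ℝ} (hτ : 0 < τ) (hα : 0 ≤ α)
    {data : Fin 3 → Lp ℂ 1 (volume : Measure (Space n))} {φ : Fin 3 → ℝ → Distr n}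
    (h : IsCattaneoSolution τ c₀ b ν α data φ) (j : Fin 3) {t : ℝ} (ht : 0 ≤ t) :
    HasFourierFunction (φ j t) fun ξ => ∑ k, dataKernel τ⁻¹ (dampSymbol (b * ν) α ξ)
      (stiffSymbol c₀ ξ) k j t * 𝓕 (data k : Space n → ℂ) ξ := by
  obtain ⟨σ, hσ⟩ := h.regularity
  choose U hUc hU using hσ
  set V : Fin 3 → ℝ → Lp ℂ 2 (volume : Measure (Space n)) := fun j t => 𝓕 (U j t) with hV
  set B : Space n → ℂ := fun ξ => (((1 + ‖ξ‖ ^ 2) ^ (-σ / 2) : ℝ) : ℂ) with hB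
  have hB0 : ∀ ξ, B ξ ≠ 0 := fun ξ => by
    simp only [hB, ne_eq, Complex.ofReal_eq_zero]; positivity
  have hφ : ∀ j t, 0 ≤ t → HasFourierFunction (φ j t) fun ξ => B ξ * V j t ξ :=
    fun j t ht => hasFourierFunction_of_besselPotential (hU j t ht)
  set F := (Lp.fourierTransformₗᵢ (Space n) ℂ).toContinuousLinearEquiv.toContinuousLinearMap
    |>.restrictScalars ℝ with hF
  have hVd : ∀ i k : Fin 3, IsTimeDeriv (φ i) (φ k) → ∀ t, 0 ≤ t →
      HasDerivWithinAt (V i) (V k t) (Set.Ici 0) t := fun i k hd t ht =>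
    F.hasFDerivAt.comp_hasDerivWithinAt t
      (hd.hasDerivWithinAt_Lp (hU i) (hU k) (hUc k) ht)
  have hVc : ContinuousOn (V 2) (Set.Ici 0) := F.continuous.comp_continuousOn (hUc 2)
  obtain ⟨ψ, w, hψ, hw, heq⟩ := h.equation
  have hwF : ∀ t, 0 < t → HasFourierFunction (w t) fun ξ => B ξ * (V 2 t ξ +
      dampSymbol (b * ν) α ξ * V 1 t ξ + stiffSymbol c₀ ξ * V 0 t ξ) := by
    intro t ht
    obtain ⟨g, hg, hg'⟩ := hψ t ht
    have hgae := hg.ae_eq (hφ 1 t ht.le)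
    rw [hw t ht]
    refine (((hφ 2 t ht.le).sub ((hφ 0 t ht.le).laplacian.smul ((c₀ ^ 2 : ℝ) : ℂ))).add
      (hg'.smul ((b * ν : ℝ) : ℂ))).congr ?_
    filter_upwards [hgae] with ξ hξ
    rw [hξ, dampSymbol, stiffSymbol]
    push_cast
    ring
  have hVeq : ∀ s t : ℝ, 0 < s → s ≤ t → ∀ᵐ ξ, V 2 t ξ + dampSymbol (b * ν) α ξ * V 1 t ξ +
      stiffSymbol c₀ ξ * V 0 t ξ = Real.exp (-τ⁻¹ * (t - s)) * (V 2 s ξ +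
      dampSymbol (b * ν) α ξ * V 1 s ξ + stiffSymbol c₀ ξ * V 0 s ξ) := by
    intro s t hs hst
    have e : w t = (Real.exp (-τ⁻¹ * (t - s)) : ℂ) • w s := by
      ext f
      exact eq_exp_decay_of_hasDerivAt hτ (fun t ht => heq t ht f) hs hst
    have h1 := (hwF s hs).smul (Real.exp (-τ⁻¹ * (t - s)) : ℂ)
    rw [← e] at h1
    filter_upwards [(hwF t (hs.trans_le hst)).ae_eq h1] with ξ hξ
    refine mul_left_cancel₀ (hB0 ξ) (hξ.trans ?_)
    ring
  have hinit : ∀ k, ∀ᵐ ξ, 𝓕 (data k : Space n → ℂ) ξ = B ξ * V k 0 ξ := fun k => by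
    have h1 := hφ k 0 le_rfl
    rw [h.initial k] at h1
    exact (hasFourierFunction_L1 (data k)).ae_eq h1
  -- Balls of integer radius exhaust the space and leave only countably many null sets.
  have hker := fun R : ℕ => ae_eq_dataKernel (continuous_dampSymbol (b * ν) hα)
    (continuous_stiffSymbol c₀) (hVd 0 1 h.deriv_one) (hVd 1 2 h.deriv_two) hVc hVeq R ht j
  refine (hφ j t ht).congr ?_
  filter_upwards [ae_all_iff.2 hker, ae_all_iff.2 hinit] with ξ h1 h2
  obtain ⟨R, hR⟩ := exists_nat_ge (2 * Real.pi * ‖ξ‖)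
  rw [h1 R hR, Finset.mul_sum]
  refine Finset.sum_congr rfl fun k _ => ?_
  rw [h2 k]
  ring

end Representation

/-! ### Pointwise estimates in the Fourier variable -/

section Pointwise

/-- This is where the orders in `dataOrder` come from: up to constants, x^(s+2-j) is the weight of
the kernel times the power assigned to the datum. -/
theorem rpow_eq_kernelWeight_mul {B c₀ x : ℝ} (hB : 0 < B) (hc₀ : 0 < c₀) (hx : 0 < x) (α s : ℝ)
    (j k : Fin 3) : x ^ (s + 2 - (j : ℕ)) = ![![1, B / c₀ ^ 2, 1 / c₀ ^ 2], ![1, 1, 1 / B],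
      ![c₀ ^ 2 / B, c₀ ^ 2 / B, 1]] j k *
      (kernelWeight (B * x ^ (2 * α)) ((c₀ * x) ^ 2) j k * x ^ dataOrder α s j k) := by
  have hy : 0 < x ^ (2 * α) := Real.rpow_pos_of_pos hx _
  have e2 : x ^ (2 : ℝ) = x ^ 2 := by norm_cast
  fin_cases j <;> fin_cases k <;>
    simp only [kernelWeight, dataOrder, Fin.zero_eta, Fin.mk_one, Fin.reduceFinMk,
      Matrix.cons_val, Nat.cast_zero, Nat.cast_one,
      Nat.cast_ofNat, Real.rpow_add hx, Real.rpow_sub hx, Real.rpow_zero, Real.rpow_one, e2] <;>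
    generalize x ^ (2 * α) = y at hy <;> field_simp

/-- For α ≤ 1 both β and γ/β are nondecreasing in x. For α in the given range γ/β² and β/γ are
nonincreasing. All conditions of the kernel bound can therefore be read off at x = ε, except the
alternative between overdamped and bounded. -/
theorem exists_dataKernel_highFreq_le {α B c₀ μ ε : ℝ} (hα : α ∈ Set.Ioc (1 / 2 : ℝ) 1)
    (hB : 0 < B) (hc₀ : 0 < c₀) (hμ : 0 < μ) (hε : 0 < ε) (s : ℝ) : ∃ C c, 0 < C ∧ 0 < c ∧
    ∀ x t, ε ≤ x → 0 ≤ t → ∀ j k : Fin 3, x ^ (s + 2 - (j : ℕ)) *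
      ‖dataKernel μ (B * x ^ (2 * α)) ((c₀ * x) ^ 2) k j t‖ ≤
      C * Real.exp (-c * t) * x ^ dataOrder α s j k := by
  obtain ⟨hα1, hα2⟩ := hα
  -- x^(4α-2) ≥ L is exactly the overdamping condition 16γ ≤ 3β²; otherwise x ≤ X and the
  -- coefficients are bounded.
  set L := 16 * c₀ ^ 2 / (3 * B ^ 2) with hL
  set X := L ^ (1 / (4 * α - 2)) with hX
  have hL0 : 0 < L := by positivity
  set δ := min (B * ε ^ (2 * α) / 2) (c₀ ^ 2 / B * ε ^ (2 - 2 * α)) with hδ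
  have hδ0 : 0 < δ := lt_min (by positivity) (by positivity)
  set M := c₀ ^ 2 / B ^ 2 * ε ^ (2 - 4 * α) + B / c₀ ^ 2 * ε ^ (2 * α - 2) + B * X ^ (2 * α) +
    (c₀ * X) ^ 2 with hM
  have m1 : 0 ≤ c₀ ^ 2 / B ^ 2 * ε ^ (2 - 4 * α) := by positivity
  have m2 : 0 ≤ B / c₀ ^ 2 * ε ^ (2 * α - 2) := by positivity
  have m3 : 0 ≤ B * X ^ (2 * α) := by positivity
  have m4 : 0 ≤ (c₀ * X) ^ 2 := by positivity
  obtain ⟨C, c, hC, hc, hK⟩ := exists_norm_dataKernel_highFreq_le hμ hδ0 M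
  set κ := 1 + B / c₀ ^ 2 + 1 / c₀ ^ 2 + 1 / B + c₀ ^ 2 / B with hκ
  refine ⟨κ * C, c, by positivity, hc, fun x t hx ht j k => ?_⟩
  have hx0 : 0 < x := hε.trans_le hx
  have hy : 0 < x ^ (2 * α) := Real.rpow_pos_of_pos hx0 _
  have e1 : x ^ (2 : ℝ) = x ^ 2 := by norm_cast
  have p1 : x ^ (2 - 2 * α) = x ^ 2 / x ^ (2 * α) := by rw [Real.rpow_sub hx0, e1]
  have p2 : x ^ (2 * α - 2) = x ^ (2 * α) / x ^ 2 := by rw [Real.rpow_sub hx0, e1]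
  have e4 : x ^ (4 * α) = (x ^ (2 * α)) ^ 2 := by
    rw [← Real.rpow_natCast, ← Real.rpow_mul hx0.le]; ring_nf
  have p3 : x ^ (2 - 4 * α) = x ^ 2 / (x ^ (2 * α)) ^ 2 := by
    rw [Real.rpow_sub hx0, e1, e4]
  have p4 : x ^ (4 * α - 2) = (x ^ (2 * α)) ^ 2 / x ^ 2 := by
    rw [Real.rpow_sub hx0, e1, e4]
  have q0 : ε ^ (2 * α) ≤ x ^ (2 * α) := Real.rpow_le_rpow hε.le hx (by linarith)
  have q1 : ε ^ (2 - 2 * α) ≤ x ^ 2 / x ^ (2 * α) :=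
    p1 ▸ Real.rpow_le_rpow hε.le hx (by linarith)
  have q2 : x ^ (2 * α) / x ^ 2 ≤ ε ^ (2 * α - 2) :=
    p2 ▸ Real.rpow_le_rpow_of_nonpos hε hx (by linarith)
  have q3 : x ^ 2 / (x ^ (2 * α)) ^ 2 ≤ ε ^ (2 - 4 * α) :=
    p3 ▸ Real.rpow_le_rpow_of_nonpos hε hx (by linarith)
  have key := hK (B * x ^ (2 * α)) ((c₀ * x) ^ 2) (by positivity) (by positivity) ?_ ?_ ?_ ?_ ?_
    t ht j k
  · have hκjk : ![![1, B / c₀ ^ 2, 1 / c₀ ^ 2], ![1, 1, 1 / B],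
        ![c₀ ^ 2 / B, c₀ ^ 2 / B, 1]] j k ≤ κ := by
      have h1 : 0 ≤ B / c₀ ^ 2 := by positivity
      have h2 : 0 ≤ 1 / c₀ ^ 2 := by positivity
      have h3 : 0 ≤ 1 / B := by positivity
      have h4 : 0 ≤ c₀ ^ 2 / B := by positivity
      fin_cases j <;> fin_cases k <;> simp only [Fin.zero_eta, Fin.mk_one, Fin.reduceFinMk,
        Matrix.cons_val, hκ] <;> linarith
    have hw : 0 ≤ kernelWeight (B * x ^ (2 * α)) ((c₀ * x) ^ 2) j k := by
      fin_cases j <;> fin_cases k <;> simp only [kernelWeight, Fin.zero_eta, Fin.mk_one,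
        Fin.reduceFinMk, Matrix.cons_val] <;> positivity
    rw [rpow_eq_kernelWeight_mul hB hc₀ hx0 α s j k]
    have hK0 := norm_nonneg (dataKernel μ (B * x ^ (2 * α)) ((c₀ * x) ^ 2) k j t)
    generalize kernelWeight (B * x ^ (2 * α)) ((c₀ * x) ^ 2) j k = w at key hw
    generalize ‖dataKernel μ (B * x ^ (2 * α)) ((c₀ * x) ^ 2) k j t‖ = K at key hK0
    calc _ ≤ κ * (w * x ^ dataOrder α s j k) * K := by gcongr
      _ = κ * (w * K) * x ^ dataOrder α s j k := by ring
      _ ≤ κ * (C * Real.exp (-c * t)) * x ^ dataOrder α s j k := by gcongr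
      _ = _ := by ring
  · exact (min_le_left _ _).trans (by gcongr)
  · refine (min_le_right _ _).trans ?_
    calc c₀ ^ 2 / B * ε ^ (2 - 2 * α) ≤ c₀ ^ 2 / B * (x ^ 2 / x ^ (2 * α)) := by gcongr
      _ = _ := by field_simp
  · have h := mul_le_mul_of_nonneg_left q3 (by positivity : 0 ≤ c₀ ^ 2 / B ^ 2)
    have h' : c₀ ^ 2 / B ^ 2 * (x ^ 2 / (x ^ (2 * α)) ^ 2) ≤ M := by rw [hM]; linarith
    calc (c₀ * x) ^ 2 = c₀ ^ 2 / B ^ 2 * (x ^ 2 / (x ^ (2 * α)) ^ 2) * (B * x ^ (2 * α)) ^ 2 := by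
          field_simp
      _ ≤ _ := by gcongr
  · have h := mul_le_mul_of_nonneg_left q2 (by positivity : 0 ≤ B / c₀ ^ 2)
    have h' : B / c₀ ^ 2 * (x ^ (2 * α) / x ^ 2) ≤ M := by rw [hM]; linarith
    calc B * x ^ (2 * α) = B / c₀ ^ 2 * (x ^ (2 * α) / x ^ 2) * (c₀ * x) ^ 2 := by
          field_simp
      _ ≤ _ := by gcongr
  · rcases le_or_gt L (x ^ (4 * α - 2)) with h | h
    · left
      rw [p4, hL, div_le_div_iff₀ (by positivity) (by positivity)] at h
      nlinarith
    · right
      have hxX : x ≤ X := by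
        have h1 := Real.rpow_le_rpow (by positivity) h.le
          (by have : 0 < 4 * α - 2 := by linarith
              positivity : 0 ≤ 1 / (4 * α - 2))
        rwa [← Real.rpow_mul hx0.le, mul_one_div_cancel (by linarith), Real.rpow_one] at h1
      have h1 : B * x ^ (2 * α) ≤ B * X ^ (2 * α) := by gcongr
      have h2 : (c₀ * x) ^ 2 ≤ (c₀ * X) ^ 2 := by gcongr
      constructor <;> rw [hM] <;> linarith

/-- Away from the origin 2πy and (1 + y²)^(1/2) are comparable; which of the two inequalities is
used depends on the sign of o. -/
theorem rpow_le_besselWeight {ε : ℝ} (hε : 0 < ε) (o : ℝ) : ∃ C, 0 < C ∧ ∀ y, 0 ≤ y →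
    ε ≤ 2 * Real.pi * y → (2 * Real.pi * y) ^ o ≤ C * (1 + y ^ 2) ^ (o / 2) := by
  have hπ := Real.pi_pos
  set K := (2 * Real.pi) ^ 2 / ε ^ 2 + 1 with hK
  refine ⟨max (((2 * Real.pi) ^ 2) ^ (o / 2)) (((2 * Real.pi) ^ 2 / K) ^ (o / 2)),
    lt_max_of_lt_left (by positivity), fun y hy hεy => ?_⟩
  have hy0 : 0 < y := by
    rcases hy.eq_or_lt with rfl | h
    · simp only [mul_zero] at hεy; linarith
    · exact h
  have e : (2 * Real.pi * y) ^ o = ((2 * Real.pi * y) ^ 2) ^ (o / 2) := by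
    rw [← Real.rpow_natCast, ← Real.rpow_mul (by positivity)]; congr 1; push_cast; ring
  have hKy : 1 + y ^ 2 ≤ K * y ^ 2 := by
    have h1 : ε ^ 2 ≤ (2 * Real.pi) ^ 2 * y ^ 2 := by
      rw [← mul_pow]; gcongr
    have h2 : 1 ≤ (2 * Real.pi) ^ 2 / ε ^ 2 * y ^ 2 := by
      rw [div_mul_eq_mul_div, le_div_iff₀ (by positivity)]; linarith
    rw [hK]; linarith
  rw [e]
  rcases le_or_gt 0 o with ho | ho
  · calc ((2 * Real.pi * y) ^ 2) ^ (o / 2) ≤ ((2 * Real.pi) ^ 2 * (1 + y ^ 2)) ^ (o / 2) := by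
          refine Real.rpow_le_rpow (by positivity) ?_ (by linarith)
          rw [mul_pow]; gcongr; linarith
      _ = ((2 * Real.pi) ^ 2) ^ (o / 2) * (1 + y ^ 2) ^ (o / 2) :=
          Real.mul_rpow (by positivity) (by positivity)
      _ ≤ _ := by gcongr; exact le_max_left _ _
  · calc ((2 * Real.pi * y) ^ 2) ^ (o / 2) ≤ ((2 * Real.pi) ^ 2 / K * (1 + y ^ 2)) ^ (o / 2) := by
          refine Real.rpow_le_rpow_of_nonpos (by positivity) ?_ (by linarith)
          rw [mul_pow (2 * Real.pi) y, div_mul_eq_mul_div, div_le_iff₀ (by positivity), mul_assoc]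
          gcongr
          linarith
      _ = ((2 * Real.pi) ^ 2 / K) ^ (o / 2) * (1 + y ^ 2) ^ (o / 2) :=
          Real.mul_rpow (by positivity) (by positivity)
      _ ≤ _ := by gcongr; exact le_max_right _ _

/-- Frequencies at which the low frequency expansion of the kernels holds. -/
def IsLowFreq (α B c₀ μ x : ℝ) : Prop :=
  0 < x ∧ B * x ^ (2 * α) ≤ c₀ * x ∧ c₀ * x ≤ 1 ∧ B * x ^ (2 * α) ≤ μ / 2

theorem tendsto_rpow_nhdsGT_zero {q : ℝ} (hq : 0 < q) :
    Tendsto (fun x : ℝ => x ^ q) (𝓝[>] 0) (𝓝 0) := by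
  have : ContinuousAt (fun x : ℝ => x ^ q) 0 := Real.continuousAt_rpow_const _ _ (Or.inr hq.le)
  have h := this.tendsto
  rw [Real.zero_rpow hq.ne'] at h
  exact h.mono_left nhdsWithin_le_nhds

theorem eventually_isLowFreq {α B c₀ μ : ℝ} (hα : α ∈ Set.Ioc (1 / 2 : ℝ) 1)
    (hB : 0 < B) (hc₀ : 0 < c₀) (hμ : 0 < μ) : ∀ᶠ x in 𝓝[>] (0 : ℝ), IsLowFreq α B c₀ μ x := by
  have h1 := ((tendsto_rpow_nhdsGT_zero (q := 2 * α - 1) (by linarith [hα.1])).const_mul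
    (B / c₀)).eventually_le_const (u := 1) (by simp)
  have h2 := ((tendsto_rpow_nhdsGT_zero (q := 1) one_pos).const_mul c₀).eventually_le_const
    (u := 1) (by simp)
  have h3 := ((tendsto_rpow_nhdsGT_zero (q := 2 * α) (by linarith [hα.1])).const_mul
    B).eventually_le_const (u := μ / 2) (by simpa)
  filter_upwards [h1, h2, h3, self_mem_nhdsWithin] with x h1 h2 h3 hx
  have hx : 0 < x := hx
  rw [Real.rpow_one] at h2
  refine ⟨hx, ?_, h2, h3⟩
  have e : x ^ (2 * α) = x ^ (2 * α - 1) * x := by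
    rw [Real.rpow_sub hx, Real.rpow_one]; field_simp
  calc B * x ^ (2 * α) = B / c₀ * x ^ (2 * α - 1) * (c₀ * x) := by rw [e]; field_simp
    _ ≤ 1 * (c₀ * x) := by gcongr
    _ = c₀ * x := one_mul _

/-- Power counting: each time derivative brings a factor x and lowers the order of the norm by one,
and E brings 1/x. So the remaining power is s + 1 for every j. -/
theorem rpow_mul_le_of_mul_le {c₀ x Y A A' : ℝ} (hc₀ : 0 < c₀) (hx : 0 < x) (s : ℝ) {j : ℕ}
    (h : c₀ * x * Y ≤ c₀ * x * A + (c₀ * x) ^ j * A') :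
    x ^ (s + 2 - j) * Y ≤ x ^ (s + 2 - j) * A + c₀ ^ j / c₀ * (x ^ (s + 1) * A') := by
  have e : x ^ (s + 1) = x ^ (s + 2 - j) * x ^ j / x := by
    rw [← Real.rpow_natCast, ← Real.rpow_add hx]
    nth_rewrite 3 [← Real.rpow_one x]
    rw [← Real.rpow_sub hx]; ring_nf
  have h0 : 0 < x ^ (s + 2 - j) := Real.rpow_pos_of_pos hx _
  have h1 := mul_le_mul_of_nonneg_left h (by positivity : 0 ≤ x ^ (s + 2 - j) / (c₀ * x))
  rw [e]
  calc x ^ (s + 2 - j) * Y = x ^ (s + 2 - j) / (c₀ * x) * (c₀ * x * Y) := by field_simp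
    _ ≤ _ := h1
    _ = _ := by rw [mul_pow]; field_simp

/-- The Fourier transform of the solution, at a frequency with `|ξ| = x`. -/
def evolution (μ c₀ B α : ℝ) (d : Fin 3 → ℂ) (j : ℕ) (t x : ℝ) : ℂ :=
  ∑ k, dataKernel μ (B * x ^ (2 * α)) ((c₀ * x) ^ 2) k j t * d k

/-- The Fourier transform of the profile without its cut-off, at a frequency with `|ξ| = x`. -/
def waveSymbol (c₀ B α : ℝ) (j : ℕ) (t x : ℝ) : ℝ :=
  iteratedDeriv j (fun r : ℝ => Real.sin (c₀ * x * r)) t / (c₀ * x) *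
    Real.exp (-(B * x ^ (2 * α) / 2) * t)

/-- The kernel comparison summed over the three data, whence 300 = 3 · 100. -/
theorem evolution_sub_le {α B c₀ μ x t D : ℝ} (hB : 0 < B) (hμ : 0 < μ)
    (hc₀ : 0 < c₀) (hx : IsLowFreq α B c₀ μ x) (j : Fin 3) {d : Fin 3 → ℂ} (hd : ∀ k, ‖d k‖ ≤ D) :
    c₀ * x * ‖evolution μ c₀ B α d j t x - (d 1 + (μ : ℂ)⁻¹ * d 2) *
      waveKernel (B * x ^ (2 * α)) ((c₀ * x) ^ 2) j t‖ ≤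
      300 * (1 + μ⁻¹) ^ 3 * (1 + μ) ^ 2 * D * (c₀ * x * Real.exp (-μ * t) +
        (c₀ * x) ^ (j : ℕ) * (c₀ * x) * Real.exp (-(B * x ^ (2 * α) / 2) * t)) := by
  obtain ⟨hx0, h1, h2, h3⟩ := hx
  have hD : 0 ≤ D := (norm_nonneg _).trans (hd 0)
  set E := waveKernel (B * x ^ (2 * α)) ((c₀ * x) ^ 2) j t with hE
  have hk := norm_dataKernel_sub_waveKernel_le hμ (mul_pos hc₀ hx0) h2
    (by positivity : 0 ≤ B * x ^ (2 * α)) h1 h3 t (j := (j : ℕ)) (by omega)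
  set C₀ := 100 * (1 + μ⁻¹) ^ 3 * (1 + μ) ^ 2 with hC₀
  set Q := Real.exp (-μ * t) + (c₀ * x) ^ (j : ℕ) * Real.exp (-(B * x ^ (2 * α) / 2) * t) with hQ
  have e : evolution μ c₀ B α d j t x - (d 1 + (μ : ℂ)⁻¹ * d 2) * E =
      ∑ k, (dataKernel μ (B * x ^ (2 * α)) ((c₀ * x) ^ 2) k j t -
        ![(0 : ℂ), 1, (μ : ℂ)⁻¹] k * E) * d k := by
    rw [evolution]
    simp only [Fin.sum_univ_three, Matrix.cons_val]
    ring
  have hs : ‖evolution μ c₀ B α d j t x - (d 1 + (μ : ℂ)⁻¹ * d 2) * E‖ ≤ 3 * (C₀ * Q * D) := by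
    rw [e]
    refine (norm_sum_le _ _).trans ((Finset.sum_le_card_nsmul _ _ (C₀ * Q * D) fun k _ => ?_).trans
      (by simp))
    rw [norm_mul]
    exact mul_le_mul (hk k) (hd k) (norm_nonneg _) (by positivity)
  calc _ ≤ c₀ * x * (3 * (C₀ * Q * D)) := by gcongr
    _ = _ := by rw [hC₀, hQ]; ring

theorem exists_evolution_lowFreq_le {α B c₀ μ : ℝ} (hB : 0 < B) (hμ : 0 < μ) (hc₀ : 0 < c₀)
    (s : ℝ) (j : Fin 3) : ∃ C, 0 < C ∧ ∀ x t D, ∀ d : Fin 3 → ℂ, IsLowFreq α B c₀ μ x → 0 ≤ t →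
      (∀ k, ‖d k‖ ≤ D) → x ^ (s + 2 - (j : ℕ)) * ‖evolution μ c₀ B α d j t x‖ ≤
      C * D * (Real.exp (-μ * t) * x ^ (s + 2 - (j : ℕ))) +
      C * D * (x ^ (s + 1) * Real.exp (-(B / 4) * x ^ (2 * α) * t)) := by
  set C₁ := 300 * (1 + μ⁻¹) ^ 3 * (1 + μ) ^ 2 with hC₁
  set C₂ := C₁ + 8 * (1 + μ⁻¹) with hC₂
  refine ⟨C₁ + c₀ ^ (j : ℕ) / c₀ * C₂, by positivity, fun x t D d hx ht hd => ?_⟩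
  have hD : 0 ≤ D := (norm_nonneg _).trans (hd 0)
  have hsub := evolution_sub_le (t := t) hB hμ hc₀ hx j hd
  obtain ⟨hx0, h1, h2, h3⟩ := hx
  have hE := norm_waveKernel_lowFreq_le (mul_pos hc₀ hx0) (by positivity : 0 ≤ B * x ^ (2 * α)) h1
    t (j : ℕ)
  set E := waveKernel (B * x ^ (2 * α)) ((c₀ * x) ^ 2) j t
  have hexp : Real.exp (-(B * x ^ (2 * α) / 2) * t) ≤ Real.exp (-(B / 4) * x ^ (2 * α) * t) := by
    rw [Real.exp_le_exp]
    have : 0 ≤ B * x ^ (2 * α) * t := by positivity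
    linarith
  set ex := Real.exp (-(B * x ^ (2 * α) / 2) * t)
  set ex' := Real.exp (-(B / 4) * x ^ (2 * α) * t)
  have hm : ‖d 1 + (μ : ℂ)⁻¹ * d 2‖ ≤ (1 + μ⁻¹) * D := by
    refine (norm_add_le _ _).trans ?_
    rw [norm_mul, norm_inv, Complex.norm_real, Real.norm_of_nonneg hμ.le, add_mul, one_mul]
    gcongr <;> exact hd _
  have hj : (2 : ℝ) ^ ((j : ℕ) + 1) ≤ 8 := by
    calc (2 : ℝ) ^ ((j : ℕ) + 1) ≤ 2 ^ 3 := by gcongr; norm_num; omega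
      _ = 8 := by norm_num
  have hax : 0 < c₀ * x := by positivity
  have key : c₀ * x * ‖evolution μ c₀ B α d j t x‖ ≤ c₀ * x * (C₁ * D * Real.exp (-μ * t)) +
      (c₀ * x) ^ (j : ℕ) * (C₂ * D * ex') := by
    have n1 : ‖evolution μ c₀ B α d j t x‖ ≤ ‖evolution μ c₀ B α d j t x -
        (d 1 + (μ : ℂ)⁻¹ * d 2) * E‖ + ‖d 1 + (μ : ℂ)⁻¹ * d 2‖ * ‖E‖ := by
      rw [← norm_mul]
      have := norm_add_le (evolution μ c₀ B α d j t x - (d 1 + (μ : ℂ)⁻¹ * d 2) * E)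
        ((d 1 + (μ : ℂ)⁻¹ * d 2) * E)
      rwa [sub_add_cancel] at this
    have n2 : c₀ * x * (‖d 1 + (μ : ℂ)⁻¹ * d 2‖ * ‖E‖) ≤
        (1 + μ⁻¹) * D * (8 * (c₀ * x) ^ (j : ℕ) * ex) := by
      calc _ = ‖d 1 + (μ : ℂ)⁻¹ * d 2‖ * (c₀ * x * ‖E‖) := by ring
        _ ≤ (1 + μ⁻¹) * D * (2 ^ ((j : ℕ) + 1) * (c₀ * x) ^ (j : ℕ) * ex) := by gcongr
        _ ≤ _ := by gcongr
    have n3 : C₁ * D * ((c₀ * x) ^ (j : ℕ) * (c₀ * x) * ex) ≤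
        C₁ * D * ((c₀ * x) ^ (j : ℕ) * 1 * ex) := by gcongr
    have n4 : (c₀ * x) ^ (j : ℕ) * (C₂ * D * ex) ≤ (c₀ * x) ^ (j : ℕ) * (C₂ * D * ex') := by
      gcongr
    have n5 := mul_le_mul_of_nonneg_left n1 hax.le
    rw [hC₂] at n4 ⊢
    linarith
  have hfin := rpow_mul_le_of_mul_le hc₀ hx0 s key
  have p1 : 0 ≤ x ^ (s + 2 - (j : ℕ)) := by positivity
  have p2 : 0 ≤ c₀ ^ (j : ℕ) / c₀ * C₂ * D * (Real.exp (-μ * t) * x ^ (s + 2 - (j : ℕ))) := by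
    positivity
  have p3 : 0 ≤ C₁ * D * (x ^ (s + 1) * ex') := by positivity
  linarith

theorem exists_evolution_highFreq_le {α B c₀ μ ε : ℝ} (hα : α ∈ Set.Ioc (1 / 2 : ℝ) 1)
    (hB : 0 < B) (hc₀ : 0 < c₀) (hμ : 0 < μ) (hε : 0 < ε) (s : ℝ) (j : Fin 3) :
    ∃ C c, 0 < C ∧ 0 < c ∧ ∀ y t : ℝ, ∀ d : Fin 3 → ℂ, 0 ≤ y → ε ≤ 2 * Real.pi * y → 0 ≤ t →
      (2 * Real.pi * y) ^ (s + 2 - (j : ℕ)) * ‖evolution μ c₀ B α d j t (2 * Real.pi * y)‖ ≤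
      C * Real.exp (-c * t) * ∑ k, (1 + y ^ 2) ^ (dataOrder α s j k / 2) * ‖d k‖ := by
  obtain ⟨C, c, hC, hc, hK⟩ := exists_dataKernel_highFreq_le hα hB hc₀ hμ hε s
  choose W hW0 hW using fun k => rpow_le_besselWeight hε (dataOrder α s j k)
  have hWs : 0 < ∑ k, W k := Finset.sum_pos (fun k _ => hW0 k) Finset.univ_nonempty
  refine ⟨C * ∑ k, W k, c, by positivity, hc, fun y t d hy hεy ht => ?_⟩
  rw [evolution]
  calc _ ≤ (2 * Real.pi * y) ^ (s + 2 - (j : ℕ)) * ∑ k, ‖dataKernel μ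
        (B * (2 * Real.pi * y) ^ (2 * α)) ((c₀ * (2 * Real.pi * y)) ^ 2) k j t‖ * ‖d k‖ := by
        have := hε.trans_le hεy
        gcongr
        refine (norm_sum_le _ _).trans (le_of_eq ?_)
        simp only [norm_mul]
    _ = ∑ k, (2 * Real.pi * y) ^ (s + 2 - (j : ℕ)) * ‖dataKernel μ
        (B * (2 * Real.pi * y) ^ (2 * α)) ((c₀ * (2 * Real.pi * y)) ^ 2) k j t‖ * ‖d k‖ := by
        rw [Finset.mul_sum]; simp only [mul_assoc]
    _ ≤ ∑ k, C * Real.exp (-c * t) * ((∑ k, W k) * (1 + y ^ 2) ^ (dataOrder α s j k / 2)) *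
        ‖d k‖ := by
        refine Finset.sum_le_sum fun k _ => mul_le_mul_of_nonneg_right ?_ (norm_nonneg _)
        refine (hK _ t hεy ht j k).trans ?_
        gcongr
        refine (hW k y hy hεy).trans ?_
        gcongr
        exact Finset.single_le_sum (fun k _ => (hW0 k).le) (Finset.mem_univ k)
    _ = _ := by
        rw [Finset.mul_sum]
        exact Finset.sum_congr rfl fun k _ => by ring

end Pointwise

/-! ### Comparison with the diffusion wave -/

section Profile

/-- The bracket collects three errors: the coefficients against multiples of E, the transform of the
data combination against the constant P, and E against the profile. The explicit powers vanish at x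
= 0, and the middle one vanishes there by continuity when P is the value at the origin. -/
theorem evolution_sub_waveSymbol_le {α B c₀ μ x t D : ℝ} (hB : 0 < B) (hμ : 0 < μ)
    (hc₀ : 0 < c₀) (hx : IsLowFreq α B c₀ μ x) (ht : 0 ≤ t) (s : ℝ) (j : Fin 3) {d : Fin 3 → ℂ}
    (hd : ∀ k, ‖d k‖ ≤ D) (P : ℂ) :
    x ^ (s + 2 - (j : ℕ)) * ‖evolution μ c₀ B α d j t x - P * waveSymbol c₀ B α j t x‖ ≤
      300 * (1 + μ⁻¹) ^ 3 * (1 + μ) ^ 2 * D * (Real.exp (-μ * t) * x ^ (s + 2 - (j : ℕ))) +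
      c₀ ^ (j : ℕ) / c₀ * (300 * (1 + μ⁻¹) ^ 3 * (1 + μ) ^ 2 * D * (c₀ * x) +
        8 * ‖d 1 + (μ : ℂ)⁻¹ * d 2 - P‖ + 12 * ‖P‖ * (B * x ^ (2 * α) / (c₀ * x))) *
        (x ^ (s + 1) * Real.exp (-(B / 4) * x ^ (2 * α) * t)) := by
  set C₁ := 300 * (1 + μ⁻¹) ^ 3 * (1 + μ) ^ 2 with hC₁
  have hD : 0 ≤ D := (norm_nonneg _).trans (hd 0)
  have hsub := evolution_sub_le (t := t) hB hμ hc₀ hx j hd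
  obtain ⟨hx0, h1, h2, h3⟩ := hx
  have hE := norm_waveKernel_lowFreq_le (mul_pos hc₀ hx0) (by positivity : 0 ≤ B * x ^ (2 * α)) h1
    t (j : ℕ)
  have hG := norm_waveKernel_sub_profile_le (mul_pos hc₀ hx0)
    (by positivity : 0 ≤ B * x ^ (2 * α)) h1 ht (j := (j : ℕ)) (by omega)
  have e4 : -(B * x ^ (2 * α) / 4) * t = -(B / 4) * x ^ (2 * α) * t := by ring
  have hexp : Real.exp (-(B * x ^ (2 * α) / 2) * t) ≤ Real.exp (-(B / 4) * x ^ (2 * α) * t) := by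
    rw [Real.exp_le_exp]
    have : 0 ≤ B * x ^ (2 * α) * t := by positivity
    linarith
  have hj : (2 : ℝ) ^ ((j : ℕ) + 1) ≤ 8 := by
    calc (2 : ℝ) ^ ((j : ℕ) + 1) ≤ 2 ^ 3 := by gcongr; norm_num; omega
      _ = 8 := by norm_num
  rw [e4] at hG
  change c₀ * x * ‖_ - ((waveSymbol c₀ B α j t x : ℝ) : ℂ)‖ ≤ _ at hG
  set E := waveKernel (B * x ^ (2 * α)) ((c₀ * x) ^ 2) j t
  set G : ℂ := ((waveSymbol c₀ B α j t x : ℝ) : ℂ)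
  set ex := Real.exp (-(B * x ^ (2 * α) / 2) * t)
  set ex' := Real.exp (-(B / 4) * x ^ (2 * α) * t)
  set m := d 1 + (μ : ℂ)⁻¹ * d 2
  set β := B * x ^ (2 * α)
  have hax : 0 < c₀ * x := by positivity
  have key : c₀ * x * ‖evolution μ c₀ B α d j t x - P * G‖ ≤
      c₀ * x * (C₁ * D * Real.exp (-μ * t)) + (c₀ * x) ^ (j : ℕ) *
      ((C₁ * D * (c₀ * x) + 8 * ‖m - P‖ + 12 * ‖P‖ * (β / (c₀ * x))) * ex') := by
    have n1 : ‖evolution μ c₀ B α d j t x - P * G‖ ≤ ‖evolution μ c₀ B α d j t x - m * E‖ +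
        ‖m - P‖ * ‖E‖ + ‖P‖ * ‖E - G‖ := by
      rw [← norm_mul, ← norm_mul]
      refine le_trans (le_of_eq ?_) norm_add₃_le
      congr 1; ring
    have n2 : c₀ * x * (‖m - P‖ * ‖E‖) ≤ ‖m - P‖ * (8 * (c₀ * x) ^ (j : ℕ) * ex') := by
      calc _ = ‖m - P‖ * (c₀ * x * ‖E‖) := by ring
        _ ≤ ‖m - P‖ * (2 ^ ((j : ℕ) + 1) * (c₀ * x) ^ (j : ℕ) * ex) := by gcongr
        _ ≤ _ := by gcongr
    have n3 : C₁ * D * ((c₀ * x) ^ (j : ℕ) * (c₀ * x) * ex) ≤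
        C₁ * D * ((c₀ * x) ^ (j : ℕ) * (c₀ * x) * ex') := by gcongr
    have n4 : c₀ * x * (‖P‖ * ‖E - G‖) ≤ ‖P‖ * (12 * ((c₀ * x) ^ (j : ℕ) * (β / (c₀ * x)) * ex')) := by
      calc _ = ‖P‖ * (c₀ * x * ‖E - G‖) := by ring
        _ ≤ _ := by gcongr
    have n5 := mul_le_mul_of_nonneg_left n1 hax.le
    linarith
  refine (rpow_mul_le_of_mul_le hc₀ hx0 s key).trans (le_of_eq ?_)
  ring

theorem abs_waveSymbol_le {c₀ x : ℝ} (hc₀ : 0 < c₀) (hx : 0 < x) (B α t : ℝ) (j : Fin 3) :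
    c₀ * x * |waveSymbol c₀ B α j t x| ≤
      (c₀ * x) ^ (j : ℕ) * Real.exp (-(B * x ^ (2 * α) / 2) * t) := by
  have ha : 0 < c₀ * x := by positivity
  obtain ⟨i0, i1, i2⟩ := iteratedDeriv_sin_mul_div ha.ne' t
  rw [waveSymbol, abs_mul, Real.abs_exp, ← mul_assoc]
  gcongr
  fin_cases j
  · change c₀ * x * |iteratedDeriv 0 _ t / _| ≤ (c₀ * x) ^ 0
    rw [i0, abs_div, abs_of_pos ha, mul_div_cancel₀ _ ha.ne', pow_zero]
    exact Real.abs_sin_le_one _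
  · change c₀ * x * |iteratedDeriv 1 _ t / _| ≤ (c₀ * x) ^ 1
    rw [i1, pow_one]
    exact mul_le_of_le_one_right ha.le (Real.abs_cos_le_one _)
  · change c₀ * x * |iteratedDeriv 2 _ t / _| ≤ (c₀ * x) ^ 2
    rw [i2, abs_neg, abs_mul, abs_of_pos ha, sq]
    exact mul_le_mul_of_nonneg_left
      (mul_le_of_le_one_right ha.le (Real.abs_sin_le_one _)) ha.le

variable {n : ℕ}

theorem profileSymbol_eq (c₀ b ν α : ℝ) (χ : LowFreqCutoff n) (j : ℕ) (t : ℝ) (ξ : Space n) :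
    profileSymbol c₀ b ν α χ j t ξ = χ.toFun ((2 * Real.pi) • ξ) *
      waveSymbol c₀ (b * ν) α j t (2 * Real.pi * ‖ξ‖) := by
  rw [profileSymbol, waveSymbol, ← Complex.ofReal_mul, mul_assoc]
  ring_nf

theorem norm_two_pi_smul (ξ : Space n) : ‖(2 * Real.pi) • ξ‖ = 2 * Real.pi * ‖ξ‖ := by
  rw [norm_smul, Real.norm_of_nonneg (by positivity)]

theorem LowFreqCutoff.exists_bound (χ : LowFreqCutoff n) : ∃ M, 0 < M ∧ ∀ η, |χ.toFun η| ≤ M := by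
  obtain ⟨M, hM⟩ := (isCompact_closedBall (0 : Space n) χ.ε₀).exists_bound_of_continuousOn
    χ.smooth.continuous.continuousOn
  refine ⟨|M| + 1, by positivity, fun η => ?_⟩
  by_cases hη : η ∈ Metric.closedBall (0 : Space n) χ.ε₀
  · exact (hM η hη).trans ((le_abs_self M).trans (by linarith))
  · rw [χ.eq_zero η, abs_zero]
    · positivity
    · simp only [Metric.mem_closedBall, dist_zero_right, not_le] at hη
      exact hη.le

/-- Away from the zero frequency the profile decays exponentially. -/
theorem exists_profileSymbol_le {c₀ b ν α δ : ℝ} (hα : 0 ≤ α) (hc₀ : 0 < c₀) (hB : 0 < b * ν)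
    (hδ : 0 < δ) (χ : LowFreqCutoff n) (j : Fin 3) : ∃ C c, 0 < C ∧ 0 < c ∧ ∀ (ξ : Space n) (t : ℝ),
      δ ≤ 2 * Real.pi * ‖ξ‖ → 0 ≤ t → ‖profileSymbol c₀ b ν α χ j t ξ‖ ≤
        C * Real.exp (-c * t) * (lowFreq n χ.ε₀).indicator 1 ξ := by
  obtain ⟨M, hM, hχ⟩ := χ.exists_bound
  have hε := χ.pos
  refine ⟨M * ((c₀ * χ.ε₀) ^ (j : ℕ) / (c₀ * δ)), b * ν * δ ^ (2 * α) / 2, by positivity,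
    by positivity, fun ξ t hξ ht => ?_⟩
  rw [profileSymbol_eq, norm_mul, Complex.norm_real, Complex.norm_real, Real.norm_eq_abs,
    Real.norm_eq_abs]
  by_cases hξR : ξ ∈ lowFreq n χ.ε₀
  · rw [Set.indicator_of_mem hξR, Pi.one_apply, mul_one, mul_assoc M]
    have hx : 0 < 2 * Real.pi * ‖ξ‖ := hδ.trans_le hξ
    have hR : 2 * Real.pi * ‖ξ‖ ≤ χ.ε₀ := hξR
    have h := abs_waveSymbol_le hc₀ hx (b * ν) α t j
    rw [mul_comm, ← le_div_iff₀ (by positivity)] at h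
    refine mul_le_mul (hχ _) (h.trans ?_) (abs_nonneg _) hM.le
    rw [mul_div_right_comm]
    gcongr
  · rw [χ.eq_zero, Set.indicator_of_notMem hξR]
    · simp
    · rw [norm_two_pi_smul]
      exact (not_le.1 hξR).le

/-- The `L²` majorant of the solution at low frequencies without time decay. -/
def lowWeight (n : ℕ) (R p : ℝ) : Space n → ℝ :=
  (lowFreq n R).indicator fun ξ => (2 * Real.pi * ‖ξ‖) ^ p

/-- The `L²` majorant of the diffusion wave at low frequencies. -/
def diffusionWeight (n : ℕ) (R p k α t : ℝ) : Space n → ℝ :=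
  (lowFreq n R).indicator fun ξ =>
    (2 * Real.pi * ‖ξ‖) ^ p * Real.exp (-k * (2 * Real.pi * ‖ξ‖) ^ (2 * α) * t)

theorem lowWeight_nonneg (R p : ℝ) (ξ : Space n) : 0 ≤ lowWeight n R p ξ :=
  Set.indicator_nonneg (fun _ _ => by positivity) _

theorem diffusionWeight_nonneg (R p k α t : ℝ) (ξ : Space n) :
    0 ≤ diffusionWeight n R p k α t ξ :=
  Set.indicator_nonneg (fun _ _ => by positivity) _

/-- The frequency space is split at a fixed radius R below which the low frequency expansion holds.
Only the middle term has algebraic rather than exponential time decay after taking norms. -/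
theorem exists_evolution_le {α B c₀ μ : ℝ} (hα : α ∈ Set.Ioc (1 / 2 : ℝ) 1) (hB : 0 < B)
    (hc₀ : 0 < c₀) (hμ : 0 < μ) (n : ℕ) (s : ℝ) (j : Fin 3) : ∃ R C c, 0 < R ∧ 0 < C ∧ 0 < c ∧
    ∀ (ξ : Space n) (t D : ℝ) (d : Fin 3 → ℂ), ξ ≠ 0 → 0 ≤ t → (∀ k, ‖d k‖ ≤ D) →
      (2 * Real.pi * ‖ξ‖) ^ (s + 2 - (j : ℕ)) *
        ‖evolution μ c₀ B α d j t (2 * Real.pi * ‖ξ‖)‖ ≤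
      C * D * Real.exp (-c * t) * lowWeight n R (s + 2 - (j : ℕ)) ξ +
      C * D * diffusionWeight n R (s + 1) (B / 4) α t ξ +
      C * Real.exp (-c * t) * ∑ k, (1 + ‖ξ‖ ^ 2) ^ (dataOrder α s j k / 2) * ‖d k‖ := by
  obtain ⟨R, hR, hRlow⟩ := mem_nhdsGT_iff_exists_Ioc_subset.1 (eventually_isLowFreq hα hB hc₀ hμ)
  have hR : 0 < R := hR
  obtain ⟨C₁, hC₁, h₁⟩ := exists_evolution_lowFreq_le (α := α) hB hμ hc₀ s j
  obtain ⟨C₂, c, hC₂, hc, h₂⟩ := exists_evolution_highFreq_le hα hB hc₀ hμ hR s j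
  refine ⟨R, C₁ + C₂, min μ c, hR, by positivity, lt_min hμ hc, fun ξ t D d hξ ht hd => ?_⟩
  have hD : 0 ≤ D := (norm_nonneg _).trans (hd 0)
  have hx : 0 < 2 * Real.pi * ‖ξ‖ := by positivity
  have l0 := lowWeight_nonneg (n := n) R (s + 2 - (j : ℕ)) ξ
  have d0 := diffusionWeight_nonneg (n := n) R (s + 1) (B / 4) α t ξ
  have s0 : 0 ≤ ∑ k, (1 + ‖ξ‖ ^ 2) ^ (dataOrder α s j k / 2) * ‖d k‖ :=
    Finset.sum_nonneg fun k _ => by positivity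
  have m1 : Real.exp (-μ * t) ≤ Real.exp (-(min μ c) * t) := by
    gcongr; exact min_le_left _ _
  have m2 : Real.exp (-c * t) ≤ Real.exp (-(min μ c) * t) := by
    gcongr; exact min_le_right _ _
  have mp := Real.exp_pos (-(min μ c) * t)
  rcases le_or_gt (2 * Real.pi * ‖ξ‖) R with h | h
  · have hmem : ξ ∈ lowFreq n R := h
    refine (h₁ _ t D d (hRlow ⟨hx, h⟩) ht hd).trans ?_
    have e1 : lowWeight n R (s + 2 - (j : ℕ)) ξ = (2 * Real.pi * ‖ξ‖) ^ (s + 2 - (j : ℕ)) :=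
      Set.indicator_of_mem hmem _
    have e2 : diffusionWeight n R (s + 1) (B / 4) α t ξ = (2 * Real.pi * ‖ξ‖) ^ (s + 1) *
        Real.exp (-(B / 4) * (2 * Real.pi * ‖ξ‖) ^ (2 * α) * t) := Set.indicator_of_mem hmem _
    rw [← e1, ← e2]
    refine le_add_of_le_of_nonneg (add_le_add ?_ ?_) (by positivity)
    · rw [← mul_assoc]
      gcongr
      linarith
    · gcongr; linarith
  · refine (h₂ ‖ξ‖ t d (norm_nonneg _) h.le ht).trans ?_
    refine le_add_of_nonneg_of_le (by positivity) ?_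
    gcongr
    linarith

/-- The three errors at low frequencies tend to 0 at the origin, so they are below η on a ball
depending on η and the data. Outside it the solution and the profile are estimated separately, both
with exponential decay. Here C and c may depend on the data and η, which an o(·) statement permits.
-/
theorem exists_evolution_sub_profileSymbol_le {α b ν c₀ μ : ℝ} (hα : α ∈ Set.Ioc (1 / 2 : ℝ) 1)
    (hB : 0 < b * ν) (hc₀ : 0 < c₀) (hμ : 0 < μ) (s : ℝ) (j : Fin 3)
    {d : Fin 3 → Space n → ℂ} {D : ℝ} (hdc : ∀ k, Continuous (d k)) (hd : ∀ k ξ, ‖d k ξ‖ ≤ D)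
    (χ : LowFreqCutoff n) {η : ℝ} (hη : 0 < η) : ∃ C c, 0 < C ∧ 0 < c ∧
    ∀ (ξ : Space n) (t : ℝ), ξ ≠ 0 → 0 ≤ t → (2 * Real.pi * ‖ξ‖) ^ (s + 2 - (j : ℕ)) *
        ‖evolution μ c₀ (b * ν) α (fun k => d k ξ) j t (2 * Real.pi * ‖ξ‖) -
          (d 1 0 + (μ : ℂ)⁻¹ * d 2 0) * profileSymbol c₀ b ν α χ j t ξ‖ ≤
      C * Real.exp (-c * t) * lowWeight n χ.ε₀ (s + 2 - (j : ℕ)) ξ +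
      η * diffusionWeight n χ.ε₀ (s + 1) (b * ν / 4) α t ξ +
      C * Real.exp (-c * t) * ∑ k, (1 + ‖ξ‖ ^ 2) ^ (dataOrder α s j k / 2) * ‖d k ξ‖ := by
  set P := d 1 0 + (μ : ℂ)⁻¹ * d 2 0 with hP
  set C₁ := 300 * (1 + μ⁻¹) ^ 3 * (1 + μ) ^ 2 with hC₁
  have hD : 0 ≤ D := (norm_nonneg _).trans (hd 0 0)
  have hε := χ.pos
  have hx0 : Tendsto (fun ξ : Space n => 2 * Real.pi * ‖ξ‖) (𝓝[≠] 0) (𝓝[>] 0) := by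
    refine tendsto_nhdsWithin_iff.2 ⟨?_, ?_⟩
    · have : Continuous fun ξ : Space n => 2 * Real.pi * ‖ξ‖ := by fun_prop
      have h := this.tendsto 0
      rw [norm_zero, mul_zero] at h
      exact h.mono_left nhdsWithin_le_nhds
    · filter_upwards [self_mem_nhdsWithin] with ξ hξ
      have : ξ ≠ 0 := hξ
      change 0 < 2 * Real.pi * ‖ξ‖
      positivity
  have hbr : Tendsto (fun ξ : Space n => c₀ ^ (j : ℕ) / c₀ * (C₁ * D * (c₀ * (2 * Real.pi * ‖ξ‖)) +
      8 * ‖d 1 ξ + (μ : ℂ)⁻¹ * d 2 ξ - P‖ + 12 * ‖P‖ *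
        (b * ν * (2 * Real.pi * ‖ξ‖) ^ (2 * α) / (c₀ * (2 * Real.pi * ‖ξ‖))))) (𝓝[≠] 0) (𝓝 0) := by
    have t1 : Tendsto (fun ξ : Space n => C₁ * D * (c₀ * (2 * Real.pi * ‖ξ‖))) (𝓝[≠] 0) (𝓝 0) := by
      have : Continuous fun ξ : Space n => C₁ * D * (c₀ * (2 * Real.pi * ‖ξ‖)) := by fun_prop
      have h := this.tendsto 0
      simp only [norm_zero, mul_zero] at h
      exact h.mono_left nhdsWithin_le_nhds
    have t2 : Tendsto (fun ξ : Space n => 8 * ‖d 1 ξ + (μ : ℂ)⁻¹ * d 2 ξ - P‖) (𝓝[≠] 0) (𝓝 0) := by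
      have h1 := hdc 1
      have h2 := hdc 2
      have : Continuous fun ξ : Space n => 8 * ‖d 1 ξ + (μ : ℂ)⁻¹ * d 2 ξ - P‖ := by fun_prop
      have h := this.tendsto 0
      simp only [← hP, sub_self, norm_zero, mul_zero] at h
      exact h.mono_left nhdsWithin_le_nhds
    have t3 : Tendsto (fun ξ : Space n => 12 * ‖P‖ *
        (b * ν * (2 * Real.pi * ‖ξ‖) ^ (2 * α) / (c₀ * (2 * Real.pi * ‖ξ‖)))) (𝓝[≠] 0) (𝓝 0) := by
      have h := (((tendsto_rpow_nhdsGT_zero (q := 2 * α - 1) (by linarith [hα.1])).comp hx0).const_mul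
        (12 * ‖P‖ * (b * ν / c₀)))
      rw [mul_zero] at h
      refine h.congr' ?_
      filter_upwards [hx0 self_mem_nhdsWithin] with ξ hξ
      have hξ : 0 < 2 * Real.pi * ‖ξ‖ := hξ
      rw [Function.comp_apply, Real.rpow_sub hξ, Real.rpow_one]
      field_simp
    simpa using ((t1.add t2).add t3).const_mul (c₀ ^ (j : ℕ) / c₀)
  have hev := (hx0.eventually (eventually_isLowFreq hα hB hc₀ hμ)).and
    ((hbr.eventually_le_const hη).and (hx0.eventually (Ioc_mem_nhdsGT (half_pos hε))))
  obtain ⟨δ', hδ', hδb⟩ := Metric.mem_nhdsWithin_iff.1 hev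
  -- Anything positive up to 2πδ' would do.
  set δ := Real.pi * δ' with hδ
  have hδ0 : 0 < δ := by positivity
  obtain ⟨C₂, c₂, hC₂, hc₂, h₂⟩ := exists_evolution_highFreq_le hα hB hc₀ hμ hδ0 s j
  obtain ⟨C₃, c₃, hC₃, hc₃, h₃⟩ := exists_profileSymbol_le (by linarith [hα.1] : 0 ≤ α) hc₀ hB hδ0
    χ j
  set c := min μ (min c₂ c₃) with hc
  refine ⟨C₁ * D + C₂ + ‖P‖ * C₃, c, by positivity, lt_min hμ (lt_min hc₂ hc₃),
    fun ξ t hξ ht => ?_⟩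
  have hx : 0 < 2 * Real.pi * ‖ξ‖ := by positivity
  have l0 := lowWeight_nonneg (n := n) χ.ε₀ (s + 2 - (j : ℕ)) ξ
  have d0 := diffusionWeight_nonneg (n := n) χ.ε₀ (s + 1) (b * ν / 4) α t ξ
  have s0 : 0 ≤ ∑ k, (1 + ‖ξ‖ ^ 2) ^ (dataOrder α s j k / 2) * ‖d k ξ‖ :=
    Finset.sum_nonneg fun k _ => by positivity
  have m1 : Real.exp (-μ * t) ≤ Real.exp (-c * t) := by
    gcongr; exact min_le_left _ _
  have m2 : Real.exp (-c₂ * t) ≤ Real.exp (-c * t) := by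
    gcongr; exact (min_le_right _ _).trans (min_le_left _ _)
  have m3 : Real.exp (-c₃ * t) ≤ Real.exp (-c * t) := by
    gcongr; exact (min_le_right _ _).trans (min_le_right _ _)
  have mp := Real.exp_pos (-c * t)
  rcases lt_or_ge (2 * Real.pi * ‖ξ‖) δ with h | h
  · have hball : ξ ∈ Metric.ball (0 : Space n) δ' ∩ {0}ᶜ := by
      refine ⟨?_, hξ⟩
      rw [Metric.mem_ball, dist_zero_right]
      have hπ := Real.pi_pos
      have : ‖ξ‖ * Real.pi < δ' * Real.pi := by
        have : 0 ≤ Real.pi * ‖ξ‖ := by positivity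
        linarith
      exact lt_of_mul_lt_mul_right this hπ.le
    obtain ⟨k1, k2, -, k3⟩ := hδb hball
    have hmem : ξ ∈ lowFreq n χ.ε₀ := by
      change 2 * Real.pi * ‖ξ‖ ≤ χ.ε₀
      linarith
    have e1 : lowWeight n χ.ε₀ (s + 2 - (j : ℕ)) ξ = (2 * Real.pi * ‖ξ‖) ^ (s + 2 - (j : ℕ)) :=
      Set.indicator_of_mem hmem _
    have e2 : diffusionWeight n χ.ε₀ (s + 1) (b * ν / 4) α t ξ = (2 * Real.pi * ‖ξ‖) ^ (s + 1) *
        Real.exp (-(b * ν / 4) * (2 * Real.pi * ‖ξ‖) ^ (2 * α) * t) := Set.indicator_of_mem hmem _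
    have hp : profileSymbol c₀ b ν α χ j t ξ = waveSymbol c₀ (b * ν) α j t (2 * Real.pi * ‖ξ‖) := by
      rw [profileSymbol_eq, χ.eq_one _ (by rw [norm_two_pi_smul]; exact k3)]
      simp
    have h1 := evolution_sub_waveSymbol_le hB hμ hc₀ k1 ht s j (fun k => hd k ξ) P
    rw [hp]
    refine h1.trans ?_
    rw [← e1, ← e2]
    refine le_add_of_le_of_nonneg (add_le_add ?_ ?_) (by positivity)
    · rw [← mul_assoc]
      gcongr
      have : 0 ≤ ‖P‖ * C₃ := by positivity
      linarith
    · exact mul_le_mul_of_nonneg_right k2 d0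
  · have h2 := h₂ ‖ξ‖ t (fun k => d k ξ) (norm_nonneg _) h ht
    have h3 := h₃ ξ t h ht
    have e1 : (2 * Real.pi * ‖ξ‖) ^ (s + 2 - (j : ℕ)) * (lowFreq n χ.ε₀).indicator 1 ξ =
        lowWeight n χ.ε₀ (s + 2 - (j : ℕ)) ξ := by
      by_cases hmem : ξ ∈ lowFreq n χ.ε₀
      · rw [lowWeight, Set.indicator_of_mem hmem, Set.indicator_of_mem hmem, Pi.one_apply, mul_one]
      · rw [lowWeight, Set.indicator_of_notMem hmem, Set.indicator_of_notMem hmem, mul_zero]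
    set S := ∑ k, (1 + ‖ξ‖ ^ 2) ^ (dataOrder α s j k / 2) * ‖d k ξ‖
    set L := lowWeight n χ.ε₀ (s + 2 - (j : ℕ)) ξ
    set w := (2 * Real.pi * ‖ξ‖) ^ (s + 2 - (j : ℕ))
    have hw : 0 < w := Real.rpow_pos_of_pos hx _
    set ev := evolution μ c₀ (b * ν) α (fun k => d k ξ) j t (2 * Real.pi * ‖ξ‖)
    set pr := profileSymbol c₀ b ν α χ j t ξ
    have hP3 : w * ‖P * pr‖ ≤ ‖P‖ * C₃ * Real.exp (-c * t) * L := by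
      rw [norm_mul]
      calc w * (‖P‖ * ‖pr‖) ≤ w * (‖P‖ * (C₃ * Real.exp (-c₃ * t) *
          (lowFreq n χ.ε₀).indicator 1 ξ)) := by gcongr
        _ = ‖P‖ * C₃ * Real.exp (-c₃ * t) * L := by rw [← e1]; ring
        _ ≤ _ := by gcongr
    have h2' : w * ‖ev‖ ≤ C₂ * Real.exp (-c * t) * S := h2.trans (by gcongr)
    have h4 : w * ‖ev - P * pr‖ ≤ w * ‖ev‖ + w * ‖P * pr‖ := by
      rw [← mul_add]
      exact mul_le_mul_of_nonneg_left (norm_sub_le _ _) hw.le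
    have z1 : 0 ≤ (C₁ * D + C₂) * Real.exp (-c * t) * L := by positivity
    have z2 : 0 ≤ η * diffusionWeight n χ.ε₀ (s + 1) (b * ν / 4) α t ξ := by positivity
    have z3 : 0 ≤ (C₁ * D + ‖P‖ * C₃) * Real.exp (-c * t) * S := by positivity
    linarith

end Profile

/-! ### Decay of the homogeneous norms -/

section Decay

variable {n : ℕ}

theorem exists_exp_neg_le_rpow {c κ : ℝ} (hc : 0 < c) (hκ : 0 < κ) : ∃ K, 0 < K ∧ ∀ t : ℝ, 0 ≤ t →
    Real.exp (-c * t) ≤ K * (1 + t) ^ (-κ) := by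
  set M := max 1 (κ / c) with hM
  have hM1 : 1 ≤ M := le_max_left _ _
  refine ⟨M ^ κ, by positivity, fun t ht => ?_⟩
  have h1 : 1 + t ≤ M * Real.exp (c / κ * t) := by
    have h2 : 1 ≤ M * (c / κ) := by
      calc 1 = κ / c * (c / κ) := by field_simp
        _ ≤ _ := by gcongr; exact le_max_right _ _
    have h3 := mul_le_mul_of_nonneg_left (Real.add_one_le_exp (c / κ * t)) (by positivity : 0 ≤ M)
    have h4 := mul_le_mul_of_nonneg_right h2 ht
    linarith
  have h2 := Real.rpow_le_rpow (by positivity) h1 hκ.le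
  rw [Real.mul_rpow (by positivity) (by positivity), ← Real.exp_mul] at h2
  have e : c / κ * t * κ = c * t := by field_simp
  rw [e] at h2
  rw [Real.rpow_neg (by positivity), ← div_eq_mul_inv, le_div_iff₀ (by positivity), neg_mul,
    Real.exp_neg, inv_mul_le_iff₀ (Real.exp_pos _)]
  linarith

theorem eLpNorm_le_add_sum {X : Type*} [MeasurableSpace X] {ρ : Measure X} {F : X → ℂ}
    {f g : X → ℝ} {h : Fin 3 → X → ℝ} {a b c : ℝ} (ha : 0 ≤ a) (hb : 0 ≤ b) (hc : 0 ≤ c)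
    (hf : AEStronglyMeasurable f ρ) (hg : AEStronglyMeasurable g ρ)
    (hh : ∀ k, AEStronglyMeasurable (h k) ρ)
    (hF : ∀ᵐ x ∂ρ, ‖F x‖ ≤ a * f x + b * g x + c * ∑ k, h k x) :
    eLpNorm F 2 ρ ≤ ENNReal.ofReal a * eLpNorm f 2 ρ + ENNReal.ofReal b * eLpNorm g 2 ρ +
      ENNReal.ofReal c * ∑ k, eLpNorm (h k) 2 ρ := by
  have hs : AEStronglyMeasurable (∑ k, h k) ρ := Finset.aestronglyMeasurable_sum _ fun k _ => hh k
  have e : ∀ (a : ℝ) (f : X → ℝ), 0 ≤ a →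
      eLpNorm (a • f) 2 ρ = ENNReal.ofReal a * eLpNorm f 2 ρ := fun a f ha => by
    rw [eLpNorm_const_smul, Real.enorm_of_nonneg ha]
  calc eLpNorm F 2 ρ ≤ eLpNorm (a • f + b • g + c • ∑ k, h k) 2 ρ := by
        refine eLpNorm_mono_ae_real ?_
        filter_upwards [hF] with x hx
        simpa [Finset.sum_apply] using hx
    _ ≤ eLpNorm (a • f) 2 ρ + eLpNorm (b • g) 2 ρ + eLpNorm (c • ∑ k, h k) 2 ρ := by
        refine (eLpNorm_add_le ((hf.const_smul a).add (hg.const_smul b)) (hs.const_smul c)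
          one_le_two).trans ?_
        gcongr
        exact eLpNorm_add_le (hf.const_smul a) (hg.const_smul b) one_le_two
    _ ≤ _ := by
        rw [e a f ha, e b g hb, e c _ hc]
        gcongr
        exact eLpNorm_sum_le (fun k _ => hh k) one_le_two

theorem aestronglyMeasurable_lowWeight (R p : ℝ) :
    AEStronglyMeasurable (lowWeight n R p) volume :=
  (Measurable.aestronglyMeasurable (by fun_prop)).indicator (measurableSet_lowFreq n R)

theorem aestronglyMeasurable_diffusionWeight (R p k α t : ℝ) :
    AEStronglyMeasurable (diffusionWeight n R p k α t) volume :=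
  (Measurable.aestronglyMeasurable (by fun_prop)).indicator (measurableSet_lowFreq n R)

theorem exists_eLpNorm_lowWeight_le (hn : n ≠ 0) {p : ℝ} (hp : 0 < 2 * p + n) (R : ℝ) :
    ∃ N : ℝ, 0 < N ∧ eLpNorm (lowWeight n R p) 2 volume ≤ ENNReal.ofReal N := by
  obtain ⟨N, hN, h⟩ := eLpNorm_indicator_rpow_mul_exp_le hn one_pos one_pos hp R
  exact ⟨N, hN, by simpa [lowWeight] using h 0 le_rfl⟩

variable {τ c₀ b ν α : ℝ}

theorem norm_rpow_mul (r : ℝ) (ξ : Space n) (z : ℂ) :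
    ‖(((2 * Real.pi * ‖ξ‖) ^ r : ℝ) : ℂ) * z‖ = (2 * Real.pi * ‖ξ‖) ^ r * ‖z‖ := by
  rw [norm_mul, Complex.norm_real, Real.norm_of_nonneg (by positivity)]

theorem eLpNorm_besselWeight_mul_le (r : ℝ) (d : Lp ℂ 1 (volume : Measure (Space n))) :
    eLpNorm (fun ξ : Space n => (1 + ‖ξ‖ ^ 2) ^ (r / 2) * ‖𝓕 (d : Space n → ℂ) ξ‖) 2 volume ≤
      sobolevNorm r (d : Distr n) := by
  refine le_trans (le_of_eq (eLpNorm_congr_norm_ae (ae_of_all _ fun ξ => ?_)))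
    (eLpNorm_le_sobolevNorm r (hasFourierFunction_L1 d))
  rw [norm_mul, norm_mul, Complex.norm_real, norm_norm]

theorem aestronglyMeasurable_besselWeight_mul (r : ℝ) (d : Lp ℂ 1 (volume : Measure (Space n))) :
    AEStronglyMeasurable
      (fun ξ : Space n => (1 + ‖ξ‖ ^ 2) ^ (r / 2) * ‖𝓕 (d : Space n → ℂ) ξ‖) volume := by
  have := (continuous_fourier_L1 d).measurable
  exact Measurable.aestronglyMeasurable (by fun_prop)

theorem ae_ne_zero (hn : n ≠ 0) : ∀ᵐ ξ : Space n, ξ ≠ 0 := by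
  have : Nonempty (Fin n) := ⟨⟨0, Nat.pos_of_ne_zero hn⟩⟩
  exact compl_mem_ae_iff.2 (measure_singleton (0 : Space n))

theorem sobolevNorm_lt_top {r : ℝ} {u : Distr n} (h : MemSobolev r 2 u) : sobolevNorm r u < ⊤ := by
  obtain ⟨f, hf⟩ := h
  exact (iInf₂_le f hf).trans_lt enorm_lt_top

/-- `hp` makes the diffusion majorant square integrable at the origin, `hr` the exponentially
decaying one. The data enter the pointwise bound only through their L¹ norms and weighted
transforms, so C is uniform. -/
theorem IsCattaneoSolution.exists_homSobolevNorm_le (hn : n ≠ 0) (hτ : 0 < τ) (hc₀ : 0 < c₀)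
    (hB : 0 < b * ν) (hα : α ∈ Set.Ioc (1 / 2 : ℝ) 1) {s : ℝ} {j : Fin 3}
    (hp : 0 < 2 * (s + 1) + n) (hr : 0 < 2 * (s + 2 - (j : ℕ)) + n) : ∃ C : ℝ, 0 < C ∧
    ∀ (data : Fin 3 → Lp ℂ 1 (volume : Measure (Space n))) (φ : Fin 3 → ℝ → Distr n),
      IsCattaneoSolution τ c₀ b ν α data φ → ∀ t : ℝ, 0 ≤ t →
      homSobolevNorm (s + 2 - (j : ℕ)) (φ j t) ≤
        ENNReal.ofReal (C * (1 + t) ^ (-((2 * s + n + 2) / (4 * α)))) * dataNorm α s j data := by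
  have hα0 : 0 < α := by linarith [hα.1]
  have hκe : (2 * (s + 1) + n) / (2 * (2 * α)) = (2 * s + n + 2) / (4 * α) := by ring
  set κ := (2 * s + n + 2) / (4 * α) with hκ
  have hκ0 : 0 < κ := hκe ▸ by positivity
  obtain ⟨R, C, c, hR, hC, hc, hev⟩ := exists_evolution_le hα hB hc₀ (inv_pos.2 hτ) n s j
  obtain ⟨N, hN, hNb⟩ := exists_eLpNorm_lowWeight_le hn hr R
  obtain ⟨N', hN', hNb'⟩ := eLpNorm_indicator_rpow_mul_exp_le hn (by positivity : 0 < 2 * α)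
    (by positivity : 0 < b * ν / 4) hp R
  rw [hκe] at hNb'
  obtain ⟨K, hK, hKb⟩ := exists_exp_neg_le_rpow hc hκ0
  refine ⟨C * K * N + C * N' + C * K, by positivity, fun data φ h t ht => ?_⟩
  rw [homSobolevNorm_eq (h.hasFourierFunction hτ hα0.le j ht)]
  set D := ∑ k, ‖data k‖ with hD
  have hD0 : 0 ≤ D := Finset.sum_nonneg fun k _ => norm_nonneg _
  set Q := (1 + t) ^ (-κ) with hQ
  have hQ0 : 0 < Q := by positivity
  have hDn : ENNReal.ofReal D ≤ dataNorm α s j data := by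
    rw [hD, ENNReal.ofReal_sum_of_nonneg fun k _ => norm_nonneg _]
    refine Finset.sum_le_sum fun k _ => ?_
    rw [ofReal_norm]
    exact le_add_self
  have hSn : ∑ k, eLpNorm (fun ξ : Space n => (1 + ‖ξ‖ ^ 2) ^ (dataOrder α s j k / 2) *
      ‖𝓕 (data k : Space n → ℂ) ξ‖) 2 volume ≤ dataNorm α s j data :=
    Finset.sum_le_sum fun k _ => (eLpNorm_besselWeight_mul_le _ _).trans le_self_add
  have hmain := eLpNorm_le_add_sum (ρ := (volume : Measure (Space n)))
    (F := fun ξ => (((2 * Real.pi * ‖ξ‖) ^ (s + 2 - (j : ℕ)) : ℝ) : ℂ) * ∑ k,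
      dataKernel τ⁻¹ (dampSymbol (b * ν) α ξ) (stiffSymbol c₀ ξ) k j t *
        𝓕 (data k : Space n → ℂ) ξ)
    (a := C * D * Real.exp (-c * t)) (b := C * D) (c := C * Real.exp (-c * t))
    (by positivity) (by positivity) (by positivity)
    (aestronglyMeasurable_lowWeight R (s + 2 - (j : ℕ)))
    (aestronglyMeasurable_diffusionWeight R (s + 1) (b * ν / 4) α t)
    (fun k => aestronglyMeasurable_besselWeight_mul (dataOrder α s j k) (data k)) (by
      filter_upwards [ae_ne_zero hn] with ξ hξ
      rw [norm_rpow_mul]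
      exact hev ξ t D (fun k => 𝓕 (data k : Space n → ℂ) ξ) hξ ht fun k =>
        (norm_fourier_L1_le _ _).trans
          (Finset.single_le_sum (fun k _ => norm_nonneg (data k)) (Finset.mem_univ k)))
  refine hmain.trans ?_
  have b1 : ENNReal.ofReal (C * D * Real.exp (-c * t)) *
      eLpNorm (lowWeight n R (s + 2 - (j : ℕ))) 2 volume ≤
      ENNReal.ofReal (C * K * N * Q) * dataNorm α s j data := by
    calc _ ≤ ENNReal.ofReal (C * D * (K * Q)) * ENNReal.ofReal N := by
          gcongr; exact hKb t ht
      _ = ENNReal.ofReal (C * K * N * Q) * ENNReal.ofReal D := by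
          rw [← ENNReal.ofReal_mul (by positivity), ← ENNReal.ofReal_mul (by positivity)]
          ring_nf
      _ ≤ _ := by gcongr
  have b2 : ENNReal.ofReal (C * D) * eLpNorm (diffusionWeight n R (s + 1) (b * ν / 4) α t) 2 volume ≤
      ENNReal.ofReal (C * N' * Q) * dataNorm α s j data := by
    calc _ ≤ ENNReal.ofReal (C * D) * ENNReal.ofReal (N' * Q) := by
          gcongr; exact hNb' t ht
      _ = ENNReal.ofReal (C * N' * Q) * ENNReal.ofReal D := by
          rw [← ENNReal.ofReal_mul (by positivity), ← ENNReal.ofReal_mul (by positivity)]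
          ring_nf
      _ ≤ _ := by gcongr
  have b3 := mul_le_mul' (ENNReal.ofReal_le_ofReal
    (mul_le_mul_of_nonneg_left (hKb t ht) hC.le)) hSn
  refine (add_le_add (add_le_add b1 b2) b3).trans (le_of_eq ?_)
  rw [← add_mul, ← add_mul, ← ENNReal.ofReal_add (by positivity) (by positivity),
    ← ENNReal.ofReal_add (by positivity) (by positivity), ← hQ]
  congr 2
  ring

theorem hasFourierFunction_profile (hα : α ∈ Set.Ioc (1 / 2 : ℝ) 1) (χ : LowFreqCutoff n) (j : ℕ)
    (t : ℝ) : HasFourierFunction (profile c₀ b ν hα χ j t) (profileSymbol c₀ b ν α χ j t) :=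
  (hasFourierFunction_fourierInv _).congr (profileSymbol_memLp c₀ b ν hα χ j t).coeFn_toLp

/-- The difference between the solution and the diffusion wave is of lower order. -/
theorem IsCattaneoSolution.eventually_homSobolevNorm_sub_le (hn : n ≠ 0) (hτ : 0 < τ) (hc₀ : 0 < c₀)
    (hB : 0 < b * ν) (hα : α ∈ Set.Ioc (1 / 2 : ℝ) 1) {s : ℝ} {j : Fin 3}
    (hp : 0 < 2 * (s + 1) + n) (hr : 0 < 2 * (s + 2 - (j : ℕ)) + n)
    {data : Fin 3 → Lp ℂ 1 (volume : Measure (Space n))} (hdata : MemDataSpace α s j data)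
    {φ : Fin 3 → ℝ → Distr n} (h : IsCattaneoSolution τ c₀ b ν α data φ) (χ : LowFreqCutoff n)
    {η : ℝ} (hη : 0 < η) : ∀ᶠ t : ℝ in atTop, homSobolevNorm (s + 2 - (j : ℕ))
      (φ j t - dataMean τ data • profile c₀ b ν hα χ j t) ≤
        ENNReal.ofReal (η * t ^ (-((2 * s + n + 2) / (4 * α)))) := by
  have hα0 : 0 < α := by linarith [hα.1]
  have hκe : (2 * (s + 1) + n) / (2 * (2 * α)) = (2 * s + n + 2) / (4 * α) := by ring
  set κ := (2 * s + n + 2) / (4 * α) with hκ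
  have hκ0 : 0 < κ := hκe ▸ by positivity
  obtain ⟨N, hN, hNb⟩ := exists_eLpNorm_lowWeight_le hn hr χ.ε₀
  obtain ⟨N', hN', hNb'⟩ := eLpNorm_indicator_rpow_mul_exp_le hn (by positivity : 0 < 2 * α)
    (by positivity : 0 < b * ν / 4) hp χ.ε₀
  rw [hκe] at hNb'
  set D := ∑ k, ‖data k‖ with hD
  -- The small constant η/(2N') lets the diffusion term use half of the allowance η t^(-κ); the
  -- exponential terms fit into the other half for large t.
  obtain ⟨C, c, hC, hc, hev⟩ := exists_evolution_sub_profileSymbol_le hα hB hc₀ (inv_pos.2 hτ) s j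
    (d := fun k => 𝓕 (data k : Space n → ℂ)) (D := D) (fun k => continuous_fourier_L1 (data k))
    (fun k ξ => (norm_fourier_L1_le _ _).trans
      (Finset.single_le_sum (fun k _ => norm_nonneg (data k)) (Finset.mem_univ k))) χ
    (div_pos (half_pos hη) hN')
  set S := ∑ k, eLpNorm (fun ξ : Space n => (1 + ‖ξ‖ ^ 2) ^ (dataOrder α s j k / 2) *
      ‖𝓕 (data k : Space n → ℂ) ξ‖) 2 volume with hS
  have hStop : S < ⊤ := ENNReal.sum_lt_top.2 fun k _ =>
    (eLpNorm_besselWeight_mul_le _ _).trans_lt (sobolevNorm_lt_top (hdata k))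
  have hlim : Tendsto (fun t : ℝ => (C * N + C * S.toReal) * (t ^ κ * Real.exp (-c * t))) atTop
      (𝓝 0) := by
    simpa using (tendsto_rpow_mul_exp_neg_mul_atTop_nhds_zero κ c hc).const_mul
      (C * N + C * S.toReal)
  filter_upwards [hlim.eventually_le_const (half_pos hη), eventually_gt_atTop 0] with t hlt ht
  have hP : dataMean τ data = 𝓕 (data 1 : Space n → ℂ) 0 +
      ((τ⁻¹ : ℝ) : ℂ)⁻¹ * 𝓕 (data 2 : Space n → ℂ) 0 := by
    rw [dataMean_eq]; simp
  rw [homSobolevNorm_eq ((h.hasFourierFunction hτ hα0.le j ht.le).sub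
    ((hasFourierFunction_profile hα χ j t).smul (dataMean τ data)))]
  have hmain := eLpNorm_le_add_sum (ρ := (volume : Measure (Space n)))
    (F := fun ξ => (((2 * Real.pi * ‖ξ‖) ^ (s + 2 - (j : ℕ)) : ℝ) : ℂ) * (∑ k,
      dataKernel τ⁻¹ (dampSymbol (b * ν) α ξ) (stiffSymbol c₀ ξ) k j t *
        𝓕 (data k : Space n → ℂ) ξ - dataMean τ data * profileSymbol c₀ b ν α χ j t ξ))
    (a := C * Real.exp (-c * t)) (b := η / 2 / N') (c := C * Real.exp (-c * t))
    (by positivity) (by positivity) (by positivity)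
    (aestronglyMeasurable_lowWeight χ.ε₀ (s + 2 - (j : ℕ)))
    (aestronglyMeasurable_diffusionWeight χ.ε₀ (s + 1) (b * ν / 4) α t)
    (fun k => aestronglyMeasurable_besselWeight_mul (dataOrder α s j k) (data k)) (by
      filter_upwards [ae_ne_zero hn] with ξ hξ
      rw [norm_rpow_mul, hP]
      exact hev ξ t hξ ht.le)
  refine hmain.trans ?_
  rw [← hS, ← ENNReal.ofReal_toReal hStop.ne]
  have hQ : (1 + t) ^ (-κ) ≤ t ^ (-κ) :=
    Real.rpow_le_rpow_of_nonpos ht (by linarith) (by linarith)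
  have b2 : eLpNorm (diffusionWeight n χ.ε₀ (s + 1) (b * ν / 4) α t) 2 volume ≤
      ENNReal.ofReal (N' * t ^ (-κ)) :=
    (hNb' t ht.le).trans (ENNReal.ofReal_le_ofReal (by gcongr))
  refine (add_le_add (add_le_add (mul_le_mul_right hNb _) (mul_le_mul_right b2 _)) le_rfl).trans ?_
  rw [← ENNReal.ofReal_mul (by positivity), ← ENNReal.ofReal_mul (by positivity),
    ← ENNReal.ofReal_mul (by positivity), ← ENNReal.ofReal_add (by positivity) (by positivity),
    ← ENNReal.ofReal_add (by positivity) (by positivity)]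
  refine ENNReal.ofReal_le_ofReal ?_
  have e : t ^ κ * t ^ (-κ) = 1 := by rw [← Real.rpow_add ht]; simp
  have hl := mul_le_mul_of_nonneg_right hlt (by positivity : 0 ≤ t ^ (-κ))
  have e1 : (C * N + C * S.toReal) * (t ^ κ * Real.exp (-c * t)) * t ^ (-κ) =
      (C * N + C * S.toReal) * Real.exp (-c * t) * (t ^ κ * t ^ (-κ)) := by ring
  rw [e1, e, mul_one] at hl
  have e2 : η / 2 / N' * (N' * t ^ (-κ)) = η / 2 * t ^ (-κ) := by field_simp
  rw [e2]
  linarith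

theorem tendsto_rpow_mul_of_eventually_le {κ : ℝ} {X : ℝ → ℝ≥0∞}
    (h : ∀ η : ℝ, 0 < η → ∀ᶠ t in atTop, X t ≤ ENNReal.ofReal (η * t ^ (-κ))) :
    Tendsto (fun t : ℝ => ENNReal.ofReal (t ^ κ) * X t) atTop (𝓝 0) := by
  rw [ENNReal.tendsto_nhds_zero]
  intro ε hε
  rcases eq_or_ne ε ⊤ with rfl | hε'
  · exact Eventually.of_forall fun t => le_top
  filter_upwards [h ε.toReal (ENNReal.toReal_pos hε.ne' hε'), eventually_gt_atTop 0] with t h1 ht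
  calc _ ≤ ENNReal.ofReal (t ^ κ) * ENNReal.ofReal (ε.toReal * t ^ (-κ)) := by gcongr
    _ = ENNReal.ofReal ε.toReal := by
        rw [← ENNReal.ofReal_mul (by positivity), mul_left_comm, ← Real.rpow_add ht]
        simp
    _ = ε := ENNReal.ofReal_toReal hε'

/-- A cut-off to low frequencies. -/
def bumpCutoff (n : ℕ) : LowFreqCutoff n :=
  let f : ContDiffBump (0 : Space n) := ⟨1 / 2, 1, by norm_num, by norm_num⟩
  { ε₀ := 1
    pos := one_pos
    toFun := f
    smooth := f.contDiff
    eq_one := fun ξ hξ => f.one_of_mem_closedBall (by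
      rw [Metric.mem_closedBall, dist_zero_right]; exact hξ)
    eq_zero := fun ξ hξ => f.zero_of_le_dist (by rw [dist_zero_right]; exact hξ) }

/-- Where the cut-off equals 1 and ξ ≠ 0, the weighted profile is in modulus a constant times
x^(s+1) times |sin| or |cos| times the exponential: sine for j = 0, 2, cosine for j = 1. -/
theorem exists_le_eLpNorm_profileSymbol (hn : n ≠ 0) (hc₀ : 0 < c₀) (hB : 0 < b * ν)
    (hα : α ∈ Set.Ioc (1 / 2 : ℝ) 1) (s : ℝ) (j : Fin 3) (χ : LowFreqCutoff n) :
    ∃ c T : ℝ, 0 < c ∧ 0 < T ∧ ∀ t : ℝ, T ≤ t →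
      ENNReal.ofReal (c * t ^ (-((2 * s + n + 2) / (4 * α)))) ≤
      eLpNorm (fun ξ => (((2 * Real.pi * ‖ξ‖) ^ (s + 2 - (j : ℕ)) : ℝ) : ℂ) *
        profileSymbol c₀ b ν α χ j t ξ) 2 volume := by
  have hκe : (2 * (s + 1) + n) / (2 * (2 * α)) = (2 * s + n + 2) / (4 * α) := by ring
  have hwave : ∃ f : ℝ → ℝ, (f = Real.sin ∨ f = Real.cos) ∧ ∀ x t : ℝ, 0 < x →
      c₀ ^ (j : ℕ) / c₀ * |x ^ (s + 1) * f (c₀ * x * t) *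
        Real.exp (-(b * ν / 2) * x ^ (2 * α) * t)| =
      x ^ (s + 2 - (j : ℕ)) * |waveSymbol c₀ (b * ν) α j t x| := by
    have e : ∀ x t : ℝ, -(b * ν * x ^ (2 * α) / 2) * t = -(b * ν / 2) * x ^ (2 * α) * t :=
      fun x t => by ring
    fin_cases j
    · refine ⟨Real.sin, Or.inl rfl, fun x t hx => ?_⟩
      have ha : 0 < c₀ * x := by positivity
      change c₀ ^ 0 / c₀ * _ = x ^ (s + 2 - ((0 : ℕ) : ℝ)) * |waveSymbol c₀ (b * ν) α 0 t x|
      rw [waveSymbol, (iteratedDeriv_sin_mul_div ha.ne' t).1, e, abs_mul, abs_mul, abs_mul, abs_div,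
        abs_of_pos ha, abs_of_pos (Real.rpow_pos_of_pos hx _)]
      have : x ^ (s + 2 - ((0 : ℕ) : ℝ)) = x ^ (s + 1) * x := by
        rw [← Real.rpow_add_one hx.ne']; congr 1; push_cast; ring
      rw [this]
      field_simp
    · refine ⟨Real.cos, Or.inr rfl, fun x t hx => ?_⟩
      have ha : 0 < c₀ * x := by positivity
      change c₀ ^ 1 / c₀ * _ = x ^ (s + 2 - ((1 : ℕ) : ℝ)) * |waveSymbol c₀ (b * ν) α 1 t x|
      rw [waveSymbol, (iteratedDeriv_sin_mul_div ha.ne' t).2.1, e, abs_mul, abs_mul, abs_mul,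
        abs_of_pos (Real.rpow_pos_of_pos hx _)]
      have : x ^ (s + 2 - ((1 : ℕ) : ℝ)) = x ^ (s + 1) := by congr 1; push_cast; ring
      rw [this]
      field_simp
    · refine ⟨Real.sin, Or.inl rfl, fun x t hx => ?_⟩
      have ha : 0 < c₀ * x := by positivity
      change c₀ ^ 2 / c₀ * _ = x ^ (s + 2 - ((2 : ℕ) : ℝ)) * |waveSymbol c₀ (b * ν) α 2 t x|
      rw [waveSymbol, (iteratedDeriv_sin_mul_div ha.ne' t).2.2, e, abs_mul, abs_mul, abs_mul,
        abs_neg, abs_mul, abs_of_pos ha, abs_of_pos (Real.rpow_pos_of_pos hx _),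
        Real.rpow_add_one hx.ne']
      have : x ^ (s + 2 - ((2 : ℕ) : ℝ)) = x ^ s := by congr 1; push_cast; ring
      rw [this]
      field_simp
  obtain ⟨f, hf, hwave⟩ := hwave
  have hε := χ.pos
  obtain ⟨c, T, hc, hT, hosc⟩ := le_eLpNorm_indicator_rpow_mul_osc hn hf (p := s + 1)
    (by linarith [hα.1] : 1 < 2 * α) (by positivity : 0 < b * ν / 2) hc₀ (half_pos hε)
  rw [hκe] at hosc
  refine ⟨c₀ ^ (j : ℕ) / c₀ * c, T, by positivity, hT, fun t ht => ?_⟩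
  rw [mul_assoc, ENNReal.ofReal_mul (by positivity)]
  refine (mul_le_mul_right (hosc t ht) _).trans ?_
  rw [← Real.enorm_of_nonneg (by positivity : 0 ≤ c₀ ^ (j : ℕ) / c₀), ← eLpNorm_const_smul]
  refine eLpNorm_mono_ae ?_
  filter_upwards [ae_ne_zero hn] with ξ hξ
  have hx : 0 < 2 * Real.pi * ‖ξ‖ := by positivity
  rw [norm_rpow_mul, Pi.smul_apply, norm_smul, Real.norm_of_nonneg (by positivity)]
  by_cases hmem : ξ ∈ lowFreq n (χ.ε₀ / 2)
  · rw [Set.indicator_of_mem hmem, Real.norm_eq_abs, hwave _ _ hx, profileSymbol_eq,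
      χ.eq_one _ (by rw [norm_two_pi_smul]; exact hmem), Complex.ofReal_one, one_mul,
      Complex.norm_real, Real.norm_eq_abs]
  · rw [Set.indicator_of_notMem hmem, norm_zero, mul_zero]
    positivity

/-- The triangle inequality: the norm of the profile times P is at least c|P| t^(-κ), and the
difference is eventually at most half of that. One fixed cut-off keeps c independent of the data. -/
theorem IsCattaneoSolution.exists_le_homSobolevNorm (hn : n ≠ 0) (hτ : 0 < τ) (hc₀ : 0 < c₀)
    (hB : 0 < b * ν) (hα : α ∈ Set.Ioc (1 / 2 : ℝ) 1) {s : ℝ} {j : Fin 3}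
    (hp : 0 < 2 * (s + 1) + n) (hr : 0 < 2 * (s + 2 - (j : ℕ)) + n) : ∃ c : ℝ, 0 < c ∧
    ∀ data : Fin 3 → Lp ℂ 1 (volume : Measure (Space n)), MemDataSpace α s j data →
      dataMean τ data ≠ 0 → ∀ φ, IsCattaneoSolution τ c₀ b ν α data φ →
        ∃ T : ℝ, 0 < T ∧ ∀ t : ℝ, T ≤ t →
          ENNReal.ofReal (c * t ^ (-((2 * s + n + 2) / (4 * α))) * ‖dataMean τ data‖) ≤
            homSobolevNorm (s + 2 - (j : ℕ)) (φ j t) := by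
  have hα0 : 0 < α := by linarith [hα.1]
  obtain ⟨c, T, hc, hT, hlow⟩ := exists_le_eLpNorm_profileSymbol hn hc₀ hB hα s j (bumpCutoff n)
  refine ⟨c / 2, half_pos hc, fun data hdata hP φ h => ?_⟩
  have hP0 : 0 < ‖dataMean τ data‖ := norm_pos_iff.2 hP
  obtain ⟨T', hT'⟩ := eventually_atTop.1 (h.eventually_homSobolevNorm_sub_le hn hτ hc₀ hB hα hp hr
    hdata (bumpCutoff n) (by positivity : 0 < c / 2 * ‖dataMean τ data‖))
  refine ⟨max T T', lt_max_of_lt_left hT, fun t ht => ?_⟩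
  have hl := hlow t ((le_max_left _ _).trans ht)
  have hd := hT' t ((le_max_right _ _).trans ht)
  have ht0 : 0 < t := hT.trans_le ((le_max_left _ _).trans ht)
  have hsol := h.hasFourierFunction hτ hα0.le j ht0.le
  have hpro := (hasFourierFunction_profile (c₀ := c₀) (b := b) (ν := ν) hα (bumpCutoff n) j t).smul
    (dataMean τ data)
  rw [homSobolevNorm_eq (hsol.sub hpro)] at hd
  rw [homSobolevNorm_eq hsol]
  set u : Space n → ℂ := fun ξ => ∑ k, dataKernel τ⁻¹ (dampSymbol (b * ν) α ξ) (stiffSymbol c₀ ξ)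
    k j t * 𝓕 (data k : Space n → ℂ) ξ
  set g : Space n → ℂ := profileSymbol c₀ b ν α (bumpCutoff n) j t
  set w : Space n → ℂ := fun ξ => (((2 * Real.pi * ‖ξ‖) ^ (s + 2 - (j : ℕ)) : ℝ) : ℂ)
  set Q := t ^ (-((2 * s + n + 2) / (4 * α)))
  have hQ0 : 0 < Q := Real.rpow_pos_of_pos ht0 _
  have hw : AEStronglyMeasurable w volume := Measurable.aestronglyMeasurable (by fun_prop)
  have hmeas : ∀ {u : Distr n} {g : Space n → ℂ}, HasFourierFunction u g →
      AEStronglyMeasurable (fun ξ => w ξ * g ξ) volume := fun h =>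
    hw.mul (locallyIntegrable_of_schwartz_mul fun f => (h f).1).aestronglyMeasurable
  have h1 : ENNReal.ofReal (c * Q * ‖dataMean τ data‖) ≤
      eLpNorm (fun ξ => w ξ * (dataMean τ data * g ξ)) 2 volume := by
    have e : (fun ξ => w ξ * (dataMean τ data * g ξ)) = dataMean τ data • fun ξ => w ξ * g ξ := by
      ext ξ; simp only [Pi.smul_apply, smul_eq_mul]; ring
    rw [e, eLpNorm_const_smul, ENNReal.ofReal_mul (by positivity), ofReal_norm, mul_comm]
    gcongr
  have h2 : eLpNorm (fun ξ => w ξ * (dataMean τ data * g ξ)) 2 volume ≤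
      eLpNorm (fun ξ => w ξ * u ξ) 2 volume +
      eLpNorm (fun ξ => w ξ * (u ξ - dataMean τ data * g ξ)) 2 volume := by
    refine le_trans (le_of_eq ?_) (eLpNorm_sub_le (hmeas hsol) (hmeas (hsol.sub hpro)) one_le_two)
    congr 1; ext ξ; simp only [Pi.sub_apply]; ring
  have h3 := h1.trans (h2.trans (add_le_add le_rfl hd))
  have e : c * Q * ‖dataMean τ data‖ = c / 2 * Q * ‖dataMean τ data‖ +
      c / 2 * ‖dataMean τ data‖ * Q := by ring
  rw [e, ENNReal.ofReal_add (by positivity) (by positivity)] at h3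
  exact (ENNReal.add_le_add_iff_right ENNReal.ofReal_ne_top).1 h3

end Decay

end

/-! ### Both parts of the theorem -/

theorem mainTheorem5 (n : ℕ) (hn : 3 ≤ n) (τ c₀ b ν α : ℝ)
    (hτ : 0 < τ) (hc₀ : 0 < c₀) (hb : 0 < b) (hν : 0 < ν) (hsmall : b * ν < 2 * c₀)
    (hα : α ∈ Set.Ioc (1 / 2 : ℝ) 1) :
    (∀ (j : Fin 3) (s : ℝ), (s = ((j : ℕ) : ℝ) - 2 ∨ 0 ≤ s) →
      (∃ C : ℝ, 0 < C ∧ ∀ data : Fin 3 → Lp ℂ 1 (volume : Measure (Space n)),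
        MemDataSpace α s j data → ∀ φ, IsCattaneoSolution τ c₀ b ν α data φ →
          ∀ t : ℝ, 0 ≤ t → homSobolevNorm (s + 2 - ((j : ℕ) : ℝ)) (φ j t) ≤
            ENNReal.ofReal (C * (1 + t) ^ (-((2 * s + n + 2) / (4 * α)))) *
              dataNorm α s j data) ∧
      (∀ data : Fin 3 → Lp ℂ 1 (volume : Measure (Space n)),
        MemDataSpace α s j data → ∀ φ, IsCattaneoSolution τ c₀ b ν α data φ →
          ∀ χ : LowFreqCutoff n,
            Tendsto (fun t : ℝ => ENNReal.ofReal (t ^ ((2 * s + n + 2) / (4 * α))) *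
              homSobolevNorm (s + 2 - ((j : ℕ) : ℝ))
                (φ j t - dataMean τ data • profile c₀ b ν hα χ j t)) atTop (𝓝 0)) ∧
      (∃ c : ℝ, 0 < c ∧ ∀ data : Fin 3 → Lp ℂ 1 (volume : Measure (Space n)),
        MemDataSpace α s j data → dataMean τ data ≠ 0 →
          ∀ φ, IsCattaneoSolution τ c₀ b ν α data φ →
            ∃ T : ℝ, 0 < T ∧ ∀ t : ℝ, T ≤ t →
              ENNReal.ofReal (c * t ^ (-((2 * s + n + 2) / (4 * α))) * ‖dataMean τ data‖) ≤
                homSobolevNorm (s + 2 - ((j : ℕ) : ℝ)) (φ j t))) ∧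
    (∀ s : ℝ, 0 ≤ s →
      (∃ C : ℝ, 0 < C ∧ ∀ data : Fin 3 → Lp ℂ 1 (volume : Measure (Space n)),
        MemDataSpace α (s + 1 - 2 * α) 2 data → ∀ φ, IsCattaneoSolution τ c₀ b ν α data φ →
          ∀ t : ℝ, 0 ≤ t → homSobolevNorm (s + 1 - 2 * α) (φ 2 t) ≤
            ENNReal.ofReal (C * (1 + t) ^ (-((2 * s + n + 4 - 4 * α) / (4 * α)))) *
              dataNorm α (s + 1 - 2 * α) 2 data) ∧
      (∀ data : Fin 3 → Lp ℂ 1 (volume : Measure (Space n)),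
        MemDataSpace α (s + 1 - 2 * α) 2 data → ∀ φ, IsCattaneoSolution τ c₀ b ν α data φ →
          ∀ χ : LowFreqCutoff n,
            Tendsto (fun t : ℝ => ENNReal.ofReal (t ^ ((2 * s + n + 4 - 4 * α) / (4 * α))) *
              homSobolevNorm (s + 1 - 2 * α)
                (φ 2 t - dataMean τ data • profile c₀ b ν hα χ 2 t)) atTop (𝓝 0)) ∧
      (∃ c : ℝ, 0 < c ∧ ∀ data : Fin 3 → Lp ℂ 1 (volume : Measure (Space n)),
        MemDataSpace α (s + 1 - 2 * α) 2 data → dataMean τ data ≠ 0 →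
          ∀ φ, IsCattaneoSolution τ c₀ b ν α data φ →
            ∃ T : ℝ, 0 < T ∧ ∀ t : ℝ, T ≤ t →
              ENNReal.ofReal (c * t ^ (-((2 * s + n + 4 - 4 * α) / (4 * α))) *
                ‖dataMean τ data‖) ≤ homSobolevNorm (s + 1 - 2 * α) (φ 2 t))) := by
  have hB : 0 < b * ν := by positivity
  have hn0 : n ≠ 0 := by omega
  have hn3 : (3 : ℝ) ≤ n := by exact_mod_cast hn
  -- A common range for both parts: s ≥ -2 and norm order at least -1 give 2(s+1) + n ≥ 1 and
  -- 2(s+2-j) + n ≥ 1, because n ≥ 3.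
  have main : ∀ (j : Fin 3) (s : ℝ), -2 ≤ s → -1 ≤ s + 2 - ((j : ℕ) : ℝ) →
      (∃ C : ℝ, 0 < C ∧ ∀ data : Fin 3 → Lp ℂ 1 (volume : Measure (Space n)),
        MemDataSpace α s j data → ∀ φ, IsCattaneoSolution τ c₀ b ν α data φ →
          ∀ t : ℝ, 0 ≤ t → homSobolevNorm (s + 2 - ((j : ℕ) : ℝ)) (φ j t) ≤
            ENNReal.ofReal (C * (1 + t) ^ (-((2 * s + n + 2) / (4 * α)))) *
              dataNorm α s j data) ∧
      (∀ data : Fin 3 → Lp ℂ 1 (volume : Measure (Space n)),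
        MemDataSpace α s j data → ∀ φ, IsCattaneoSolution τ c₀ b ν α data φ →
          ∀ χ : LowFreqCutoff n,
            Tendsto (fun t : ℝ => ENNReal.ofReal (t ^ ((2 * s + n + 2) / (4 * α))) *
              homSobolevNorm (s + 2 - ((j : ℕ) : ℝ))
                (φ j t - dataMean τ data • profile c₀ b ν hα χ j t)) atTop (𝓝 0)) ∧
      (∃ c : ℝ, 0 < c ∧ ∀ data : Fin 3 → Lp ℂ 1 (volume : Measure (Space n)),
        MemDataSpace α s j data → dataMean τ data ≠ 0 →
          ∀ φ, IsCattaneoSolution τ c₀ b ν α data φ →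
            ∃ T : ℝ, 0 < T ∧ ∀ t : ℝ, T ≤ t →
              ENNReal.ofReal (c * t ^ (-((2 * s + n + 2) / (4 * α))) * ‖dataMean τ data‖) ≤
                homSobolevNorm (s + 2 - ((j : ℕ) : ℝ)) (φ j t)) := by
    intro j s hs hr
    have hp' : 0 < 2 * (s + 1) + n := by linarith
    have hr' : 0 < 2 * (s + 2 - ((j : ℕ) : ℝ)) + n := by linarith
    refine ⟨?_, fun data hdata φ hφ χ => tendsto_rpow_mul_of_eventually_le fun η hη =>
      hφ.eventually_homSobolevNorm_sub_le hn0 hτ hc₀ hB hα hp' hr' hdata χ hη,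
      IsCattaneoSolution.exists_le_homSobolevNorm hn0 hτ hc₀ hB hα hp' hr'⟩
    obtain ⟨C, hC, h⟩ := IsCattaneoSolution.exists_homSobolevNorm_le hn0 hτ hc₀ hB hα hp' hr'
    exact ⟨C, hC, fun data _ φ hφ => h data φ hφ⟩
  refine ⟨fun j s hs => ?_, fun s hs => ?_⟩
  · have hj : ((j : ℕ) : ℝ) ≤ 2 := by exact_mod_cast Nat.le_of_lt_succ j.isLt
    have hj0 : (0 : ℝ) ≤ ((j : ℕ) : ℝ) := Nat.cast_nonneg _
    rcases hs with rfl | hs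
    · exact main j _ (by linarith) (by linarith)
    · exact main j s (by linarith) (by linarith)
  -- Part (ii) is the case j = 2 with s + 1 - 2α in place of s. This order may be negative, but it
  -- is at least -1 since α ≤ 1.
  · have h := main 2 (s + 1 - 2 * α) (by linarith [hα.2])
      (by rw [Fin.val_two, Nat.cast_ofNat]; linarith [hα.2])
    have e1 : 2 * (s + 1 - 2 * α) + n + 2 = 2 * s + n + 4 - 4 * α := by ring
    have e2 : s + 1 - 2 * α + 2 - (((2 : Fin 3) : ℕ) : ℝ) = s + 1 - 2 * α := by
      rw [Fin.val_two, Nat.cast_ofNat]; ring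
    rw [e1, e2] at h
    exact h
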